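/- Let $X=(X,d,\mu)$ be a metric measure space, where $\mu$ is a Borel regular outer measure for which every ball $B(x,r)=\{y:d(x,y)<r\}$ has positive and finite measure, and suppose that there are constants $C_0>0$ and $Q>0$ such that $$\frac{\mu(B(y,r))}{\mu(B(x,R))}\ge C_0\Big(\frac rR\Big)^Q\qquad\text{for all }x\in X,\ 0<r\le R,\ y\in B(x,R).$$ Let $\mathcal B=\bigcup_{x\in X}\mathcal B(x)$ be a Busemann--Feller basis on $X$: each $\mathcal B(x)$ consists of bounded open sets containing $x$, for every $x\in X$ and $\varepsilon>0$ there is $B\in\mathcal B(x)$ with $\operatorname{diam}B<\varepsilon$, and $x\in B\in\mathcal B$ implies $B\in\mathcal B(x)$. Upper limits along $\mathcal B$ are defined by $\limsup_{\mathcal B\ni B\to x}\varphi(B)=\lim_{\varepsilon\to0}\sup\{\varphi(B):B\in\mathcal B(x),\ \operatorname{diam}B<\varepsilon\}$; lower limits are defined with $\inf$ in place of $\sup$, and $\lim_{\mathcal B\ni B\to x}\varphi(B)$ is their common value when they coincide. Write $u_B=\mu(B)^{-1}\int_Bu\,d\mu$. For $0<s<\infty$ and a measurable, almost everywhere finite $u:X\to[-\infty,\infty]$,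 a fractional $s$-gradient of $u$ is a sequence $(g_k)_{k\in\mathbb Z}$ of measurable functions $g_k:X\to[0,\infty]$ for which there is a set $E$ with $\mu(E)=0$ such that $|u(x)-u(y)|\le d(x,y)^s(g_k(x)+g_k(y))$ for all $k\in\mathbb Z$ and all $x,y\in X\setminus E$ with $2^{-k-1}\le d(x,y)<2^{-k}$. For $0<p<\infty$ and $0<q\le\infty$, the Hajłasz--Triebel--Lizorkin space $M^s_{p,q}(X)$ and the Hajłasz--Besov space $N^s_{p,q}(X)$ consist of those $u$ for which, respectively, $$\|u\|_{M^s_{p,q}}=\|u\|_{L^p}+\inf_{(g_k)}\big\|\,\|(g_k)_k\|_{l^q}\big\|_{L^p},\qquad \|u\|_{N^s_{p,q}}=\|u\|_{L^p}+\inf_{(g_k)}\big\|\big(\|g_k\|_{L^p}\big)_k\big\|_{l^q}$$ is finite, the infima being over all fractional $s$-gradients of $u$. Let $Q/(Q+s)<p<\infty$, and let either $\mathcal F\in\{N^s_{p,q}(X),M^s_{p,q}(X)\}$ with $0<s<1$ and $0<q<\infty$, or $\mathcal F=M^s_{p,\infty}(X)$ (the Hajłasz space $M^{s,p}(X)$)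 with $0<s\le1$. The $\mathcal F$-capacity of $E\subset X$ is $$C_{\mathcal F}(E)=\inf\{\|u\|_{\mathcal F}^p:u\in\mathcal F,\ u\ge1\text{ on a neighbourhood of }E\},$$ and $u:X\to[-\infty,\infty]$ is quasicontinuous if for every $\varepsilon>0$ there is $E\subset X$ with $C_{\mathcal F}(E)<\varepsilon$ such that $u|_{X\setminus E}$ is continuous. Then every $u\in\mathcal F$ is integrable on every ball, and the following claims are equivalent. 1. For every quasicontinuous $u\in\mathcal F$ there is a set $E$ with $C_{\mathcal F}(E)=0$ such that $\lim_{\mathcal B\ni B\to x}u_B=u(x)$ for every $x\in X\setminus E$. 2. There is a constant $C$ such that $$C_{\mathcal F}\big(\{x\in X:\limsup_{\mathcal B\ni B\to x}|u|_B>\lambda\}\big)\le C\lambda^{-p}\|u\|_{\mathcal F}^p$$ for every $\lambda>0$ and $u\in\mathcal F$. 3. For each $\lambda>0$ and each sequence $(u_k)$ in $\mathcal F$ with $\|u_k\|_{\mathcal F}\to0$ as $k\to\infty$, $$C_{\mathcal F}\big(\{x\in X:\limsup_{\mathcal B\ni B\to x}|u_k|_B>\lambda\}\big)\to0\quad\text{as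 }k\to\infty.$$ -/

import Mathlib

open MeasureTheory Filter Topology Set
open scoped ENNReal NNReal

namespace HajlaszAverages

noncomputable section

variable {X : Type*} [MetricSpace X] [MeasurableSpace X]

/-- Every ball has positive and finite measure. -/
def BallsPosFinite (μ : Measure X) : Prop :=
  ∀ (x : X) (r : ℝ), 0 < r → 0 < μ (Metric.ball x r) ∧ μ (Metric.ball x r) < ∞

/-- The doubling condition with exponent `Q`: for some constant `C > 0`,
`μ(B(y,r)) / μ(B(x,R)) ≥ C (r/R)^Q` whenever `0 < r ≤ R` and `y ∈ B(x,R)`. -/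
def HasDoublingDimension (μ : Measure X) (Q : ℝ) : Prop :=
  ∃ C : ℝ, 0 < C ∧ ∀ (x y : X) (r R : ℝ), 0 < r → r ≤ R → y ∈ Metric.ball x R →
    ENNReal.ofReal (C * (r / R) ^ Q) ≤ μ (Metric.ball y r) / μ (Metric.ball x R)

/-! ### Differentiation bases -/

/-- `𝓑 x` is the family of basis sets attached to `x`. Measurability is understood with respect to
the completion of `μ`, that is, for the outer measure generated by `μ`. -/
structure IsDifferentiationBasis (μ : Measure X) (𝓑 : X → Set (Set X)) : Prop where
  mem : ∀ x, ∀ B ∈ 𝓑 x, x ∈ B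
  isBounded : ∀ x, ∀ B ∈ 𝓑 x, Bornology.IsBounded B
  measurable : ∀ x, ∀ B ∈ 𝓑 x, NullMeasurableSet B μ
  exists_small : ∀ x, ∀ ε : ℝ, 0 < ε → ∃ B ∈ 𝓑 x, Metric.diam B < ε

/-- A Busemann--Feller basis: all basis sets are open and each basis set is attached to all of
its points. -/
structure IsBusemannFellerBasis (μ : Measure X) (𝓑 : X → Set (Set X)) : Prop extends
    IsDifferentiationBasis μ 𝓑 where
  isOpen : ∀ x, ∀ B ∈ 𝓑 x, IsOpen B
  mem_of_mem : ∀ x y, ∀ B ∈ 𝓑 x, y ∈ B → B ∈ 𝓑 y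

/-- The filter "`𝓑 ∋ B → x`" on sets: it is generated by the families
`{B ∈ 𝓑 x : diam B < ε}`, `ε > 0`. -/
def basisFilter (𝓑 : X → Set (Set X)) (x : X) : Filter (Set X) :=
  ⨅ ε : {ε : ℝ // 0 < ε}, 𝓟 {B | B ∈ 𝓑 x ∧ Metric.diam B < ε}

/-- The absolute value of an extended real function. -/
def absFun (u : X → EReal) : X → EReal := fun x => ((u x).abs : EReal)

/-- The integral average `u_B` of an (almost everywhere finite) function over `B`,
regarded as an extended real so that upper limits always exist. -/
def avg (μ : Measure X) (u : X → EReal) (B : Set X) : EReal :=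
  ((⨍ y in B, (u y).toReal ∂μ : ℝ) : EReal)

/-! ### Hajłasz--Besov and Hajłasz--Triebel--Lizorkin spaces -/

/-- `L⁰(X)`: measurable functions that are finite almost everywhere. -/
def MemL0 (μ : Measure X) (u : X → EReal) : Prop :=
  AEMeasurable u μ ∧ ∀ᵐ x ∂μ, u x ≠ ⊤ ∧ u x ≠ ⊥

/-- `(∫ f^p)^{1/p}` for `f ≥ 0`. -/
def lpQuasiNorm (μ : Measure X) (p : ℝ) (f : X → ℝ≥0∞) : ℝ≥0∞ :=
  (∫⁻ x, f x ^ p ∂μ) ^ (1 / p)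

/-- The `l^q`-norm of a nonnegative sequence indexed by `ℤ`, `0 < q ≤ ∞`. -/
def lqQuasiNorm (q : ℝ≥0∞) (a : ℤ → ℝ≥0∞) : ℝ≥0∞ :=
  if q = ∞ then ⨆ k, a k else (∑' k, a k ^ q.toReal) ^ (1 / q.toReal)

/-- `(g_k)` is a fractional `s`-gradient of `u`. -/
def IsFractionalGradient (μ : Measure X) (s : ℝ) (u : X → EReal) (g : ℤ → X → ℝ≥0∞) : Prop :=
  (∀ k, AEMeasurable (g k) μ) ∧
    ∃ E : Set X, μ E = 0 ∧ ∀ k : ℤ, ∀ x ∉ E, ∀ y ∉ E,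
      (2 : ℝ) ^ (-k - 1) ≤ dist x y → dist x y < (2 : ℝ) ^ (-k) →
        (u x - u y).abs ≤ ENNReal.ofReal (dist x y ^ s) * (g k x + g k y)

/-- The two scales of spaces: Besov (`N`) and Triebel--Lizorkin (`M`). -/
inductive Scale
  | besov
  | triebelLizorkin

/-- The norm of `l^q(L^p(X))` for Besov, and of `L^p(X, l^q)` for Triebel--Lizorkin. -/
def mixedNorm (μ : Measure X) (p : ℝ) (q : ℝ≥0∞) (g : ℤ → X → ℝ≥0∞) : Scale → ℝ≥0∞
  | .besov => lqQuasiNorm q fun k => lpQuasiNorm μ p (g k)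
  | .triebelLizorkin => lpQuasiNorm μ p fun x => lqQuasiNorm q fun k => g k x

/-- The homogeneous seminorm of `N^s_{p,q}(X)`, respectively `M^s_{p,q}(X)`. -/
def homNorm (μ : Measure X) (F : Scale) (s p : ℝ) (q : ℝ≥0∞) (u : X → EReal) : ℝ≥0∞ :=
  ⨅ (g : ℤ → X → ℝ≥0∞) (_ : IsFractionalGradient μ s u g), mixedNorm μ p q g F

/-- The norm of `N^s_{p,q}(X)`, respectively `M^s_{p,q}(X)`. -/
def fNorm (μ : Measure X) (F : Scale) (s p : ℝ) (q : ℝ≥0∞) (u : X → EReal) : ℝ≥0∞ :=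
  lpQuasiNorm μ p (fun x => (u x).abs) + homNorm μ F s p q u

/-- Membership in `N^s_{p,q}(X)`, respectively `M^s_{p,q}(X)`. -/
def MemF (μ : Measure X) (F : Scale) (s p : ℝ) (q : ℝ≥0∞) (u : X → EReal) : Prop :=
  MemL0 μ u ∧ fNorm μ F s p q u < ∞

/-! ### Capacity and quasicontinuity -/

/-- The capacity `C_F(E) = inf ‖u‖^p` over all `u` in the space with `u ≥ 1` on a neighbourhood
of `E`. -/
def capacity (μ : Measure X) (F : Scale) (s p : ℝ) (q : ℝ≥0∞) (E : Set X) : ℝ≥0∞ :=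
  ⨅ (u : X → EReal) (_ : MemF μ F s p q u) (_ : ∃ U : Set X, IsOpen U ∧ E ⊆ U ∧ ∀ x ∈ U, 1 ≤ u x),
    fNorm μ F s p q u ^ p

/-- Quasicontinuity: continuity of the restriction to the complement of sets of arbitrarily
small capacity. -/
def IsQuasicontinuous (μ : Measure X) (F : Scale) (s p : ℝ) (q : ℝ≥0∞) (u : X → EReal) : Prop :=
  ∀ ε : ℝ≥0∞, 0 < ε → ∃ E : Set X, capacity μ F s p q E < ε ∧ ContinuousOn u Eᶜ

end

end HajlaszAverages

open HajlaszAverages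

/-! The equivalence runs 1 ⇒ 2 ⇒ 3 ⇒ 1 and rests on three facts about the space: its functions are
integrable on balls (`NormLE.integrableOn_ball`), continuous functions approximate its elements in
norm (`exists_continuous_approx`), and the superlevel set `{|u| > λ}` of a quasicontinuous `u` has
capacity at most a constant times `λ ^ (-p) ‖u‖ ^ p` (`IsQuasicontinuous.capacity_gt_le`).

For 1 ⇒ 2, density gives `u` a quasicontinuous representative `v`
(`exists_quasicontinuous_representative`). Averages of `|u|` are averages of `|v|`, which by 1
converge to `|v|` off a set of capacity zero, so the upper averages exceed `λ` essentially only
where `|v| > λ`. The implication 2 ⇒ 3 is immediate. For 3 ⇒ 1, approximate a quasicontinuous `u` by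
continuous `v_k`. Averages of `v_k` converge everywhere, so at a point where the averages of `u`
stay far from `u`, either the upper averages of `|u - v_k|` or the value `|u - v_k|` is large. The
capacities of both sets tend to zero, the first by 3, the second by the weak estimate.

Integrability is delicate because `p` may be below 1. A chain of points through the sublevel sets of
the gradient, built from Chebyshev's inequality and the lower mass bound, gives `|u| ≤ M (1 + h ^
p)` (`exists_bound_of_hajlasz`); this is where `p > Q / (Q + s)` enters.

Density has two proofs. If `q = ∞`, restrict `u` to a sublevel set of its gradient, where it is
Hölder, and extend. If `q < ∞`, smooth `u` at scale `2 ^ (-k)`: the error is governed by the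
gradients at scales up to eight times as large and below (`exists_local_approx`), and these form a
tail that vanishes in norm.

Since `p` and `q` may be less than 1, triangle inequalities are replaced throughout by bounds for
countable suprema with geometric weights `supConst p q ^ i`. -/

namespace HajlaszAverages

/-! ### Quasi-norms and countable suprema -/

section QuasiNorms

variable {X : Type*} [MeasurableSpace X] {μ : Measure X} {p : ℝ} {q : ℝ≥0∞}

theorem iSup_rpow_le_tsum {ι : Type*} (hp : 0 < p) (f : ι → ℝ≥0∞) :
    (⨆ i, f i) ^ p ≤ ∑' i, f i ^ p := by
  have h : (⨆ i, f i) ^ p = ⨆ i, f i ^ p := (ENNReal.orderIsoRpow p hp).map_iSup f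
  rw [h]
  exact iSup_le fun i => ENNReal.le_tsum i

/-- With `S` the weighted supremum, `b i ^ p ≤ S ^ p * 2⁻¹ ^ i`, and the geometric series sums to 2.
This stands in for the triangle inequality at every exponent `p > 0`. -/
theorem root_le_iSup_of_le_tsum (hp : 0 < p) {b : ℕ → ℝ≥0∞} {T : ℝ≥0∞}
    (hT : T ≤ ∑' i, b i ^ p) :
    T ^ (1 / p) ≤ (2 : ℝ≥0∞) ^ (1 / p) * ⨆ i, ((2 : ℝ≥0∞) ^ (1 / p)) ^ i * b i := by
  set S := ⨆ i, ((2 : ℝ≥0∞) ^ (1 / p)) ^ i * b i with hS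
  have h1 : ∀ i, b i ^ p ≤ S ^ p * (2⁻¹ : ℝ≥0∞) ^ i := by
    intro i
    have h2 : ((2 : ℝ≥0∞) ^ (1 / p)) ^ i * b i ≤ S :=
      le_iSup (fun i => ((2 : ℝ≥0∞) ^ (1 / p)) ^ i * b i) i
    have h3 := ENNReal.rpow_le_rpow h2 hp.le
    rw [ENNReal.mul_rpow_of_nonneg _ _ hp.le, ← ENNReal.rpow_natCast, ← ENNReal.rpow_mul,
      ← ENNReal.rpow_mul] at h3
    have h4 : 1 / p * ((i : ℝ) * p) = i := by field_simp
    rw [h4, ENNReal.rpow_natCast] at h3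
    calc b i ^ p = (2 ^ i * b i ^ p) * (2⁻¹ : ℝ≥0∞) ^ i := by
          rw [mul_right_comm, ← mul_pow, ENNReal.mul_inv_cancel (by norm_num) (by norm_num),
            one_pow, one_mul]
      _ ≤ _ := by gcongr
  have h5 : T ≤ S ^ p * 2 := by
    refine hT.trans ((ENNReal.tsum_le_tsum h1).trans ?_)
    rw [ENNReal.tsum_mul_left, ENNReal.tsum_geometric, ENNReal.one_sub_inv_two, inv_inv]
  refine (ENNReal.rpow_le_rpow h5 (by positivity)).trans ?_
  rw [ENNReal.mul_rpow_of_nonneg _ _ (by positivity), ← ENNReal.rpow_mul,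
    mul_one_div_cancel hp.ne', ENNReal.rpow_one, mul_comm]

theorem lpQuasiNorm_mono_ae (hp : 0 < p) {f g : X → ℝ≥0∞} (h : ∀ᵐ x ∂μ, f x ≤ g x) :
    lpQuasiNorm μ p f ≤ lpQuasiNorm μ p g := by
  unfold lpQuasiNorm
  refine ENNReal.rpow_le_rpow (lintegral_mono_ae ?_) (by positivity)
  filter_upwards [h] with x hx using ENNReal.rpow_le_rpow hx hp.le

theorem lpQuasiNorm_mono (hp : 0 < p) {f g : X → ℝ≥0∞} (h : ∀ x, f x ≤ g x) :
    lpQuasiNorm μ p f ≤ lpQuasiNorm μ p g :=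
  lpQuasiNorm_mono_ae hp (Eventually.of_forall h)

theorem lpQuasiNorm_rpow (hp : 0 < p) (f : X → ℝ≥0∞) :
    lpQuasiNorm μ p f ^ p = ∫⁻ x, f x ^ p ∂μ := by
  rw [lpQuasiNorm, ← ENNReal.rpow_mul, one_div_mul_cancel hp.ne', ENNReal.rpow_one]

theorem lpQuasiNorm_le_iff (hp : 0 < p) {f : X → ℝ≥0∞} {a : ℝ≥0∞} :
    lpQuasiNorm μ p f ≤ a ↔ ∫⁻ x, f x ^ p ∂μ ≤ a ^ p := by
  rw [← lpQuasiNorm_rpow hp, ENNReal.rpow_le_rpow_iff hp]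

theorem lpQuasiNorm_const_mul (hp : 0 < p) {c : ℝ≥0∞} (hc : c ≠ ∞) (f : X → ℝ≥0∞) :
    lpQuasiNorm μ p (fun x => c * f x) = c * lpQuasiNorm μ p f := by
  unfold lpQuasiNorm
  simp_rw [ENNReal.mul_rpow_of_nonneg _ _ hp.le]
  rw [lintegral_const_mul' _ _ (ENNReal.rpow_ne_top_of_nonneg hp.le hc),
    ENNReal.mul_rpow_of_nonneg _ _ (by positivity), ← ENNReal.rpow_mul,
    mul_one_div_cancel hp.ne', ENNReal.rpow_one]

theorem lpQuasiNorm_iSup_le (hp : 0 < p) {f : ℕ → X → ℝ≥0∞} (hf : ∀ i, AEMeasurable (f i) μ) :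
    lpQuasiNorm μ p (fun x => ⨆ i, f i x) ≤
      (2 : ℝ≥0∞) ^ (1 / p) * ⨆ i, ((2 : ℝ≥0∞) ^ (1 / p)) ^ i * lpQuasiNorm μ p (f i) := by
  refine root_le_iSup_of_le_tsum hp ?_
  simp_rw [lpQuasiNorm_rpow hp]
  rw [← lintegral_tsum fun i => (hf i).pow_const p]
  exact lintegral_mono fun x => iSup_rpow_le_tsum hp _

theorem toReal_pos_of_lt_top (hq : 0 < q) (h : q ≠ ∞) : 0 < q.toReal :=
  ENNReal.toReal_pos hq.ne' h

theorem lqQuasiNorm_mono {a b : ℤ → ℝ≥0∞} (h : ∀ k, a k ≤ b k) :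
    lqQuasiNorm q a ≤ lqQuasiNorm q b := by
  unfold lqQuasiNorm
  split_ifs
  · exact iSup_mono h
  · exact ENNReal.rpow_le_rpow (ENNReal.tsum_le_tsum fun k =>
      ENNReal.rpow_le_rpow (h k) ENNReal.toReal_nonneg) (by positivity)

theorem lqQuasiNorm_const_mul (hq : 0 < q) (c : ℝ≥0∞) (a : ℤ → ℝ≥0∞) :
    lqQuasiNorm q (fun k => c * a k) = c * lqQuasiNorm q a := by
  unfold lqQuasiNorm
  split_ifs with h
  · rw [ENNReal.mul_iSup]
  · have hq' := toReal_pos_of_lt_top hq h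
    simp_rw [ENNReal.mul_rpow_of_nonneg _ _ hq'.le]
    rw [ENNReal.tsum_mul_left, ENNReal.mul_rpow_of_nonneg _ _ (by positivity), ← ENNReal.rpow_mul,
      mul_one_div_cancel hq'.ne', ENNReal.rpow_one]

theorem le_lqQuasiNorm (hq : 0 < q) (a : ℤ → ℝ≥0∞) (k : ℤ) : a k ≤ lqQuasiNorm q a := by
  unfold lqQuasiNorm
  split_ifs with h
  · exact le_iSup a k
  · have hq' := toReal_pos_of_lt_top hq h
    rw [one_div, ENNReal.le_rpow_inv_iff hq']
    exact ENNReal.le_tsum (f := fun k => a k ^ q.toReal) k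

theorem lqQuasiNorm_iSup_le (hq : 0 < q) (a : ℕ → ℤ → ℝ≥0∞) :
    lqQuasiNorm q (fun k => ⨆ i, a i k) ≤
      (2 : ℝ≥0∞) ^ (1 / q.toReal) *
        ⨆ i, ((2 : ℝ≥0∞) ^ (1 / q.toReal)) ^ i * lqQuasiNorm q (a i) := by
  unfold lqQuasiNorm
  split_ifs with h
  · subst h
    simp only [ENNReal.toReal_top, div_zero, ENNReal.rpow_zero, one_pow, one_mul]
    rw [iSup_comm]
  · have hq' := toReal_pos_of_lt_top hq h
    refine root_le_iSup_of_le_tsum hq' ?_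
    simp_rw [← ENNReal.rpow_mul, one_div_mul_cancel hq'.ne', ENNReal.rpow_one]
    rw [ENNReal.tsum_comm]
    exact ENNReal.tsum_le_tsum fun k => iSup_rpow_le_tsum hq' _

theorem aemeasurable_lqQuasiNorm {g : ℤ → X → ℝ≥0∞} (hg : ∀ k, AEMeasurable (g k) μ) :
    AEMeasurable (fun x => lqQuasiNorm q fun k => g k x) μ := by
  unfold lqQuasiNorm
  split_ifs
  · exact AEMeasurable.iSup hg
  · exact (AEMeasurable.tsum fun k => (hg k).pow_const _).pow_const _

/-- The constant in the quasi-triangle inequality for countable suprema. -/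
noncomputable def supConst (p : ℝ) (q : ℝ≥0∞) : ℝ≥0∞ :=
  (2 : ℝ≥0∞) ^ (1 / p) * (2 : ℝ≥0∞) ^ (1 / q.toReal)

theorem one_le_supConst (hp : 0 < p) : 1 ≤ supConst p q := by
  unfold supConst
  have h : ∀ t : ℝ, 0 ≤ t → (1 : ℝ≥0∞) ≤ 2 ^ t := fun t ht =>
    (ENNReal.one_rpow t).symm.le.trans (ENNReal.rpow_le_rpow (by norm_num) ht)
  exact one_le_mul (h _ (by positivity)) (h _ (by positivity))

theorem supConst_ne_top (hp : 0 < p) : supConst p q ≠ ∞ :=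
  ENNReal.mul_ne_top (ENNReal.rpow_ne_top_of_nonneg (by positivity) (by norm_num))
    (ENNReal.rpow_ne_top_of_nonneg (by positivity) (by norm_num))

variable {F : Scale}

theorem mixedNorm_mono_ae (hp : 0 < p) {g h : ℤ → X → ℝ≥0∞}
    (H : ∀ k, ∀ᵐ x ∂μ, g k x ≤ h k x) :
    mixedNorm μ p q g F ≤ mixedNorm μ p q h F := by
  cases F
  · exact lqQuasiNorm_mono fun k => lpQuasiNorm_mono_ae hp (H k)
  · refine lpQuasiNorm_mono_ae hp ?_
    filter_upwards [ae_all_iff.2 H] with x hx using lqQuasiNorm_mono hx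

theorem mixedNorm_mono (hp : 0 < p) {g h : ℤ → X → ℝ≥0∞} (H : ∀ k x, g k x ≤ h k x) :
    mixedNorm μ p q g F ≤ mixedNorm μ p q h F :=
  mixedNorm_mono_ae hp fun k => Eventually.of_forall (H k)

theorem mixedNorm_const_mul (hp : 0 < p) (hq : 0 < q) {c : ℝ≥0∞} (hc : c ≠ ∞)
    (g : ℤ → X → ℝ≥0∞) :
    mixedNorm μ p q (fun k x => c * g k x) F = c * mixedNorm μ p q g F := by
  cases F
  · simp only [mixedNorm, lpQuasiNorm_const_mul hp hc, lqQuasiNorm_const_mul hq]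
  · simp only [mixedNorm, lqQuasiNorm_const_mul hq, lpQuasiNorm_const_mul hp hc]

theorem mixedNorm_zero (hp : 0 < p) (hq : 0 < q) :
    mixedNorm μ p q (fun _ _ => 0) F = 0 := by
  have := mixedNorm_const_mul (μ := μ) (F := F) hp hq ENNReal.zero_ne_top fun _ _ => 0
  simpa using this

/-- The weighted supremum bound is used once in `L^p` and once in `l^q`, in the order that the scale
dictates; the two geometric weights multiply to `supConst p q ^ i`. For `q = ∞` the convention `1 /
0 = 0` makes the second weight 1. -/
theorem mixedNorm_iSup_le (hp : 0 < p) (hq : 0 < q) {g : ℕ → ℤ → X → ℝ≥0∞}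
    (hg : ∀ i k, AEMeasurable (g i k) μ) :
    mixedNorm μ p q (fun k x => ⨆ i, g i k x) F ≤
      supConst p q * ⨆ i, supConst p q ^ i * mixedNorm μ p q (g i) F := by
  have hP : ∀ i : ℕ, ((2 : ℝ≥0∞) ^ (1 / p)) ^ i ≠ ∞ := fun i =>
    ENNReal.pow_ne_top (ENNReal.rpow_ne_top_of_nonneg (by positivity) (by norm_num))
  have hR : ∀ i : ℕ, ((2 : ℝ≥0∞) ^ (1 / q.toReal)) ^ i ≠ ∞ := fun i =>
    ENNReal.pow_ne_top (ENNReal.rpow_ne_top_of_nonneg (by positivity) (by norm_num))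
  cases F
  · simp only [mixedNorm]
    refine (lqQuasiNorm_mono fun k => lpQuasiNorm_iSup_le hp fun i => hg i k).trans ?_
    rw [lqQuasiNorm_const_mul hq]
    refine (mul_le_mul_right (lqQuasiNorm_iSup_le hq _) _).trans (le_of_eq ?_)
    rw [supConst, mul_assoc]
    congr 2
    refine iSup_congr fun i => ?_
    rw [lqQuasiNorm_const_mul hq, mul_pow]
    ring
  · simp only [mixedNorm]
    refine (lpQuasiNorm_mono hp fun x => lqQuasiNorm_iSup_le hq _).trans ?_
    have h1 := hR 1
    rw [pow_one] at h1
    rw [lpQuasiNorm_const_mul hp h1]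
    refine (mul_le_mul_right (lpQuasiNorm_iSup_le hp fun i =>
      (aemeasurable_lqQuasiNorm (hg i)).const_mul _) _).trans (le_of_eq ?_)
    rw [supConst, mul_comm ((2 : ℝ≥0∞) ^ (1 / p)) (2 ^ (1 / q.toReal)), mul_assoc]
    congr 2
    refine iSup_congr fun i => ?_
    rw [lpQuasiNorm_const_mul hp (hR i), mul_pow]
    ring

/-- On a product of a sequence and a function the order of the two norms is immaterial. -/
theorem mixedNorm_mul_of_seq (hp : 0 < p) (hq : 0 < q) (c : ℤ → ℝ≥0∞) (hc : ∀ k, c k ≠ ∞)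
    (hc' : lqQuasiNorm q c ≠ ∞) (f : X → ℝ≥0∞) :
    mixedNorm μ p q (fun k x => c k * f x) F = lqQuasiNorm q c * lpQuasiNorm μ p f := by
  cases F
  · simp only [mixedNorm, lpQuasiNorm_const_mul hp (hc _)]
    simp_rw [mul_comm (c _)]
    rw [lqQuasiNorm_const_mul hq, mul_comm]
  · simp only [mixedNorm]
    simp_rw [mul_comm (c _)]
    simp_rw [lqQuasiNorm_const_mul hq, mul_comm _ (lqQuasiNorm q c)]
    rw [lpQuasiNorm_const_mul hp hc']

theorem iSup_pair_le {K a : ℝ≥0∞} (hK : 1 ≤ K) {b : ℕ → ℝ≥0∞} (h0 : b 0 ≤ a) (h1 : b 1 ≤ a)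
    (h2 : ∀ i, b (i + 2) = 0) : ⨆ i, K ^ i * b i ≤ K * a := by
  refine iSup_le fun i => ?_
  match i with
  | 0 => simpa using h0.trans (le_mul_of_one_le_left' hK)
  | 1 => simpa using mul_le_mul_right h1 K
  | i + 2 => simp [h2]

/-- The sequence with two prescribed terms, followed by zeros. -/
def pairSeq {β : Type*} [Zero β] (a b : β) : ℕ → β
  | 0 => a
  | 1 => b
  | _ + 2 => 0

theorem add_le_two_mul_iSup_pairSeq (a b : ℝ≥0∞) : a + b ≤ 2 * ⨆ i, pairSeq a b i := by
  have h0 : a ≤ ⨆ i, pairSeq a b i := le_iSup (pairSeq a b) 0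
  have h1 : b ≤ ⨆ i, pairSeq a b i := le_iSup (pairSeq a b) 1
  rw [two_mul]
  gcongr

theorem mixedNorm_add_le (hp : 0 < p) (hq : 0 < q) {g h : ℤ → X → ℝ≥0∞}
    (hg : ∀ k, AEMeasurable (g k) μ) (hh : ∀ k, AEMeasurable (h k) μ) {a : ℝ≥0∞}
    (hga : mixedNorm μ p q g F ≤ a) (hha : mixedNorm μ p q h F ≤ a) :
    mixedNorm μ p q (fun k x => g k x + h k x) F ≤ 2 * supConst p q ^ 2 * a := by
  have key : ∀ k x, g k x + h k x ≤ 2 * ⨆ i, pairSeq g h i k x := by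
    intro k x
    refine (add_le_two_mul_iSup_pairSeq _ _).trans
      (mul_le_mul_right (iSup_mono fun i => le_of_eq ?_) _)
    match i with
    | 0 => rfl
    | 1 => rfl
    | i + 2 => rfl
  refine (mixedNorm_mono hp key).trans ?_
  rw [mixedNorm_const_mul hp hq (by norm_num), mul_assoc]
  refine mul_le_mul_right ((mixedNorm_iSup_le hp hq ?_).trans ?_) _
  · intro i k
    match i with
    | 0 => exact hg k
    | 1 => exact hh k
    | i + 2 => exact aemeasurable_const
  · rw [pow_two, mul_assoc]
    exact mul_le_mul_right (iSup_pair_le (one_le_supConst hp) hga hha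
      fun i => mixedNorm_zero hp hq) _

end QuasiNorms

/-! ### Real representatives and operations on norm bounds -/

section RealFunctions

variable {X : Type*} [MetricSpace X] [MeasurableSpace X] {μ : Measure X} {F : Scale} {s p : ℝ}
  {q : ℝ≥0∞}

theorem abs_coe_sub_coe (a b : ℝ) : ((a : EReal) - b).abs = ‖a - b‖ₑ := by
  rw [← EReal.coe_sub, EReal.abs_def, Real.enorm_eq_ofReal_abs]

theorem IsFractionalGradient.congr_ae {u v : X → EReal} {g : ℤ → X → ℝ≥0∞}
    (hg : IsFractionalGradient μ s u g) (h : u =ᵐ[μ] v) : IsFractionalGradient μ s v g := by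
  obtain ⟨hm, E, hE, H⟩ := hg
  refine ⟨hm, E ∪ {x | u x ≠ v x}, measure_union_null hE h, fun k x hx y hy h1 h2 => ?_⟩
  simp only [mem_union, mem_ofPred_eq, not_or, not_not] at hx hy
  rw [← hx.2, ← hy.2]
  exact H k x hx.1 y hy.1 h1 h2

/-- The real function `v` belongs to the space and both the `L^p`-part of its norm and the mixed
norm of one of its fractional gradients are at most `a`. -/
structure NormLE (μ : Measure X) (F : Scale) (s p : ℝ) (q : ℝ≥0∞) (v : X → ℝ) (a : ℝ≥0∞) :
    Prop where
  aemeasurable : AEMeasurable v μ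
  lp_le : lpQuasiNorm μ p (fun x => ‖v x‖ₑ) ≤ a
  grad : ∃ g, IsFractionalGradient μ s (fun x => (v x : EReal)) g ∧ mixedNorm μ p q g F ≤ a

omit [MetricSpace X] in
theorem MemL0.coe_toReal_ae {u : X → EReal} (hu : MemL0 μ u) :
    (fun x => ((u x).toReal : EReal)) =ᵐ[μ] u := by
  filter_upwards [hu.2] with x hx using EReal.coe_toReal hx.1 hx.2

theorem normLE_of_fNorm_lt {u : X → EReal} (hu : MemL0 μ u) (hp : 0 < p) {a : ℝ≥0∞}
    (h : fNorm μ F s p q u < a) : NormLE μ F s p q (fun x => (u x).toReal) a := by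
  refine ⟨hu.1.ereal_toReal, ?_, ?_⟩
  · refine (lpQuasiNorm_mono_ae hp ?_).trans ((le_self_add.trans h.le :
      lpQuasiNorm μ p (fun x => (u x).abs) ≤ a))
    filter_upwards [hu.coe_toReal_ae] with x hx
    rw [← hx, EReal.toReal_coe, EReal.abs_def, Real.enorm_eq_ofReal_abs]
  · have h1 : homNorm μ F s p q u < a := lt_of_le_of_lt le_add_self h
    simp only [homNorm, iInf_lt_iff] at h1
    obtain ⟨g, hg, hga⟩ := h1
    exact ⟨g, hg.congr_ae hu.coe_toReal_ae.symm, hga.le⟩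

namespace NormLE

variable {v w : X → ℝ} {a b : ℝ≥0∞}

theorem mono (h : NormLE μ F s p q v a) (hab : a ≤ b) : NormLE μ F s p q v b :=
  ⟨h.1, h.2.trans hab, h.3.imp fun _ hg => ⟨hg.1, hg.2.trans hab⟩⟩

theorem congr_ae (h : NormLE μ F s p q v a) (hp : 0 < p) (hvw : v =ᵐ[μ] w) :
    NormLE μ F s p q w a := by
  refine ⟨h.1.congr hvw, (lpQuasiNorm_mono_ae hp ?_).trans h.2, h.3.imp fun g hg =>
    ⟨hg.1.congr_ae ?_, hg.2⟩⟩
  · filter_upwards [hvw] with x hx using by rw [hx]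
  · filter_upwards [hvw] with x hx using by rw [hx]

theorem fNorm_le (h : NormLE μ F s p q v a) (hp : 0 < p) {u : X → EReal}
    (hu : u =ᵐ[μ] fun x => (v x : EReal)) : fNorm μ F s p q u ≤ 2 * a := by
  obtain ⟨g, hg, hga⟩ := h.grad
  rw [fNorm, two_mul]
  refine add_le_add ((lpQuasiNorm_mono_ae hp ?_).trans h.lp_le)
    ((iInf₂_le g (hg.congr_ae hu.symm)).trans hga)
  filter_upwards [hu] with x hx
  rw [hx, EReal.abs_def, Real.enorm_eq_ofReal_abs]

theorem memL0 (h : NormLE μ F s p q v a) {u : X → EReal}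
    (hu : u =ᵐ[μ] fun x => (v x : EReal)) : MemL0 μ u := by
  refine ⟨(measurable_coe_real_ereal.comp_aemeasurable h.1).congr hu.symm, ?_⟩
  filter_upwards [hu] with x hx
  rw [hx]
  exact ⟨EReal.coe_ne_top _, EReal.coe_ne_bot _⟩

theorem memF (h : NormLE μ F s p q v a) (hp : 0 < p) (ha : a ≠ ∞) {u : X → EReal}
    (hu : u =ᵐ[μ] fun x => (v x : EReal)) : MemF μ F s p q u :=
  ⟨h.memL0 hu, (h.fNorm_le hp hu).trans_lt (ENNReal.mul_lt_top (by norm_num) ha.lt_top)⟩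

theorem const_mul (h : NormLE μ F s p q v a) (hp : 0 < p) (hq : 0 < q) (c : ℝ) :
    NormLE μ F s p q (fun x => c * v x) (‖c‖ₑ * a) := by
  obtain ⟨g, ⟨hm, E, hE, H⟩, hga⟩ := h.grad
  have hc : ‖c‖ₑ ≠ ∞ := enorm_ne_top
  refine ⟨h.1.const_mul c, ?_, fun k x => ‖c‖ₑ * g k x,
    ⟨fun k => (hm k).const_mul _, E, hE, fun k x hx y hy h1 h2 => ?_⟩, ?_⟩
  · simp_rw [enorm_mul]
    rw [lpQuasiNorm_const_mul hp hc]
    exact mul_le_mul_right h.lp_le _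
  · have h3 := H k x hx y hy h1 h2
    rw [abs_coe_sub_coe] at h3 ⊢
    rw [← mul_sub, enorm_mul, ← mul_add, mul_left_comm]
    exact mul_le_mul_right h3 _
  · rw [mixedNorm_const_mul hp hq hc]
    exact mul_le_mul_right hga _

theorem zero (hp : 0 < p) (hq : 0 < q) : NormLE μ F s p q (fun _ => 0) 0 := by
  refine ⟨aemeasurable_const, ?_, fun _ _ => 0, ⟨fun _ => aemeasurable_const, ∅, measure_empty,
    fun k x _ y _ _ _ => by simp⟩, (mixedNorm_zero hp hq).le⟩
  have := lpQuasiNorm_const_mul (μ := μ) hp ENNReal.zero_ne_top fun _ => 0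
  simp only [zero_mul] at this
  simp [this]

/-- The supremum of the gradients is a gradient of any function whose size and increments are
dominated by the suprema of those of the `w i`. -/
theorem of_iSup (hp : 0 < p) (hq : 0 < q) {w : ℕ → X → ℝ} {a : ℕ → ℝ≥0∞}
    (h : ∀ i, NormLE μ F s p q (w i) (a i)) (hv : AEMeasurable v μ)
    (h1 : ∀ x, ‖v x‖ₑ ≤ ⨆ i, ‖w i x‖ₑ)
    (h2 : ∀ x y, ‖v x - v y‖ₑ ≤ ⨆ i, ‖w i x - w i y‖ₑ) :
    NormLE μ F s p q v (supConst p q * ⨆ i, supConst p q ^ i * a i) := by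
  choose g hg hga using fun i => (h i).grad
  choose hm E hE H using hg
  refine ⟨hv, ?_, fun k x => ⨆ i, g i k x, ⟨fun k => AEMeasurable.iSup fun i => hm i k,
    ⋃ i, E i, measure_iUnion_null hE, fun k x hx y hy h3 h4 => ?_⟩, ?_⟩
  · have hle : (2 : ℝ≥0∞) ^ (1 / p) ≤ supConst p q := by
      refine le_mul_of_one_le_right' ?_
      exact (ENNReal.one_rpow (1 / q.toReal)).symm.le.trans
        (ENNReal.rpow_le_rpow (by norm_num) (by positivity))
    refine (lpQuasiNorm_mono hp h1).trans
      ((lpQuasiNorm_iSup_le hp fun i => (h i).1.enorm).trans ?_)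
    gcongr with i
    exact (h i).lp_le
  · simp only [mem_iUnion, not_exists] at hx hy
    rw [abs_coe_sub_coe]
    refine (h2 x y).trans (iSup_le fun i => ?_)
    have h5 := H i k x (hx i) y (hy i) h3 h4
    rw [abs_coe_sub_coe] at h5
    refine h5.trans ?_
    gcongr
    · exact le_iSup (fun i => g i k x) i
    · exact le_iSup (fun i => g i k y) i
  · refine (mixedNorm_iSup_le hp hq hm).trans ?_
    gcongr with i
    exact hga i

/-- The pair is padded with zeros to a sequence. Stated by domination, the result covers maxima and,
after doubling both functions, sums. -/
theorem of_pair (hp : 0 < p) (hq : 0 < q) {w₁ w₂ : X → ℝ}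
    (hw₁ : NormLE μ F s p q w₁ a) (hw₂ : NormLE μ F s p q w₂ a) (hv : AEMeasurable v μ)
    (h1 : ∀ x, ‖v x‖ₑ ≤ max ‖w₁ x‖ₑ ‖w₂ x‖ₑ)
    (h2 : ∀ x y, ‖v x - v y‖ₑ ≤ max ‖w₁ x - w₁ y‖ₑ ‖w₂ x - w₂ y‖ₑ) :
    NormLE μ F s p q v (supConst p q ^ 2 * a) := by
  have key : NormLE μ F s p q v (supConst p q * ⨆ i, supConst p q ^ i * pairSeq a a i) := by
    refine of_iSup (w := pairSeq w₁ w₂) hp hq ?_ hv ?_ ?_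
    · intro i
      match i with
      | 0 => exact hw₁
      | 1 => exact hw₂
      | i + 2 => exact zero hp hq
    · intro x
      exact (h1 x).trans (max_le (le_iSup (fun i => ‖pairSeq w₁ w₂ i x‖ₑ) 0)
        (le_iSup (fun i => ‖pairSeq w₁ w₂ i x‖ₑ) 1))
    · intro x y
      exact (h2 x y).trans
        (max_le (le_iSup (fun i => ‖pairSeq w₁ w₂ i x - pairSeq w₁ w₂ i y‖ₑ) 0)
          (le_iSup (fun i => ‖pairSeq w₁ w₂ i x - pairSeq w₁ w₂ i y‖ₑ) 1))
  refine key.mono ?_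
  rw [pow_two, mul_assoc]
  exact mul_le_mul_right (iSup_pair_le (one_le_supConst hp) le_rfl le_rfl fun i => rfl) _

theorem of_contraction (h : NormLE μ F s p q w a) (hp : 0 < p) (hv : AEMeasurable v μ)
    (h1 : ∀ x, ‖v x‖ₑ ≤ ‖w x‖ₑ) (h2 : ∀ x y, ‖v x - v y‖ₑ ≤ ‖w x - w y‖ₑ) :
    NormLE μ F s p q v a := by
  obtain ⟨g, ⟨hm, E, hE, H⟩, hga⟩ := h.grad
  refine ⟨hv, (lpQuasiNorm_mono hp h1).trans h.2, g, ⟨hm, E, hE, fun k x hx y hy h3 h4 => ?_⟩, hga⟩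
  rw [abs_coe_sub_coe]
  refine (h2 x y).trans ?_
  rw [← abs_coe_sub_coe]
  exact H k x hx y hy h3 h4

theorem abs (h : NormLE μ F s p q v a) (hp : 0 < p) : NormLE μ F s p q (fun x => |v x|) a := by
  refine h.of_contraction hp h.1.abs (fun x => by simp) fun x y => ?_
  rw [Real.enorm_eq_ofReal_abs, Real.enorm_eq_ofReal_abs]
  exact ENNReal.ofReal_le_ofReal (abs_abs_sub_abs_le_abs_sub _ _)

theorem add (hp : 0 < p) (hq : 0 < q) (hv : NormLE μ F s p q v a) (hw : NormLE μ F s p q w a) :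
    NormLE μ F s p q (fun x => v x + w x) (2 * supConst p q ^ 2 * a) := by
  have h2 : ‖(2 : ℝ)‖ₑ = 2 := by
    rw [Real.enorm_eq_ofReal_abs]; norm_num
  have hmax : ∀ a b : ℝ, ‖a + b‖ₑ ≤ max ‖2 * a‖ₑ ‖2 * b‖ₑ := by
    intro a b
    simp only [Real.enorm_eq_ofReal_abs, abs_mul, abs_two, ← ENNReal.ofReal_max]
    refine ENNReal.ofReal_le_ofReal ?_
    rcases le_total |a| |b| with h | h
    · exact le_max_of_le_right (by linarith [abs_add_le a b])
    · exact le_max_of_le_left (by linarith [abs_add_le a b])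
  have := of_pair (v := fun x => v x + w x) hp hq (hv.const_mul hp hq 2) (hw.const_mul hp hq 2)
    (hv.1.add hw.1) (fun x => hmax _ _) fun x y => by
      rw [← mul_sub, ← mul_sub, add_sub_add_comm]
      exact hmax _ _
  rw [h2, ← mul_assoc, mul_comm _ (2 : ℝ≥0∞)] at this
  exact this

theorem neg (h : NormLE μ F s p q v a) (hp : 0 < p) : NormLE μ F s p q (fun x => -v x) a := by
  refine h.of_contraction hp h.1.neg (fun x => by simp) fun x y => ?_
  rw [← neg_sub', enorm_neg]

theorem sub (hp : 0 < p) (hq : 0 < q) (hv : NormLE μ F s p q v a) (hw : NormLE μ F s p q w a) :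
    NormLE μ F s p q (fun x => v x - w x) (2 * supConst p q ^ 2 * a) := by
  simpa only [sub_eq_add_neg] using add hp hq hv (hw.neg hp)

end NormLE

theorem MemF.exists_normLE {u : X → EReal} (hu : MemF μ F s p q u) (hp : 0 < p) :
    ∃ a, a ≠ ∞ ∧ NormLE μ F s p q (fun x => (u x).toReal) a := by
  obtain ⟨a, h1, h2⟩ := exists_between hu.2
  exact ⟨a, h2.ne, normLE_of_fNorm_lt hu.1 hp h1⟩

/-! ### Capacity and its quasi-subadditivity -/

theorem capacity_mono {E E' : Set X} (h : E ⊆ E') :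
    capacity μ F s p q E ≤ capacity μ F s p q E' := by
  unfold capacity
  refine le_iInf₂ fun u hu => le_iInf fun hU => ?_
  obtain ⟨U, hU, hE, h1⟩ := hU
  exact iInf₂_le_of_le u hu (iInf_le _ ⟨U, hU, h.trans hE, h1⟩)

theorem capacity_le_of_normLE (hp : 0 < p) {w : X → ℝ} {a : ℝ≥0∞} (hw : NormLE μ F s p q w a)
    {E U : Set X} (hU : IsOpen U) (hE : E ⊆ U) (h1 : ∀ x ∈ U, 1 ≤ w x) :
    capacity μ F s p q E ≤ (2 * a) ^ p := by
  rcases eq_or_ne a ∞ with rfl | ha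
  · simp [ENNReal.top_rpow_of_pos hp]
  · have hw' := hw.memF hp ha (ae_eq_refl _)
    unfold capacity
    refine iInf₂_le_of_le (fun x => (w x : EReal)) hw' (iInf_le_of_le ⟨U, hU, hE, fun x hx => ?_⟩
      (ENNReal.rpow_le_rpow (hw.fNorm_le hp (ae_eq_refl _)) hp.le))
    exact EReal.coe_le_coe_iff.2 (h1 x hx)

/-- Truncation of a real number to `[0, 1]`. -/
def clamp (t : ℝ) : ℝ := max 0 (min t 1)

theorem clamp_nonneg (t : ℝ) : 0 ≤ clamp t := le_max_left _ _

theorem clamp_le_one (t : ℝ) : clamp t ≤ 1 := max_le zero_le_one (min_le_right _ _)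

theorem clamp_eq_one {t : ℝ} (h : 1 ≤ t) : clamp t = 1 := by
  simp [clamp, min_eq_right h]

theorem abs_clamp_le (t : ℝ) : |clamp t| ≤ |t| := by
  rw [abs_of_nonneg (clamp_nonneg t)]
  exact max_le (abs_nonneg t) ((min_le_left _ _).trans (le_abs_self t))

theorem abs_clamp_sub_clamp_le (t t' : ℝ) : |clamp t - clamp t'| ≤ |t - t'| := by
  unfold clamp
  refine (abs_max_sub_max_le_max _ _ _ _).trans (max_le (by simp) ?_)
  exact (abs_min_sub_min_le_max _ _ _ _).trans (max_le le_rfl (by simp))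

theorem measurable_clamp : Measurable clamp :=
  measurable_const.max (measurable_id.min measurable_const)

theorem NormLE.clamp {v : X → ℝ} {a : ℝ≥0∞} (h : NormLE μ F s p q v a) (hp : 0 < p) :
    NormLE μ F s p q (fun x => clamp (v x)) a := by
  refine h.of_contraction hp (measurable_clamp.comp_aemeasurable h.1) (fun x => ?_) fun x y => ?_
  · simp only [Real.enorm_eq_ofReal_abs]
    exact ENNReal.ofReal_le_ofReal (abs_clamp_le _)
  · simp only [Real.enorm_eq_ofReal_abs]
    exact ENNReal.ofReal_le_ofReal (abs_clamp_sub_clamp_le _ _)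

open scoped Classical in
-- Truncation to `[0, 1]` does not increase the bound, and resetting the value to 1 on `U` changes
-- only points where the original is infinite, a null set. Control at every point is what allows
-- real suprema of countably many test functions.
theorem exists_of_capacity_lt (hp : 0 < p) {E : Set X} {b : ℝ≥0∞}
    (h : capacity μ F s p q E < b ^ p) :
    ∃ (w : X → ℝ) (U : Set X), NormLE μ F s p q w b ∧ IsOpen U ∧ E ⊆ U ∧ (∀ x ∈ U, w x = 1) ∧
      ∀ x, 0 ≤ w x ∧ w x ≤ 1 := by
  simp only [capacity, iInf_lt_iff] at h
  obtain ⟨u, hu, ⟨U, hU, hE, h1⟩, hb⟩ := h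
  rw [ENNReal.rpow_lt_rpow_iff hp] at hb
  have h3 := (normLE_of_fNorm_lt hu.1 hp hb).clamp hp
  refine ⟨fun x => if x ∈ U then 1 else HajlaszAverages.clamp (u x).toReal, U,
    h3.congr_ae hp ?_, hU, hE, fun x hx => if_pos hx, fun x => ?_⟩
  · filter_upwards [hu.1.coe_toReal_ae] with x hx
    split_ifs with hxU
    · refine clamp_eq_one ?_
      have := h1 x hxU
      rw [← hx] at this
      exact_mod_cast this
    · rfl
  · dsimp only
    split_ifs
    · simp
    · exact ⟨clamp_nonneg _, clamp_le_one _⟩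

theorem bddAbove_range_of_le_one {w : ℕ → ℝ} (hw : ∀ i, 0 ≤ w i ∧ w i ≤ 1) :
    BddAbove (range w) := ⟨1, by rintro _ ⟨i, rfl⟩; exact (hw i).2⟩

theorem abs_ciSup_sub_ciSup_le {w w' : ℕ → ℝ} (hw : BddAbove (range w))
    (hw' : BddAbove (range w')) :
    ‖(⨆ i, w i) - ⨆ i, w' i‖ₑ ≤ ⨆ i, ‖w i - w' i‖ₑ := by
  by_cases htop : ⨆ i, ‖w i - w' i‖ₑ = ∞
  · rw [htop]; exact le_top
  set S := ⨆ i, ‖w i - w' i‖ₑ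
  have key : ∀ i, |w i - w' i| ≤ S.toReal := by
    intro i
    have h : ‖w i - w' i‖ₑ ≤ S := le_iSup (fun i => ‖w i - w' i‖ₑ) i
    rw [Real.enorm_eq_ofReal_abs] at h
    exact (ENNReal.ofReal_le_iff_le_toReal htop).1 h
  rw [Real.enorm_eq_ofReal_abs]
  refine (ENNReal.ofReal_le_iff_le_toReal htop).2 (abs_sub_le_iff.2 ⟨?_, ?_⟩)
  · rw [sub_le_iff_le_add]
    refine ciSup_le fun i => ?_
    linarith [le_ciSup hw' i, (abs_sub_le_iff.1 (key i)).1]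
  · rw [sub_le_iff_le_add]
    refine ciSup_le fun i => ?_
    linarith [le_ciSup hw i, (abs_sub_le_iff.1 (key i)).2]

theorem NormLE.ciSup (hp : 0 < p) (hq : 0 < q) {w : ℕ → X → ℝ} {a : ℕ → ℝ≥0∞}
    (h : ∀ i, NormLE μ F s p q (w i) (a i)) (hw : ∀ i x, 0 ≤ w i x ∧ w i x ≤ 1) :
    NormLE μ F s p q (fun x => ⨆ i, w i x) (supConst p q * ⨆ i, supConst p q ^ i * a i) := by
  have hb : ∀ x, BddAbove (range fun i => w i x) := fun x =>
    bddAbove_range_of_le_one fun i => hw i x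
  refine of_iSup hp hq h (AEMeasurable.iSup fun i => (h i).1) (fun x => ?_) fun x y =>
    abs_ciSup_sub_ciSup_le (hb x) (hb y)
  have := abs_ciSup_sub_ciSup_le (hb x) (w' := fun _ => 0) ⟨0, by rintro _ ⟨i, rfl⟩; exact le_rfl⟩
  simpa using this

/-- The supremum of the test functions is a test function for the union. The weights are harmless
when the `b i` decay geometrically fast enough. -/
theorem capacity_iUnion_le (hp : 0 < p) (hq : 0 < q) {E : ℕ → Set X} {b : ℕ → ℝ≥0∞}
    (h : ∀ i, capacity μ F s p q (E i) < b i ^ p) :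
    capacity μ F s p q (⋃ i, E i) ≤ (2 * (supConst p q * ⨆ i, supConst p q ^ i * b i)) ^ p := by
  choose w U hw hU hE h1 h01 using fun i => exists_of_capacity_lt hp (h i)
  refine capacity_le_of_normLE hp (NormLE.ciSup hp hq hw h01) (isOpen_iUnion hU)
    (iUnion_mono hE) fun x hx => ?_
  obtain ⟨i, hi⟩ := mem_iUnion.1 hx
  exact (h1 i x hi).symm.le.trans (le_ciSup (bddAbove_range_of_le_one fun i => h01 i x) i)

theorem capacity_iUnion_null (hp : 0 < p) (hq : 0 < q) {E : ℕ → Set X}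
    (h : ∀ i, capacity μ F s p q (E i) = 0) : capacity μ F s p q (⋃ i, E i) = 0 := by
  have hK0 : supConst p q ≠ 0 := (zero_lt_one.trans_le (one_le_supConst hp)).ne'
  have hKt : supConst p q ≠ ∞ := supConst_ne_top hp
  have key : ∀ t : ℝ≥0∞, t ≠ 0 → t ≠ ∞ → capacity μ F s p q (⋃ i, E i) ≤ t ^ p := by
    intro t ht ht'
    -- The choice `b i = K ^ (-(i + 1)) * t / 2`, with `K = supConst p q`, cancels every weight and
    -- makes the bound exactly `t ^ p`.
    have := capacity_iUnion_le (μ := μ) (F := F) (s := s) hp hq (E := E)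
      (b := fun i => (supConst p q ^ (i + 1))⁻¹ * (2⁻¹ * t)) fun i => by
        rw [h i]
        refine ENNReal.rpow_pos (pos_iff_ne_zero.2 (mul_ne_zero
          (ENNReal.inv_ne_zero.2 (ENNReal.pow_ne_top hKt)) (mul_ne_zero (by norm_num) ht))) ?_
        exact ENNReal.mul_ne_top (ENNReal.inv_ne_top.2 (pow_ne_zero _ hK0))
          (ENNReal.mul_ne_top (by norm_num) ht')
    refine this.trans (ENNReal.rpow_le_rpow ?_ hp.le)
    rw [ENNReal.mul_iSup, ENNReal.mul_iSup]
    refine iSup_le fun i => le_of_eq ?_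
    rw [← mul_assoc (supConst p q), ← pow_succ', ← mul_assoc (supConst p q ^ (i + 1)),
      ENNReal.mul_inv_cancel (pow_ne_zero _ hK0) (ENNReal.pow_ne_top hKt), one_mul, ← mul_assoc,
      ENNReal.mul_inv_cancel (by norm_num) (by norm_num), one_mul]
  refine le_antisymm (le_of_forall_gt_imp_ge_of_dense fun ε hε => ?_) zero_le
  obtain ⟨δ, hδ, hδε⟩ := exists_between hε
  have h2 : δ ≠ ∞ := (hδε.trans_le le_top).ne
  have := key (δ ^ (1 / p)) (ENNReal.rpow_pos hδ h2).ne'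
    (ENNReal.rpow_ne_top_of_nonneg (by positivity) h2)
  rw [← ENNReal.rpow_mul, one_div_mul_cancel hp.ne', ENNReal.rpow_one] at this
  exact this.trans hδε.le

theorem capacity_union_le (hp : 0 < p) (hq : 0 < q) {E E' : Set X} {b : ℝ≥0∞}
    (h : capacity μ F s p q E < b ^ p) (h' : capacity μ F s p q E' < b ^ p) :
    capacity μ F s p q (E ∪ E') ≤ (2 * (supConst p q ^ 2 * b)) ^ p := by
  obtain ⟨w, U, hw, hU, hE, h1, h01⟩ := exists_of_capacity_lt hp h
  obtain ⟨w', U', hw', hU', hE', h1', h01'⟩ := exists_of_capacity_lt hp h'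
  have hm : NormLE μ F s p q (fun x => max (w x) (w' x)) (supConst p q ^ 2 * b) := by
    refine NormLE.of_pair hp hq hw hw' (hw.1.max hw'.1) (fun x => ?_) fun x y => ?_
    · simp only [Real.enorm_eq_ofReal_abs, ← ENNReal.ofReal_max]
      exact ENNReal.ofReal_le_ofReal abs_max_le_max_abs_abs
    · simp only [Real.enorm_eq_ofReal_abs, ← ENNReal.ofReal_max]
      exact ENNReal.ofReal_le_ofReal (abs_max_sub_max_le_max _ _ _ _)
  refine capacity_le_of_normLE hp hm (hU.union hU') (union_subset_union hE hE') ?_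
  rintro x (hx | hx)
  · exact le_max_of_le_left (h1 x hx).symm.le
  · exact le_max_of_le_right (h1' x hx).symm.le

end RealFunctions

/-! ### Doubling, mass bounds and separability -/

section Geometry

variable {X : Type*} [MetricSpace X] [MeasurableSpace X] {μ : Measure X} {Q : ℝ}

theorem HasDoublingDimension.exists_doubling (hμ : BallsPosFinite μ)
    (hdim : HasDoublingDimension μ Q) {M : ℝ} (hM : 1 ≤ M) :
    ∃ D : ℝ≥0∞, D ≠ ∞ ∧ ∀ (x y : X) (r : ℝ), 0 < r → dist y x < M * r →
      μ (Metric.ball x (M * r)) ≤ D * μ (Metric.ball y r) := by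
  obtain ⟨C, hC, H⟩ := hdim
  have hpos : 0 < C * (1 / M) ^ Q := by positivity
  refine ⟨(ENNReal.ofReal (C * (1 / M) ^ Q))⁻¹, ?_, fun x y r hr hy => ?_⟩
  · exact ENNReal.inv_ne_top.2 (ENNReal.ofReal_pos.2 hpos).ne'
  · have h := H x y r (M * r) hr (le_mul_of_one_le_left hr.le hM) hy
    have hq : r / (M * r) = 1 / M := by field_simp
    have hb := hμ x (M * r) (by positivity)
    rw [hq, ENNReal.le_div_iff_mul_le (Or.inl hb.1.ne') (Or.inl hb.2.ne)] at h
    rw [mul_comm _ (μ (Metric.ball y r)), ← div_eq_mul_inv, ENNReal.le_div_iff_mul_le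
      (Or.inl (ENNReal.ofReal_pos.2 hpos).ne') (Or.inl ENNReal.ofReal_ne_top), mul_comm]
    exact h

theorem HasDoublingDimension.exists_lower_mass (hμ : BallsPosFinite μ)
    (hdim : HasDoublingDimension μ Q) (x : X) {R : ℝ} (hR : 0 < R) :
    ∃ b : ℝ, 0 < b ∧ ∀ y ∈ Metric.ball x R, ∀ r, 0 < r → r ≤ R →
      ENNReal.ofReal (b * r ^ Q) ≤ μ (Metric.ball y r) := by
  obtain ⟨C, hC, H⟩ := hdim
  have hb := hμ x R hR
  have hm : 0 < (μ (Metric.ball x R)).toReal := ENNReal.toReal_pos hb.1.ne' hb.2.ne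
  refine ⟨C * (μ (Metric.ball x R)).toReal / R ^ Q, by positivity, fun y hy r hr hrR => ?_⟩
  have h := H x y r R hr hrR hy
  rw [ENNReal.le_div_iff_mul_le (Or.inl hb.1.ne') (Or.inl hb.2.ne),
    ← ENNReal.ofReal_toReal hb.2.ne, ← ENNReal.ofReal_mul (by positivity)] at h
  convert h using 2
  rw [Real.div_rpow hr.le hR.le]
  ring

theorem BallsPosFinite.sigmaFinite (hμ : BallsPosFinite μ) : SigmaFinite μ := by
  rcases isEmpty_or_nonempty X with hX | ⟨⟨x⟩⟩
  · rw [Measure.eq_zero_of_isEmpty μ]; infer_instance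
  · refine ⟨⟨⟨fun n => Metric.ball x (n + 1), fun _ => trivial,
      fun n => (hμ x _ (by positivity)).2, ?_⟩⟩⟩
    refine eq_univ_of_forall fun y => ?_
    obtain ⟨n, hn⟩ := exists_nat_gt (dist y x)
    exact mem_iUnion.2 ⟨n, by rw [Metric.mem_ball]; linarith⟩

/-- A maximal `ε`-separated set is `ε`-dense. Its points carry disjoint balls of positive measure,
and σ-finiteness allows only countably many of these. -/
theorem BallsPosFinite.secondCountable [BorelSpace X] (hμ : BallsPosFinite μ) :
    SecondCountableTopology X := by
  have := hμ.sigmaFinite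
  refine Metric.secondCountable_of_almost_dense_set fun ε hε => ?_
  obtain ⟨S, hS⟩ := zorn_subset {S : Set X | S.Pairwise fun x y => ε ≤ dist x y}
    fun c hc hchain => ⟨⋃₀ c, (pairwise_sUnion hchain.directedOn).2 fun s hs => hc hs,
      fun s hs => subset_sUnion_of_mem hs⟩
  refine ⟨S, ?_, fun x => ?_⟩
  · have h := Measure.countable_meas_pos_of_disjoint_iUnion (μ := μ)
      (As := fun x : S => Metric.ball (x : X) (ε / 2)) (fun _ => Metric.isOpen_ball.measurableSet)
      fun x y hxy => Metric.ball_disjoint_ball (by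
        have := hS.prop x.2 y.2 (Subtype.coe_injective.ne hxy)
        linarith)
    have h2 : {i : S | 0 < μ (Metric.ball (i : X) (ε / 2))} = univ :=
      eq_univ_of_forall fun x => (hμ x _ (by positivity)).1
    rw [h2, countable_univ_iff] at h
    exact h
  · by_contra! hcon
    have hx : insert x S ∈ {S : Set X | S.Pairwise fun x y => ε ≤ dist x y} := by
      refine hS.prop.insert fun y hy _ => ⟨(hcon y hy).le, ?_⟩
      rw [dist_comm]; exact (hcon y hy).le
    have := hS.le_of_ge hx (subset_insert x S) (mem_insert x S)
    have h3 := hcon x this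
    rw [dist_self] at h3
    linarith

end Geometry

/-! ### Collapsing a fractional gradient to a single function at small scales -/

section LocalGradient

variable {X : Type*} [MetricSpace X] [MeasurableSpace X] {μ : Measure X} {F : Scale} {s p : ℝ}
  {q : ℝ≥0∞}

/-- The part of a sequence of functions that describes the scales below `2 ^ (-m)`. -/
def tailSeq (m : ℤ) (g : ℤ → X → ℝ≥0∞) : ℤ → X → ℝ≥0∞ := fun k x => if m ≤ k then g k x else 0

omit [MetricSpace X] in
theorem lpQuasiNorm_le_mixedNorm (hp : 0 < p) (hq : 0 < q) (g : ℤ → X → ℝ≥0∞) (k : ℤ) :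
    lpQuasiNorm μ p (g k) ≤ mixedNorm μ p q g F := by
  cases F
  · exact le_lqQuasiNorm hq (fun k => lpQuasiNorm μ p (g k)) k
  · exact lpQuasiNorm_mono hp fun x => le_lqQuasiNorm hq (fun k => g k x) k

/-- The weighted supremum of a sequence of functions over the scales below `2 ^ (-m)`. -/
noncomputable def weightedSup (δ : ℝ) (m : ℤ) (g : ℤ → X → ℝ≥0∞) (x : X) : ℝ≥0∞ :=
  ⨆ n : ℕ, ENNReal.ofReal (2 ^ (-δ)) ^ n * g (m + n) x

omit [MetricSpace X] in
theorem aemeasurable_weightedSup {δ : ℝ} {m : ℤ} {g : ℤ → X → ℝ≥0∞}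
    (hg : ∀ k, AEMeasurable (g k) μ) : AEMeasurable (weightedSup δ m g) μ :=
  AEMeasurable.iSup fun n => (hg (m + n)).const_mul _

variable (μ F) in
omit [MetricSpace X] in
-- Each `g (m + n)` has `L^p` norm at most the mixed norm of the tail, and the weights `2 ^ (-δ n)`
-- make the `p`-th powers summable. Only this termwise bound is used, so both scales and every `q`
-- are covered at once.
theorem exists_lpQuasiNorm_weightedSup_le (hp : 0 < p) (hq : 0 < q) {δ : ℝ} (hδ : 0 < δ) :
    ∃ C : ℝ≥0∞, C ≠ ∞ ∧ ∀ (m : ℤ) (g : ℤ → X → ℝ≥0∞), (∀ k, AEMeasurable (g k) μ) →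
      lpQuasiNorm μ p (weightedSup δ m g) ≤ C * mixedNorm μ p q (tailSeq m g) F := by
  set t : ℝ≥0∞ := ENNReal.ofReal (2 ^ (-δ)) with ht
  have htp : t ^ p < 1 := by
    refine ENNReal.rpow_lt_one ?_ hp
    rw [ht, ← ENNReal.ofReal_one]
    refine (ENNReal.ofReal_lt_ofReal_iff (by norm_num)).2 ?_
    exact Real.rpow_lt_one_of_one_lt_of_neg (by norm_num) (by linarith)
  refine ⟨((1 - t ^ p)⁻¹) ^ (1 / p), ENNReal.rpow_ne_top_of_nonneg (by positivity)
    (ENNReal.inv_ne_top.2 (tsub_pos_of_lt htp).ne'), fun m g hg => ?_⟩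
  set T := mixedNorm μ p q (tailSeq m g) F
  have h1 : ∀ n : ℕ, ∫⁻ x, g (m + n) x ^ p ∂μ ≤ T ^ p := by
    intro n
    rw [← lpQuasiNorm_le_iff hp]
    have h := lpQuasiNorm_le_mixedNorm (μ := μ) (F := F) hp hq (tailSeq m g) (m + n)
    have h2 : tailSeq m g (m + n) = g (m + n) := by
      funext x
      exact if_pos (by omega)
    rwa [h2] at h
  rw [lpQuasiNorm_le_iff hp, ENNReal.mul_rpow_of_nonneg _ _ hp.le, ← ENNReal.rpow_mul,
    one_div_mul_cancel hp.ne', ENNReal.rpow_one]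
  calc ∫⁻ x, weightedSup δ m g x ^ p ∂μ
      ≤ ∫⁻ x, ∑' n : ℕ, (t ^ n * g (m + n) x) ^ p ∂μ :=
        lintegral_mono fun x => iSup_rpow_le_tsum hp _
    _ = ∑' n : ℕ, ∫⁻ x, (t ^ n * g (m + n) x) ^ p ∂μ :=
        lintegral_tsum fun n => ((hg (m + n)).const_mul _).pow_const _
    _ ≤ ∑' n : ℕ, (t ^ p) ^ n * T ^ p := by
        refine ENNReal.tsum_le_tsum fun n => ?_
        simp_rw [ENNReal.mul_rpow_of_nonneg _ _ hp.le]
        rw [lintegral_const_mul'' _ ((hg (m + n)).pow_const _), ← ENNReal.rpow_natCast t,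
          ← ENNReal.rpow_natCast (t ^ p), ← ENNReal.rpow_mul, ← ENNReal.rpow_mul, mul_comm p]
        exact mul_le_mul_right (h1 n) _
    _ = _ := by rw [ENNReal.tsum_mul_right, ENNReal.tsum_geometric]

theorem exists_dyadic_scale {d : ℝ} (hd : 0 < d) :
    ∃ k : ℤ, (2 : ℝ) ^ (-k - 1) ≤ d ∧ d < (2 : ℝ) ^ (-k) := by
  obtain ⟨n, h1, h2⟩ := exists_mem_Ico_zpow hd one_lt_two
  exact ⟨-n - 1, by simpa using h1, by simpa [add_comm] using h2⟩

theorem le_of_dyadic_scale {d : ℝ} {k m : ℤ} (h1 : (2 : ℝ) ^ (-k - 1) ≤ d)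
    (h2 : d < (2 : ℝ) ^ (-m)) : m ≤ k := by
  have := (zpow_lt_zpow_iff_right₀ (one_lt_two (α := ℝ))).1 (h1.trans_lt h2)
  omega

omit [MeasurableSpace X] in
-- A pair at dyadic scale `m + n` has `d ^ s = d ^ σ * d ^ (s - σ)` with `d ^ (s - σ) ≤ 2 ^ (-(m +
-- n)(s - σ))`. Lowering the exponent to `σ` thus pays for the decaying weight; `σ = 0` is used for
-- smoothing, `0 < σ < s` for integrability.
theorem enorm_sub_le_weightedSup {u : X → ℝ} {g : ℤ → X → ℝ≥0∞} {E : Set X}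
    (H : ∀ k : ℤ, ∀ x ∉ E, ∀ y ∉ E, (2 : ℝ) ^ (-k - 1) ≤ dist x y → dist x y < (2 : ℝ) ^ (-k) →
        ‖u x - u y‖ₑ ≤ ENNReal.ofReal (dist x y ^ s) * (g k x + g k y))
    {σ : ℝ} (hσ : σ ≤ s) (m : ℤ) {x y : X} (hx : x ∉ E) (hy : y ∉ E)
    (hxy : dist x y < (2 : ℝ) ^ (-m)) :
    ‖u x - u y‖ₑ ≤ ENNReal.ofReal (dist x y ^ σ) *
      (ENNReal.ofReal (((2 : ℝ) ^ (-m)) ^ (s - σ)) * weightedSup (s - σ) m g x +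
        ENNReal.ofReal (((2 : ℝ) ^ (-m)) ^ (s - σ)) * weightedSup (s - σ) m g y) := by
  rcases eq_or_ne x y with rfl | hne
  · simp
  have hd : 0 < dist x y := dist_pos.2 hne
  obtain ⟨k, h1, h2⟩ := exists_dyadic_scale hd
  obtain ⟨n, rfl⟩ := Int.le.dest (le_of_dyadic_scale h1 hxy)
  refine (H _ x hx y hy h1 h2).trans ?_
  have h3 : ENNReal.ofReal (dist x y ^ s) ≤ ENNReal.ofReal (dist x y ^ σ) *
      (ENNReal.ofReal (((2 : ℝ) ^ (-m)) ^ (s - σ)) * ENNReal.ofReal (2 ^ (-(s - σ))) ^ n) := by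
    rw [← ENNReal.ofReal_pow (by positivity), ← ENNReal.ofReal_mul (by positivity),
      ← ENNReal.ofReal_mul (by positivity)]
    refine ENNReal.ofReal_le_ofReal ?_
    have h4 : dist x y ^ s = dist x y ^ σ * dist x y ^ (s - σ) := by
      rw [← Real.rpow_add hd]; congr 1; ring
    have h5 : ((2 : ℝ) ^ (-m)) ^ (s - σ) * (2 ^ (-(s - σ))) ^ n =
        ((2 : ℝ) ^ (-(m + (n : ℤ)))) ^ (s - σ) := by
      rw [← Real.rpow_natCast (2 ^ (-(s - σ))), ← Real.rpow_mul (by norm_num),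
        ← Real.rpow_intCast, ← Real.rpow_intCast, ← Real.rpow_mul (by norm_num),
        ← Real.rpow_mul (by norm_num), ← Real.rpow_add (by norm_num)]
      congr 1
      push_cast
      ring
    rw [h4, h5]
    gcongr
  refine (mul_le_mul_left h3 _).trans ?_
  rw [mul_assoc, mul_assoc, ← mul_add, mul_add (ENNReal.ofReal (2 ^ (-(s - σ))) ^ n)]
  gcongr
  · exact le_iSup (fun n : ℕ => ENNReal.ofReal (2 ^ (-(s - σ))) ^ n * g (m + n) x) n
  · exact le_iSup (fun n : ℕ => ENNReal.ofReal (2 ^ (-(s - σ))) ^ n * g (m + n) y) n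

end LocalGradient

/-! ### Integrability on balls -/

section Integrability

variable {X : Type*} [MetricSpace X] [MeasurableSpace X] {μ : Measure X} {F : Scale} {s p Q : ℝ}
  {q : ℝ≥0∞}

/-- The set where `h > 2 ^ k` is too small to contain a ball of radius about `2 ^ (-k p / Q)`, so a
point with `h ≤ 2 ^ (k + 1)` has a neighbour at that distance with `h ≤ 2 ^ k`. Descending to a
fixed level `k₀`, where `u` is bounded, the increments sum to a geometric series of ratio `2 ^ p`,
hence to a multiple of `h ^ p`. -/
theorem exists_bound_of_hajlasz (hμ : BallsPosFinite μ) (hQ : 0 < Q)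
    (hdim : HasDoublingDimension μ Q) {σ : ℝ} (hσ : 0 < σ) (hp0 : 0 < p) (hp : Q / (Q + σ) ≤ p)
    {u : X → ℝ} {h : X → ℝ≥0∞} (hm : AEMeasurable h μ) (hfin : ∫⁻ x, h x ^ p ∂μ ≠ ∞)
    {E : Set X} (hE : μ E = 0) (x₀ : X) {r : ℝ} (hr : 0 < r)
    (H : ∀ x ∉ E, ∀ y ∉ E, dist x y < 4 * r →
      ‖u x - u y‖ₑ ≤ ENNReal.ofReal (dist x y ^ σ) * (h x + h y)) :
    ∃ M : ℝ, ∀ x ∉ E, x ∈ Metric.ball x₀ r → h x ≠ ∞ →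
      ‖u x‖ₑ ≤ ENNReal.ofReal M * (1 + h x ^ p) := by
  obtain ⟨b, hb, Hb⟩ := hdim.exists_lower_mass hμ x₀ (R := 2 * r) (by positivity)
  set A : ℕ → Set X := fun k => {x | x ∉ E ∧ x ∈ Metric.ball x₀ (2 * r) ∧ h x ≤ 2 ^ k} with hA
  -- The added 1 makes `I` positive and the Chebyshev estimate strict.
  set I : ℝ := (∫⁻ x, h x ^ p ∂μ).toReal + 1 with hI
  have hI0 : 0 < I := by positivity
  set t : ℝ := 2 ^ (-(p / Q)) with ht
  have ht0 : 0 < t := by positivity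
  have ht1 : t < 1 := Real.rpow_lt_one_of_one_lt_of_neg (by norm_num) (by
    have : 0 < p / Q := by positivity
    linarith)
  -- The radii `c * t ^ k` are chosen so that the lower mass bound `b * (c * t ^ k) ^ Q` equals the
  -- Chebyshev bound `I / 2 ^ (p k)`.
  set c : ℝ := (I / b) ^ (1 / Q) with hc
  have hc0 : 0 < c := by positivity
  set β : ℝ := 2 ^ p with hβ
  have hβ1 : 1 < β := Real.one_lt_rpow (by norm_num) hp0
  -- the complement of `A k` is small
  have hsmall : ∀ k, μ (Metric.ball x₀ (2 * r) \ A k) < ENNReal.ofReal (b * (c * t ^ k) ^ Q) := by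
    intro k
    have h1 : b * (c * t ^ k) ^ Q = I / β ^ k := by
      rw [Real.mul_rpow hc0.le (by positivity), hc, ← Real.rpow_mul (by positivity),
        one_div_mul_cancel hQ.ne', Real.rpow_one, ht, ← Real.rpow_natCast,
        ← Real.rpow_mul (by positivity), ← Real.rpow_mul (by positivity), hβ, ← Real.rpow_natCast,
        ← Real.rpow_mul (by positivity)]
      have h2 : -(p / Q) * (k * Q) = -(p * k) := by field_simp
      rw [h2, Real.rpow_neg (by norm_num)]
      field_simp
    have h2 : Metric.ball x₀ (2 * r) \ A k ⊆ E ∪ {x | ENNReal.ofReal (β ^ k) ≤ h x ^ p} := by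
      rintro x ⟨hx, hxA⟩
      by_cases hxE : x ∈ E
      · exact Or.inl hxE
      · right
        have h3 : ¬ h x ≤ 2 ^ k := fun h' => hxA ⟨hxE, hx, h'⟩
        have h4 : ENNReal.ofReal (β ^ k) = (2 ^ k : ℝ≥0∞) ^ p := by
          rw [hβ, ← Real.rpow_natCast, ← Real.rpow_mul (by norm_num), mul_comm, Real.rpow_mul
            (by norm_num), ← ENNReal.ofReal_rpow_of_nonneg (by positivity) hp0.le,
            Real.rpow_natCast, ENNReal.ofReal_pow (by norm_num)]
          norm_num
        rw [mem_ofPred_eq, h4]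
        exact ENNReal.rpow_le_rpow (not_le.1 h3).le hp0.le
    have h3 := mul_meas_ge_le_lintegral₀ (hm.pow_const p) (ENNReal.ofReal (β ^ k))
    have h4 : μ (Metric.ball x₀ (2 * r) \ A k) ≤ μ {x | ENNReal.ofReal (β ^ k) ≤ h x ^ p} := by
      refine (measure_mono h2).trans ((measure_union_le _ _).trans ?_)
      rw [hE, zero_add]
    have hβk : 0 < β ^ k := by positivity
    rw [h1, div_eq_mul_inv, ENNReal.ofReal_mul hI0.le, ENNReal.ofReal_inv_of_pos hβk,
      ← div_eq_mul_inv]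
    refine h4.trans_lt ?_
    rw [ENNReal.lt_div_iff_mul_lt (Or.inl (ENNReal.ofReal_pos.2 hβk).ne')
      (Or.inl ENNReal.ofReal_ne_top), mul_comm]
    refine h3.trans_lt ?_
    rw [ENNReal.lt_ofReal_iff_toReal_lt hfin, hI]
    linarith
  -- the oscillation between consecutive levels
  have hstep : ∀ k, 2 ^ k * (c * t ^ k) ^ σ ≤ c ^ σ * β ^ k := by
    intro k
    rw [Real.mul_rpow hc0.le (by positivity), mul_left_comm]
    gcongr
    rw [ht, hβ, ← Real.rpow_natCast, ← Real.rpow_natCast, ← Real.rpow_mul (by positivity),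
      ← Real.rpow_mul (by positivity), ← Real.rpow_add (by norm_num), ← Real.rpow_natCast,
      ← Real.rpow_mul (by positivity)]
    refine Real.rpow_le_rpow_of_exponent_le (by norm_num) ?_
    -- This is `p ≥ Q / (Q + σ)` rearranged; it makes the increments grow no faster than `2 ^ (p
    -- k)`.
    have h1 : 1 - p * σ / Q ≤ p := by
      rw [div_le_iff₀ (by positivity)] at hp
      rw [sub_le_iff_le_add, ← sub_le_iff_le_add', le_div_iff₀ hQ]
      linarith
    calc (k : ℝ) + -(p / Q) * (k * σ) = (1 - p * σ / Q) * k := by ring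
      _ ≤ p * k := by gcongr
  obtain ⟨k₀, hk₀⟩ : ∃ k₀ : ℕ, c / (1 - t) * t ^ k₀ < r := by
    have h1 : Tendsto (fun k : ℕ => c / (1 - t) * t ^ k) atTop (𝓝 (c / (1 - t) * 0)) :=
      (tendsto_pow_atTop_nhds_zero_of_lt_one ht0.le ht1).const_mul _
    rw [mul_zero] at h1
    exact (h1.eventually_lt_const hr).exists
  -- `R k` is the tail sum of the radii `c * t ^ j` over `j ≥ k`; `R k₀ < r` keeps the chain inside
  -- the ball of radius `2 * r`.
  set R : ℕ → ℝ := fun k => c / (1 - t) * t ^ k with hR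
  have h1t : 0 < 1 - t := by linarith
  have hRpos : ∀ k, 0 < R k := fun k => by positivity
  have hRstep : ∀ k, c * t ^ k + R (k + 1) = R k := by
    intro k
    simp only [hR, pow_succ]
    field_simp
    ring
  have hRanti : ∀ n, R (k₀ + n) ≤ R k₀ := by
    intro n
    simp only [hR]
    gcongr c / (1 - t) * ?_
    exact pow_le_pow_of_le_one ht0.le ht1.le (by omega)
  have hreal : ∀ x y (k : ℕ), x ∈ A (k + 1) → y ∈ A k → dist x y < 4 * r →
      |u x - u y| ≤ dist x y ^ σ * (3 * 2 ^ k) := by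
    intro x y k hx hy hxy
    have h1 := H x hx.1 y hy.1 hxy
    have h2 : h x + h y ≤ ENNReal.ofReal (3 * 2 ^ k) := by
      rw [ENNReal.ofReal_mul (by norm_num), ENNReal.ofReal_pow (by norm_num)]
      norm_num
      refine (add_le_add hx.2.2 hy.2.2).trans (le_of_eq ?_)
      rw [pow_succ]
      ring
    have h3 := h1.trans (mul_le_mul_right h2 _)
    rw [← ENNReal.ofReal_mul (by positivity), Real.enorm_eq_ofReal_abs] at h3
    exact (ENNReal.ofReal_le_ofReal_iff (by positivity)).1 h3
  have hdist : ∀ x y, x ∈ Metric.ball x₀ (2 * r) → y ∈ Metric.ball x₀ (2 * r) →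
      dist x y < 4 * r := by
    intro x y hx hy
    rw [Metric.mem_ball] at hx hy
    linarith [dist_triangle_right x y x₀]
  obtain ⟨M₀, hM₀, HM₀⟩ : ∃ M₀ : ℝ, 0 ≤ M₀ ∧ ∀ x ∈ A k₀, |u x| ≤ M₀ := by
    rcases (A k₀).eq_empty_or_nonempty with hemp | ⟨y, hy⟩
    · exact ⟨0, le_rfl, fun x hx => by simp [hemp] at hx⟩
    · refine ⟨|u y| + (4 * r) ^ σ * (3 * 2 ^ k₀), by positivity, fun x hx => ?_⟩
      have hxy := hdist x y hx.2.1 hy.2.1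
      have hx' : x ∈ A (k₀ + 1) := ⟨hx.1, hx.2.1, hx.2.2.trans
        (pow_le_pow_right₀ (by norm_num) (by omega))⟩
      have h1 := hreal x y k₀ hx' hy hxy
      have h2 : dist x y ^ σ * (3 * 2 ^ k₀) ≤ (4 * r) ^ σ * (3 * 2 ^ k₀) := by gcongr
      have h3 := abs_sub_abs_le_abs_sub (u x) (u y)
      linarith
  -- `L` solves `L * β = L + 3 * c ^ σ`, which closes the induction.
  set L : ℝ := 3 * c ^ σ / (β - 1) with hL
  have hβ0 : 0 < β - 1 := by linarith
  have hL0 : 0 < L := by positivity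
  have hLβ : L * β = L + 3 * c ^ σ := by rw [hL]; field_simp; ring
  -- `R k₀ - R (k₀ + n)` is the length that the chain may still travel on its way down to level
  -- `k₀`.
  have hind : ∀ n, ∀ x ∈ A (k₀ + n), dist x x₀ + R k₀ - R (k₀ + n) < 2 * r →
      |u x| ≤ M₀ + L * β ^ (k₀ + n) := by
    intro n
    induction n with
    | zero =>
      intro x hx _
      have : 0 < L * β ^ (k₀ + 0) := by positivity
      linarith [HM₀ x hx]
    | succ n ih =>
      intro x hx hxd
      set k := k₀ + n with hk
      have hρ0 : 0 < c * t ^ k := by positivity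
      have hρr : c * t ^ k ≤ r := by linarith [hRstep k, hRpos (k + 1), hRanti n]
      have hsub : Metric.ball x (c * t ^ k) ⊆ Metric.ball x₀ (2 * r) := by
        intro y hy
        rw [Metric.mem_ball] at hy ⊢
        have h1 := hRstep k
        have h2 := hRanti n
        have h3 : R (k₀ + (n + 1)) = R (k + 1) := rfl
        linarith [dist_triangle y x x₀]
      have hmass := (hsmall k).trans_le (Hb x hx.2.1 (c * t ^ k) hρ0 (by linarith))
      obtain ⟨y, hy, hyA⟩ : ∃ y ∈ Metric.ball x (c * t ^ k), y ∈ A k := by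
        by_contra! hcon
        refine absurd hmass (not_lt.2 (measure_mono fun y hy => ⟨hsub hy, hcon y hy⟩))
      have hyd := Metric.mem_ball'.1 hy
      have h1 : |u y| ≤ M₀ + L * β ^ k := by
        refine ih y hyA ?_
        have h1 := hRstep k
        have h3 : R (k₀ + (n + 1)) = R (k + 1) := rfl
        have h4 := dist_triangle_left y x₀ x
        linarith
      have h2 := hreal x y k hx hyA (hdist x y hx.2.1 hyA.2.1)
      have h3 : dist x y ^ σ * (3 * 2 ^ k) ≤ 3 * c ^ σ * β ^ k := by
        have : dist x y ^ σ ≤ (c * t ^ k) ^ σ := by gcongr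
        have h4 := hstep k
        have h5 : (0 : ℝ) < 2 ^ k := by positivity
        nlinarith
      have h4 := abs_sub_abs_le_abs_sub (u x) (u y)
      have h5 : L * β ^ (k₀ + (n + 1)) = L * β ^ k + 3 * c ^ σ * β ^ k := by
        rw [show k₀ + (n + 1) = k + 1 from rfl, pow_succ, ← add_mul, ← hLβ]
        ring
      rw [h5]
      linarith
  refine ⟨M₀ + L * β ^ k₀ + L * β, fun x hxE hxB hx => ?_⟩
  have hex : ∃ n : ℕ, h x ≤ 2 ^ (k₀ + n) := by
    obtain ⟨n, hn⟩ := ENNReal.exists_nat_gt hx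
    refine ⟨n, hn.le.trans ?_⟩
    have : (n : ℝ≥0∞) ≤ 2 ^ n := by exact_mod_cast Nat.lt_two_pow_self.le
    exact this.trans (pow_le_pow_right₀ (by norm_num) (by omega))
  classical
  have hxB' : x ∈ Metric.ball x₀ (2 * r) := Metric.ball_subset_ball (by linarith) hxB
  have hfind := Nat.find_spec hex
  have hbound := hind (Nat.find hex) x ⟨hxE, hxB', hfind⟩ (by
    have := Metric.mem_ball.1 hxB
    have h2 := hRpos (k₀ + Nat.find hex)
    linarith)
  rw [Real.enorm_eq_ofReal_abs]
  rcases hn : Nat.find hex with _ | n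
  · rw [hn, add_zero] at hbound
    refine (ENNReal.ofReal_le_ofReal (hbound.trans ?_)).trans (le_mul_of_one_le_right' ?_)
    · have : 0 < L * β := by positivity
      linarith
    · exact le_self_add
  -- Minimality of the level gives the reverse inequality for `h x`, which turns the power of `β`
  -- into `h x ^ p`.
  · have hlt : ¬ h x ≤ 2 ^ (k₀ + n) := Nat.find_min hex (by omega)
    rw [hn] at hbound
    have h1 : ENNReal.ofReal (β ^ (k₀ + n)) ≤ h x ^ p := by
      have h4 : ENNReal.ofReal (β ^ (k₀ + n)) = (2 ^ (k₀ + n) : ℝ≥0∞) ^ p := by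
        rw [hβ, ← Real.rpow_natCast, ← Real.rpow_mul (by norm_num), mul_comm, Real.rpow_mul
          (by norm_num), ← ENNReal.ofReal_rpow_of_nonneg (by positivity) hp0.le,
          Real.rpow_natCast, ENNReal.ofReal_pow (by norm_num)]
        norm_num
      rw [h4]
      exact ENNReal.rpow_le_rpow (not_le.1 hlt).le hp0.le
    have hLβ0 : 0 ≤ L * β := by positivity
    have hLk : 0 ≤ L * β ^ k₀ := by positivity
    have h2 : M₀ + L * β ^ (k₀ + (n + 1)) = M₀ + L * β * β ^ (k₀ + n) := by
      rw [← add_assoc, pow_succ]; ring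
    rw [h2] at hbound
    refine (ENNReal.ofReal_le_ofReal hbound).trans ?_
    rw [ENNReal.ofReal_add hM₀ (by positivity), ENNReal.ofReal_mul hLβ0, mul_add, mul_one]
    gcongr
    · linarith
    · linarith

theorem NormLE.integrableOn_ball [BorelSpace X] (hμ : BallsPosFinite μ) (hQ : 0 < Q)
    (hdim : HasDoublingDimension μ Q) (hs : 0 < s) (hp : Q / (Q + s) < p) (hq : 0 < q)
    {u : X → ℝ} {a : ℝ≥0∞} (ha : a ≠ ∞) (h : NormLE μ F s p q u a) (x₀ : X) (r : ℝ) :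
    IntegrableOn u (Metric.ball x₀ r) μ := by
  rcases le_or_gt r 0 with hr | hr
  · rw [Metric.ball_eq_empty.2 hr]; exact integrableOn_empty
  have hp0 : 0 < p := lt_trans (by positivity) hp
  -- The lower bound on `σ` is `p > Q / (Q + σ)` solved for `σ`; staying below `s` keeps the decay
  -- exponent `s - σ` positive.
  obtain ⟨σ, hσ1, hσ2⟩ : ∃ σ, max 0 (Q * (1 - p) / p) < σ ∧ σ < s := by
    refine exists_between (max_lt hs ?_)
    rw [div_lt_iff₀ hp0]
    rw [div_lt_iff₀ (by positivity)] at hp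
    linarith
  have hσ0 : 0 < σ := (le_max_left _ _).trans_lt hσ1
  have hpσ : Q / (Q + σ) ≤ p := by
    have h1 := (le_max_right _ _).trans_lt hσ1
    rw [div_lt_iff₀ hp0] at h1
    rw [div_le_iff₀ (by positivity)]
    linarith
  obtain ⟨g, ⟨hm, E, hE, H⟩, hga⟩ := h.grad
  simp only [abs_coe_sub_coe] at H
  obtain ⟨m, -, hmr⟩ := exists_dyadic_scale (d := 4 * r) (by positivity)
  obtain ⟨C, hC, HC⟩ := exists_lpQuasiNorm_weightedSup_le μ F hp0 hq (δ := s - σ) (by linarith)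
  set c := ENNReal.ofReal (((2 : ℝ) ^ (-m)) ^ (s - σ))
  set f : X → ℝ≥0∞ := fun x => c * weightedSup (s - σ) m g x with hf
  have hfm : AEMeasurable f μ := (aemeasurable_weightedSup hm).const_mul _
  have hfin : ∫⁻ x, f x ^ p ∂μ ≠ ∞ := by
    rw [← lpQuasiNorm_rpow hp0, hf, lpQuasiNorm_const_mul hp0 ENNReal.ofReal_ne_top]
    refine ENNReal.rpow_ne_top_of_nonneg hp0.le (ENNReal.mul_ne_top ENNReal.ofReal_ne_top ?_)
    refine ne_top_of_le_ne_top (ENNReal.mul_ne_top hC ha) ((HC m g hm).trans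
      (mul_le_mul_right ((mixedNorm_mono hp0 fun k x => ?_).trans hga) _))
    unfold tailSeq
    split_ifs
    exacts [le_rfl, zero_le]
  obtain ⟨M, HM⟩ := exists_bound_of_hajlasz hμ hQ hdim hσ0 hp0 hpσ hfm hfin hE x₀ hr
    fun x hx y hy hxy => enorm_sub_le_weightedSup H hσ2.le m hx hy (hxy.trans hmr)
  refine ⟨h.1.aestronglyMeasurable.restrict, ?_⟩
  have hae : ∀ᵐ x ∂μ, x ∈ Metric.ball x₀ r →
      ‖u x‖ₑ ≤ ENNReal.ofReal M * (1 + f x ^ p) := by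
    have h1 : ∀ᵐ x ∂μ, x ∉ E := measure_eq_zero_iff_ae_notMem.1 hE
    filter_upwards [h1, ae_lt_top' (hfm.pow_const p) hfin] with x hx hx2 hxB
    exact HM x hx hxB fun htop => by simp [htop, ENNReal.top_rpow_of_pos hp0] at hx2
  have hball := (hμ x₀ r hr).2
  calc ∫⁻ x in Metric.ball x₀ r, ‖u x‖ₑ ∂μ
      ≤ ∫⁻ x in Metric.ball x₀ r, ENNReal.ofReal M * (1 + f x ^ p) ∂μ :=
        setLIntegral_mono_ae' Metric.isOpen_ball.measurableSet hae
    _ = ENNReal.ofReal M * (μ (Metric.ball x₀ r) + ∫⁻ x in Metric.ball x₀ r, f x ^ p ∂μ) := by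
        rw [lintegral_const_mul' _ _ ENNReal.ofReal_ne_top, lintegral_add_left measurable_const]
        simp
    _ < ∞ := ENNReal.mul_lt_top ENNReal.ofReal_lt_top (ENNReal.add_lt_top.2 ⟨hball,
        (setLIntegral_le_lintegral _ _).trans_lt hfin.lt_top⟩)

end Integrability

/-! ### Density for `q = ∞`: Hölder extension -/

section HolderApproximation

variable {X : Type*} [MetricSpace X]

/-- McShane's infimum formula for the metric `dist ^ s`, whose triangle inequality needs `s ≤ 1`,
followed by truncation to `[-M, M]`. -/
theorem exists_holder_extension {A : Set X} (hA : A.Nonempty) {u : X → ℝ} {s L M : ℝ}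
    (hs : 0 < s) (hs1 : s ≤ 1) (hL : 0 ≤ L) (hM : 0 ≤ M) (hb : ∀ x ∈ A, |u x| ≤ M)
    (hu : ∀ x ∈ A, ∀ y ∈ A, |u x - u y| ≤ L * dist x y ^ s) :
    ∃ v : X → ℝ, (∀ x ∈ A, v x = u x) ∧ (∀ x, |v x| ≤ M) ∧
      ∀ x y, |v x - v y| ≤ L * dist x y ^ s := by
  have := hA.to_subtype
  set v₀ : X → ℝ := fun x => ⨅ y : A, (u y + L * dist x y ^ s) with hv₀
  have hbdd : ∀ x : X, BddBelow (range fun y : A => u y + L * dist x y ^ s) := by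
    refine fun x => ⟨-M, ?_⟩
    rintro _ ⟨y, rfl⟩
    have h1 := (abs_le.1 (hb y y.2)).1
    have h2 : 0 ≤ L * dist x y ^ s := by positivity
    dsimp only
    linarith
  have hle : ∀ x y, v₀ x - v₀ y ≤ L * dist x y ^ s := by
    intro x y
    rw [sub_le_iff_le_add, ← sub_le_iff_le_add']
    refine le_ciInf fun z => ?_
    have h1 : v₀ x ≤ u z + L * dist x z ^ s := ciInf_le (hbdd x) z
    have h2 : dist x z ^ s ≤ dist x y ^ s + dist y z ^ s :=
      (Real.rpow_le_rpow dist_nonneg (dist_triangle x y z) hs.le).trans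
        (Real.rpow_add_le_add_rpow dist_nonneg dist_nonneg hs.le hs1)
    have h3 := mul_le_mul_of_nonneg_left h2 hL
    linarith
  have heq : ∀ x ∈ A, v₀ x = u x := by
    intro x hx
    refine le_antisymm ?_ (le_ciInf fun y => ?_)
    · have h := ciInf_le (hbdd x) ⟨x, hx⟩
      simpa [Real.zero_rpow hs.ne'] using h
    · have := (abs_le.1 (hu x hx y y.2)).2
      linarith
  refine ⟨fun x => max (-M) (min (v₀ x) M), fun x hx => ?_, fun x => ?_, fun x y => ?_⟩
  · dsimp only
    have := abs_le.1 (hb x hx)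
    rw [heq x hx, min_eq_left this.2, max_eq_right this.1]
  · exact abs_le.2 ⟨le_max_left _ _, max_le (by linarith) (min_le_right _ _)⟩
  · refine (abs_max_sub_max_le_max _ _ _ _).trans (max_le ?_ ?_)
    · simp only [sub_self, abs_zero]
      positivity
    · refine (abs_min_sub_min_le_max _ _ _ _).trans (max_le ?_ ?_)
      · refine abs_sub_le_iff.2 ⟨hle x y, ?_⟩
        rw [dist_comm]
        exact hle y x
      · simp only [sub_self, abs_zero]
        positivity

theorem continuous_of_holder {v : X → ℝ} {s L : ℝ} (hs : 0 < s)
    (hv : ∀ x y, |v x - v y| ≤ L * dist x y ^ s) : Continuous v := by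
  refine continuous_iff_continuousAt.2 fun x => ?_
  rw [ContinuousAt, tendsto_iff_dist_tendsto_zero]
  have h1 : Tendsto (fun y => L * dist y x ^ s) (𝓝 x) (𝓝 (L * 0 ^ s)) := by
    have h2 : Tendsto (fun y => dist y x) (𝓝 x) (𝓝 0) := tendsto_iff_dist_tendsto_zero.1 tendsto_id
    exact (h2.rpow_const (Or.inr hs.le)).const_mul L
  rw [Real.zero_rpow hs.ne', mul_zero] at h1
  exact squeeze_zero (fun _ => dist_nonneg) (fun y => by rw [Real.dist_eq]; exact hv y x) h1

variable [MeasurableSpace X] {μ : Measure X} {s p : ℝ}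

omit [MetricSpace X] in
theorem tendsto_lpQuasiNorm_indicator_gt (hp : 0 < p) {H : X → ℝ≥0∞} (hm : AEMeasurable H μ)
    (hfin : ∫⁻ x, H x ^ p ∂μ ≠ ∞) :
    Tendsto (fun n : ℕ => lpQuasiNorm μ p ({x | (n : ℝ≥0∞) < H x}.indicator H)) atTop (𝓝 0) := by
  have hHf : ∀ᵐ x ∂μ, H x ≠ ∞ := by
    filter_upwards [ae_lt_top' (hm.pow_const p) hfin] with x hx htop
    simp [htop, ENNReal.top_rpow_of_pos hp] at hx
  have h1 : Tendsto (fun n : ℕ => ∫⁻ x, ({x | (n : ℝ≥0∞) < H x}.indicator H x) ^ p ∂μ) atTop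
      (𝓝 (∫⁻ _, 0 ∂μ)) := by
    refine tendsto_lintegral_of_dominated_convergence' (fun x => H x ^ p) (fun n => ?_)
      (fun n => Eventually.of_forall fun x => ?_) hfin ?_
    · exact (hm.indicator₀ (nullMeasurableSet_lt aemeasurable_const hm)).pow_const _
    · exact ENNReal.rpow_le_rpow (indicator_le_self _ _ x) hp.le
    · filter_upwards [hHf] with x hx
      obtain ⟨N, hN⟩ := ENNReal.exists_nat_gt hx
      refine tendsto_const_nhds.congr' ?_
      filter_upwards [eventually_ge_atTop N] with n hn
      rw [indicator_of_notMem, ENNReal.zero_rpow_of_pos hp]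
      simp only [mem_ofPred_eq, not_lt]
      exact hN.le.trans (by exact_mod_cast hn)
  rw [lintegral_zero] at h1
  have h2 := (ENNReal.continuous_rpow_const (y := 1 / p)).tendsto 0 |>.comp h1
  rw [ENNReal.zero_rpow_of_pos (by positivity)] at h2
  exact h2

/-- Where `H = max |u| G` is at most `n`, `u` is bounded and Hölder; `v` extends this restriction.
The difference vanishes almost everywhere on `{H ≤ n}`, and `4 H` on the set `{H > n}` bounds both
its size and its gradient. Dominated convergence makes this small for large `n`. -/
theorem exists_continuous_approx_of_top [BorelSpace X] (hs : 0 < s) (hs1 : s ≤ 1) (hp : 0 < p)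
    {u : X → ℝ} {a : ℝ≥0∞} (ha : a ≠ ∞) (h : NormLE μ .triebelLizorkin s p ∞ u a) {ε : ℝ≥0∞}
    (hε : 0 < ε) :
    ∃ v : X → ℝ, Continuous v ∧ NormLE μ .triebelLizorkin s p ∞ (fun x => u x - v x) ε := by
  obtain ⟨g, ⟨hm, E, hE, Hg⟩, hga⟩ := h.grad
  simp only [abs_coe_sub_coe] at Hg
  set G : X → ℝ≥0∞ := fun x => ⨆ k, g k x with hG
  have hGm : AEMeasurable G μ := AEMeasurable.iSup hm
  set H : X → ℝ≥0∞ := fun x => max ‖u x‖ₑ (G x) with hH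
  have hHm : AEMeasurable H μ := h.1.enorm.max hGm
  have huH : ∀ x, ‖u x‖ₑ ≤ H x := fun x => le_max_left _ _
  have hfin : ∫⁻ x, H x ^ p ∂μ ≠ ∞ := by
    have h1 : ∀ x, H x ^ p ≤ ‖u x‖ₑ ^ p + G x ^ p := by
      intro x
      rcases max_choice ‖u x‖ₑ (G x) with h2 | h2 <;> simp only [hH, h2]
      exacts [le_self_add, le_add_self]
    refine ne_top_of_le_ne_top ?_ (lintegral_mono h1)
    rw [lintegral_add_left' (h.1.enorm.pow_const p)]
    refine ENNReal.add_ne_top.2 ⟨?_, ?_⟩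
    · exact ne_top_of_le_ne_top (ENNReal.rpow_ne_top_of_nonneg hp.le ha)
        ((lpQuasiNorm_le_iff hp).1 h.lp_le)
    · refine ne_top_of_le_ne_top (ENNReal.rpow_ne_top_of_nonneg hp.le ha)
        ((lpQuasiNorm_le_iff hp).1 (le_trans (le_of_eq ?_) hga))
      simp only [mixedNorm, lqQuasiNorm, if_true, hG]
  have hgrad : ∀ x ∉ E, ∀ y ∉ E, ‖u x - u y‖ₑ ≤ ENNReal.ofReal (dist x y ^ s) * (H x + H y) := by
    intro x hx y hy
    rcases eq_or_ne x y with rfl | hne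
    · simp
    obtain ⟨k, h1, h2⟩ := exists_dyadic_scale (dist_pos.2 hne)
    refine (Hg k x hx y hy h1 h2).trans ?_
    gcongr
    · exact (le_iSup (fun k => g k x) k).trans (le_max_right _ _)
    · exact (le_iSup (fun k => g k y) k).trans (le_max_right _ _)
  have hlim := (tendsto_lpQuasiNorm_indicator_gt hp hHm hfin)
  have hlim4 : Tendsto (fun n : ℕ => 4 * lpQuasiNorm μ p ({x | (n : ℝ≥0∞) < H x}.indicator H))
      atTop (𝓝 (4 * 0)) := ENNReal.Tendsto.const_mul hlim (Or.inr (by norm_num))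
  rw [mul_zero] at hlim4
  obtain ⟨n, hn⟩ := (hlim4.eventually_lt_const hε).exists
  set A : Set X := {x | x ∉ E ∧ H x ≤ n} with hA
  obtain ⟨v, hvA, hvb, hvc⟩ : ∃ v : X → ℝ, (∀ x ∈ A, v x = u x) ∧ (∀ x, |v x| ≤ n) ∧
      ∀ x y, |v x - v y| ≤ 2 * n * dist x y ^ s := by
    rcases A.eq_empty_or_nonempty with hemp | hne
    · refine ⟨fun _ => 0, fun x hx => by simp [hemp] at hx, fun x => by simp, fun x y => ?_⟩
      simp only [sub_self, abs_zero]
      positivity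
    · refine exists_holder_extension hne hs hs1 (by positivity) (by positivity) (fun x hx => ?_)
        fun x hx y hy => ?_
      · have h1 := (huH x).trans hx.2
        rw [Real.enorm_eq_ofReal_abs] at h1
        have h2 := (ENNReal.ofReal_le_iff_le_toReal (ENNReal.natCast_ne_top n)).1 h1
        simpa using h2
      · have h1 := (hgrad x hx.1 y hy.1).trans (mul_le_mul_right (add_le_add hx.2 hy.2) _)
        rw [Real.enorm_eq_ofReal_abs, ← two_mul] at h1
        have h3 : (2 * n : ℝ≥0∞) = ENNReal.ofReal (2 * n) := by
          rw [ENNReal.ofReal_mul (by norm_num)]; simp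
        rw [h3, ← ENNReal.ofReal_mul (by positivity)] at h1
        rw [mul_comm]
        exact (ENNReal.ofReal_le_ofReal_iff (by positivity)).1 h1
  have hcont := continuous_of_holder hs hvc
  have hvb' : ∀ x, ‖v x‖ₑ ≤ n := by
    intro x
    rw [Real.enorm_eq_ofReal_abs]
    exact (ENNReal.ofReal_le_ofReal (hvb x)).trans (by simp)
  have hvc' : ∀ x y, ‖v x - v y‖ₑ ≤ ENNReal.ofReal (dist x y ^ s) * (2 * n) := by
    intro x y
    rw [Real.enorm_eq_ofReal_abs]
    refine (ENNReal.ofReal_le_ofReal (hvc x y)).trans (le_of_eq ?_)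
    rw [mul_comm, ENNReal.ofReal_mul (by positivity), ENNReal.ofReal_mul (by norm_num)]
    simp
  have hsub : ∀ x y : X, ‖u x - v x - (u y - v y)‖ₑ ≤ ‖u x - u y‖ₑ + ‖v x - v y‖ₑ := by
    intro x y
    rw [sub_sub_sub_comm]
    exact enorm_sub_le
  -- The 4 is needed for a pair with only `x` in `{H > n}`: then `H x + H y + 2 * n ≤ H x + 3 * n ≤
  -- 4 * H x`.
  set f : X → ℝ≥0∞ := fun x => 4 * {x | (n : ℝ≥0∞) < H x}.indicator H x with hf
  have hfm : AEMeasurable f μ :=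
    (hHm.indicator₀ (nullMeasurableSet_lt aemeasurable_const hHm)).const_mul _
  have hflt : ∀ x, (n : ℝ≥0∞) < H x → f x = 4 * H x := by
    intro x hx
    simp only [hf]
    rw [indicator_of_mem (by exact hx)]
  have hfn : lpQuasiNorm μ p f ≤ ε := by
    rw [hf, lpQuasiNorm_const_mul hp (by norm_num)]
    exact hn.le
  have hmix : ∀ x y, x ∉ E → y ∉ E → (n : ℝ≥0∞) < H x →
      ‖u x - v x - (u y - v y)‖ₑ ≤ ENNReal.ofReal (dist x y ^ s) * (f x + f y) := by
    intro x y hx hy hxn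
    refine (hsub x y).trans ((add_le_add (hgrad x hx y hy) (hvc' x y)).trans ?_)
    rw [← mul_add]
    refine mul_le_mul_right ?_ _
    rw [hflt x hxn]
    rcases lt_or_ge (n : ℝ≥0∞) (H y) with hyn | hyn
    · rw [hflt y hyn]
      calc H x + H y + 2 * n ≤ H x + H y + 2 * H x := by gcongr
        _ ≤ H x + H y + 2 * H x + (H x + 3 * H y) := le_self_add
        _ = 4 * H x + 4 * H y := by ring
    · calc H x + H y + 2 * n ≤ H x + n + 2 * n := by gcongr
        _ = H x + 3 * n := by ring
        _ ≤ H x + 3 * H x := by gcongr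
        _ = 4 * H x := by ring
        _ ≤ _ := le_self_add
  refine ⟨v, hcont, h.1.sub hcont.measurable.aemeasurable, ?_, fun _ => f, ⟨fun _ => hfm, E, hE,
    fun k x hx y hy _ _ => ?_⟩, ?_⟩
  · refine (lpQuasiNorm_mono_ae hp ?_).trans hfn
    filter_upwards [measure_eq_zero_iff_ae_notMem.1 hE] with x hx
    rcases lt_or_ge (n : ℝ≥0∞) (H x) with hxn | hxn
    · rw [hflt x hxn]
      calc ‖u x - v x‖ₑ ≤ ‖u x‖ₑ + ‖v x‖ₑ := enorm_sub_le
        _ ≤ H x + H x := add_le_add (huH x) ((hvb' x).trans hxn.le)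
        _ ≤ H x + H x + 2 * H x := le_self_add
        _ = 4 * H x := by ring
    · rw [hvA x ⟨hx, hxn⟩]
      simp
  · rw [abs_coe_sub_coe]
    rcases lt_or_ge (n : ℝ≥0∞) (H x) with hxn | hxn
    · exact hmix x y hx hy hxn
    rcases lt_or_ge (n : ℝ≥0∞) (H y) with hyn | hyn
    · have := hmix y x hy hx hyn
      rw [enorm_sub_rev, dist_comm, add_comm (f y)] at this
      exact this
    · rw [hvA x ⟨hx, hxn⟩, hvA y ⟨hy, hyn⟩]
      simp
  · simp only [mixedNorm, lqQuasiNorm, if_true, iSup_const]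
    exact hfn

end HolderApproximation

/-! ### Lipschitz averaging -/

section Smoothing

variable {X : Type*} [MetricSpace X] [MeasurableSpace X] [BorelSpace X] {μ : Measure X} {Q : ℝ}

/-- `v` is the average of `w` against the kernel `max 0 (r - dist x z)`, which is Lipschitz in `x`.
Both conclusions are local: `w` need not be integrable elsewhere, and the value of the quotient
there is irrelevant. -/
theorem exists_smoothing (hμ : BallsPosFinite μ) (hdim : HasDoublingDimension μ Q) :
    ∃ C : ℝ, 0 < C ∧ ∀ r : ℝ, 0 < r → ∀ w : X → ℝ, Measurable w → ∃ v : X → ℝ,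
      ∀ (x : X) (c A : ℝ), (∀ z ∈ Metric.ball x (2 * r), |w z - c| ≤ A) →
        |v x - c| ≤ A ∧ ∀ y, dist x y < r → |v x - v y| ≤ C * (dist x y / r) * A := by
  obtain ⟨D, hD, HD⟩ := hdim.exists_doubling hμ (M := 4) (by norm_num)
  refine ⟨4 * (D.toReal + 1), by positivity, fun r hr w hw => ?_⟩
  set φ : X → X → ℝ := fun x z => max 0 (r - dist x z) with hφ
  have hφ0 : ∀ x z, 0 ≤ φ x z := fun x z => le_max_left _ _
  have hφr : ∀ x z, φ x z ≤ r := fun x z =>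
    max_le hr.le (by linarith [dist_nonneg (x := x) (y := z)])
  have hφc : ∀ x, Continuous (φ x) := fun x => by fun_prop
  have hφz : ∀ x z, r ≤ dist x z → φ x z = 0 := fun x z h => max_eq_left (by linarith)
  have hφd : ∀ x y z, |φ x z - φ y z| ≤ dist x y := by
    intro x y z
    refine (abs_max_sub_max_le_max _ _ _ _).trans (max_le (by simp) ?_)
    rw [sub_sub_sub_cancel_left, abs_sub_comm]
    exact abs_dist_sub_le x y z
  refine ⟨fun x => (∫ z, φ x z * w z ∂μ) / ∫ z, φ x z ∂μ, fun x c A hA => ?_⟩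
  have hA0 : 0 ≤ A := (abs_nonneg _).trans (hA x (Metric.mem_ball_self (by positivity)))
  set B := Metric.ball x (2 * r) with hB
  have hBm : MeasurableSet B := Metric.isOpen_ball.measurableSet
  have hBf : μ B ≠ ∞ := (hμ x _ (by positivity)).2.ne
  have hsupp : ∀ y, dist x y < r → ∀ z, z ∉ B → φ y z = 0 := by
    intro y hy z hz
    refine hφz y z ?_
    rw [hB, Metric.mem_ball', not_lt] at hz
    linarith [dist_triangle x y z]
  have hintB : ∀ (f : X → ℝ) {K : ℝ}, Measurable f → (∀ z ∈ B, |f z| ≤ K) → (∀ z, z ∉ B → f z = 0) →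
      Integrable f μ ∧ |∫ z, f z ∂μ| ≤ K * (μ B).toReal := by
    intro f K hf hK hf0
    have h1 : IntegrableOn f B μ :=
      Measure.integrableOn_of_bounded hBf hf.aestronglyMeasurable
        (by filter_upwards [ae_restrict_mem hBm] with z hz using hK z hz)
    refine ⟨(integrableOn_iff_integrable_of_support_subset fun z hz => ?_).1 h1, ?_⟩
    · by_contra hzB
      exact hz (hf0 z hzB)
    · rw [← setIntegral_eq_integral_of_forall_compl_eq_zero hf0]
      exact norm_setIntegral_le_of_norm_le_const (f := f) hBf.lt_top hK
  have hφB : ∀ y, dist x y < r → Integrable (φ y) μ := fun y hy =>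
    (hintB (φ y) (hφc y).measurable (fun z _ => by rw [abs_of_nonneg (hφ0 y z)]; exact hφr y z)
      (hsupp y hy)).1
  have hφw : ∀ y, dist x y < r → Integrable (fun z => φ y z * (w z - c)) μ := fun y hy =>
    (hintB (fun z => φ y z * (w z - c)) ((hφc y).measurable.mul (hw.sub_const c)) (K := r * A)
      (fun z hz => by
      rw [abs_mul, abs_of_nonneg (hφ0 y z)]
      exact mul_le_mul (hφr y z) (hA z hz) (abs_nonneg _) hr.le)
      (fun z hz => by rw [hsupp y hy z hz, zero_mul])).1
  set Φ : X → ℝ := fun y => ∫ z, φ y z ∂μ with hΦ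
  set N : X → ℝ := fun y => ∫ z, φ y z * (w z - c) ∂μ with hN
  have hΦlow : ∀ y, dist x y < r → r / 2 * (μ (Metric.ball y (r / 2))).toReal ≤ Φ y := by
    intro y hy
    have h1 : ∫ z in Metric.ball y (r / 2), r / 2 ∂μ ≤ ∫ z in Metric.ball y (r / 2), φ y z ∂μ := by
      refine setIntegral_mono_on (integrableOn_const (hμ y _ (by positivity)).2.ne)
        (hφB y hy).integrableOn Metric.isOpen_ball.measurableSet fun z hz => ?_
      rw [Metric.mem_ball'] at hz
      exact le_max_of_le_right (by linarith)
    rw [setIntegral_const, smul_eq_mul, mul_comm] at h1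
    exact h1.trans (setIntegral_le_integral (hφB y hy) (Eventually.of_forall fun z => hφ0 y z))
  have hΦpos : ∀ y, dist x y < r → 0 < Φ y := fun y hy =>
    (mul_pos (by positivity) (ENNReal.toReal_pos (hμ y _ (by positivity)).1.ne'
      (hμ y _ (by positivity)).2.ne)).trans_le (hΦlow y hy)
  have hvN : ∀ y, dist x y < r → (∫ z, φ y z * w z ∂μ) / Φ y = c + N y / Φ y := by
    intro y hy
    have h1 : ∫ z, φ y z * w z ∂μ = N y + c * Φ y := by
      rw [hN, hΦ]
      dsimp only
      rw [← integral_const_mul, ← integral_add (hφw y hy) ((hφB y hy).const_mul c)]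
      congr 1
      funext z
      ring
    rw [h1, add_div, mul_div_assoc, div_self (hΦpos y hy).ne', mul_one, add_comm]
  have hNA : ∀ y, dist x y < r → |N y / Φ y| ≤ A := by
    intro y hy
    rw [abs_div, abs_of_pos (hΦpos y hy), div_le_iff₀ (hΦpos y hy)]
    rw [hΦ]
    dsimp only
    rw [← integral_const_mul]
    refine norm_integral_le_of_norm_le (f := fun z => φ y z * (w z - c)) ((hφB y hy).const_mul A)
      (Eventually.of_forall fun z => ?_)
    rw [Real.norm_eq_abs, abs_mul, abs_of_nonneg (hφ0 y z), mul_comm]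
    by_cases hz : z ∈ B
    · exact mul_le_mul_of_nonneg_right (hA z hz) (hφ0 y z)
    · rw [hsupp y hy z hz]
      simp
  have hxx : dist x x < r := by simpa using hr
  refine ⟨?_, fun y hy => ?_⟩
  · dsimp only
    rw [hvN x hxx, add_sub_cancel_left]
    exact hNA x hxx
  · set d := dist x y
    have hd : 0 ≤ d := dist_nonneg
    set m := (μ B).toReal
    have hNN : |N x - N y| ≤ d * A * m := by
      rw [hN]
      dsimp only
      rw [← integral_sub (hφw x hxx) (hφw y hy)]
      refine (hintB (fun z => φ x z * (w z - c) - φ y z * (w z - c))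
        (((hφc x).measurable.mul (hw.sub_const c)).sub
        ((hφc y).measurable.mul (hw.sub_const c))) (fun z hz => ?_) fun z hz => ?_).2
      · rw [← sub_mul, abs_mul]
        exact mul_le_mul (hφd x y z) (hA z hz) (abs_nonneg _) hd
      · rw [hsupp x hxx z hz, hsupp y hy z hz]
        simp
    have hΦΦ : |Φ x - Φ y| ≤ d * m := by
      rw [hΦ]
      dsimp only
      rw [← integral_sub (hφB x hxx) (hφB y hy)]
      refine (hintB (fun z => φ x z - φ y z) ((hφc x).measurable.sub (hφc y).measurable)
        (fun z hz => hφd x y z)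
        fun z hz => ?_).2
      rw [hsupp x hxx z hz, hsupp y hy z hz, sub_self]
    dsimp only
    rw [hvN x hxx, hvN y hy, add_sub_add_left_eq_sub]
    have hpx := hΦpos x hxx
    have hpy := hΦpos y hy
    have hm0 : 0 ≤ m := ENNReal.toReal_nonneg
    -- This form of the quotient rule keeps only `Φ x` in the denominator and leaves `N y / Φ y`,
    -- already bounded by `A`.
    have h1 : N x / Φ x - N y / Φ y = ((N x - N y) - (N y / Φ y) * (Φ x - Φ y)) / Φ x := by
      field_simp
      ring
    have h2 : |(N x - N y) - (N y / Φ y) * (Φ x - Φ y)| ≤ 2 * d * A * m := by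
      refine (abs_sub _ _).trans ?_
      rw [abs_mul]
      have := mul_le_mul (hNA y hy) hΦΦ (abs_nonneg _) hA0
      linarith
    -- The kernel is at least `r / 2` only on the ball of radius `r / 2`, a quarter of the radius of
    -- `B`; hence doubling with factor 4.
    have h3 : m ≤ D.toReal * (μ (Metric.ball x (r / 2))).toReal := by
      have h := HD x x (r / 2) (by positivity) (by rw [dist_self]; positivity)
      have h4 : 4 * (r / 2) = 2 * r := by ring
      rw [h4] at h
      rw [← ENNReal.toReal_mul]
      exact ENNReal.toReal_mono (ENNReal.mul_ne_top hD (hμ x _ (by positivity)).2.ne) h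
    have h5 := hΦlow x hxx
    rw [h1, abs_div, abs_of_pos hpx, div_le_iff₀ hpx]
    refine h2.trans ?_
    set ν := (μ (Metric.ball x (r / 2))).toReal
    have hν : 0 ≤ ν := ENNReal.toReal_nonneg
    have hD0 : 0 ≤ D.toReal := ENNReal.toReal_nonneg
    calc 2 * d * A * m ≤ 2 * d * A * ((D.toReal + 1) * ν) := by
          gcongr
          nlinarith
      _ = 4 * (D.toReal + 1) * (d / r) * A * (r / 2 * ν) := by
          field_simp
          ring
      _ ≤ _ := by gcongr

end Smoothing

/-! ### Continuous approximation at a fixed scale -/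

section LocalApproximation

theorem add_rpow_le_two_rpow_mul {p : ℝ} (hp : 0 < p) (a b : ℝ≥0∞) :
    (a + b) ^ p ≤ 2 ^ p * (a ^ p + b ^ p) := by
  have h1 : a + b ≤ 2 * max a b := by
    rw [two_mul]
    exact add_le_add (le_max_left _ _) (le_max_right _ _)
  refine (ENNReal.rpow_le_rpow h1 hp.le).trans ?_
  rw [ENNReal.mul_rpow_of_nonneg _ _ hp.le]
  refine mul_le_mul_right ?_ _
  rcases max_choice a b with h | h <;> rw [h]
  exacts [le_self_add, le_add_self]

variable {X : Type*} [MetricSpace X] [MeasurableSpace X] [BorelSpace X] {μ : Measure X} {p Q : ℝ}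

omit [MetricSpace X] [BorelSpace X] in
-- For `p < 1` the mean of `u` is not a suitable constant. Instead take `c = u z` at a point `z`
-- where the integral of `|u - u z| ^ p` over `B` does not exceed its average in `z`; comparison
-- with `c'` costs the factor `2 * 2 ^ p`.
theorem exists_almost_minimizer [SFinite μ] (hp : 0 < p) {u : X → ℝ} (hu : Measurable u)
    {B : Set X} (h0 : μ B ≠ 0) (hB : μ B ≠ ∞) :
    ∃ c : ℝ, ∀ c' : ℝ, ∫⁻ z in B, ‖u z - c‖ₑ ^ p ∂μ ≤
      2 * 2 ^ p * ∫⁻ z in B, ‖u z - c'‖ₑ ^ p ∂μ := by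
  set f : X → ℝ≥0∞ := fun z' => ∫⁻ z in B, ‖u z - u z'‖ₑ ^ p ∂μ with hf
  have hfm : Measurable f := by
    have h1 : Measurable fun x : X × X => ‖u x.2 - u x.1‖ₑ ^ p :=
      (((hu.comp measurable_snd).sub (hu.comp measurable_fst)).enorm).pow_const p
    exact h1.lintegral_prod_right'
  obtain ⟨z, -, hz⟩ := exists_le_setLAverage h0 hB hfm.aemeasurable
  refine ⟨u z, fun c' => hz.trans ?_⟩
  set J := ∫⁻ z in B, ‖u z - c'‖ₑ ^ p ∂μ with hJ
  have hm : ∀ c : ℝ, Measurable fun z => ‖u z - c‖ₑ ^ p := fun c =>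
    (hu.sub_const c).enorm.pow_const p
  have h1 : ∀ z', f z' ≤ 2 ^ p * (J + ‖u z' - c'‖ₑ ^ p * μ B) := by
    intro z'
    calc f z' ≤ ∫⁻ z in B, 2 ^ p * (‖u z - c'‖ₑ ^ p + ‖u z' - c'‖ₑ ^ p) ∂μ := by
          refine lintegral_mono fun z => ?_
          refine le_trans (ENNReal.rpow_le_rpow ?_ hp.le) (add_rpow_le_two_rpow_mul hp _ _)
          rw [show u z - u z' = (u z - c') - (u z' - c') by ring]
          exact enorm_sub_le
      _ = _ := by
          rw [lintegral_const_mul _ ((hm c').add_const _), lintegral_add_left (hm c'),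
            setLIntegral_const]
  rw [setLAverage_eq]
  refine ENNReal.div_le_of_le_mul ?_
  calc ∫⁻ z' in B, f z' ∂μ ≤ ∫⁻ z' in B, 2 ^ p * (J + ‖u z' - c'‖ₑ ^ p * μ B) ∂μ :=
        lintegral_mono h1
    _ = 2 ^ p * (J * μ B + J * μ B) := by
        rw [lintegral_const_mul _ (((hm c').mul_const _).const_add _),
          lintegral_add_left measurable_const, setLIntegral_const, lintegral_mul_const _ (hm c')]
    _ = 2 * 2 ^ p * J * μ B := by ring

theorem measurable_measure_ball [SecondCountableTopology X] [SFinite μ] (R : ℝ) :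
    Measurable fun x => μ (Metric.ball x R) := by
  have hS : MeasurableSet {z : X × X | dist z.1 z.2 < R} :=
    measurableSet_lt measurable_dist measurable_const
  have := measurable_measure_prodMk_left (ν := μ) hS
  convert this using 3 with x
  ext y
  exact Metric.mem_ball'

theorem lintegral_ball_eq [SecondCountableTopology X] (f : X → ℝ≥0∞) (R : ℝ) (x : X) :
    ∫⁻ y in Metric.ball x R, f y ∂μ =
      ∫⁻ y, {z : X × X | dist z.1 z.2 < R}.indicator (fun z => f z.2) (x, y) ∂μ := by
  rw [← lintegral_indicator Metric.isOpen_ball.measurableSet]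
  refine lintegral_congr fun y => ?_
  by_cases hy : dist x y < R
  · rw [indicator_of_mem (Metric.mem_ball'.2 hy), indicator_of_mem (by exact hy)]
  · rw [indicator_of_notMem (fun h => hy (Metric.mem_ball'.1 h)), indicator_of_notMem (by exact hy)]

theorem measurable_lintegral_ball [SecondCountableTopology X] [SFinite μ] {f : X → ℝ≥0∞}
    (hf : Measurable f) (R : ℝ) : Measurable fun x => ∫⁻ y in Metric.ball x R, f y ∂μ := by
  simp_rw [lintegral_ball_eq]
  exact ((hf.comp measurable_snd).indicator
    (measurableSet_lt measurable_dist measurable_const)).lintegral_prod_right'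

/-- By Tonelli `f y` is weighted with the integral of `1 / μ(B(x,R))` over `x ∈ B(y,R)`, and
doubling bounds this by `D`. -/
theorem lintegral_average_ball_le [SecondCountableTopology X] [SFinite μ]
    (hμ : BallsPosFinite μ) {f : X → ℝ≥0∞} (hf : Measurable f) {R : ℝ} (hR : 0 < R) {D : ℝ≥0∞}
    (hD : ∀ x y, dist x y < R → μ (Metric.ball x R) ≤ D * μ (Metric.ball y R)) :
    ∫⁻ x, (∫⁻ y in Metric.ball x R, f y ∂μ) / μ (Metric.ball x R) ∂μ ≤ D * ∫⁻ x, f x ∂μ := by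
  set S : Set (X × X) := {z : X × X | dist z.1 z.2 < R} with hS
  have hSm : MeasurableSet S := measurableSet_lt measurable_dist measurable_const
  set G : X × X → ℝ≥0∞ := S.indicator fun z => f z.2 / μ (Metric.ball z.1 R) with hG
  have hGm : Measurable G := ((hf.comp measurable_snd).div
    ((measurable_measure_ball R).comp measurable_fst)).indicator hSm
  have h1 : ∀ x, (∫⁻ y in Metric.ball x R, f y ∂μ) / μ (Metric.ball x R) = ∫⁻ y, G (x, y) ∂μ := by
    intro x
    rw [lintegral_ball_eq, div_eq_mul_inv,
      ← lintegral_mul_const' _ _ (ENNReal.inv_ne_top.2 (hμ x R hR).1.ne')]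
    refine lintegral_congr fun y => ?_
    by_cases hy : dist x y < R
    · rw [hG, indicator_of_mem (by exact hy), indicator_of_mem (by exact hy), div_eq_mul_inv]
    · rw [hG, indicator_of_notMem (by exact hy), indicator_of_notMem (by exact hy), zero_mul]
  simp_rw [h1]
  rw [lintegral_lintegral_swap (f := fun x y => G (x, y)) hGm.aemeasurable,
    ← lintegral_const_mul _ hf]
  refine lintegral_mono fun y => ?_
  have h2 : ∀ x, G (x, y) ≤ (Metric.ball y R).indicator
      (fun _ => D * f y * (μ (Metric.ball y R))⁻¹) x := by
    intro x
    by_cases hy : dist x y < R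
    · rw [hG, indicator_of_mem (by exact hy), indicator_of_mem (by exact hy)]
      have h3 := hD y x (by rwa [dist_comm])
      have hx := hμ x R hR
      have hy' := hμ y R hR
      refine ENNReal.div_le_of_le_mul ?_
      calc f y = f y * (μ (Metric.ball y R) * (μ (Metric.ball y R))⁻¹) := by
            rw [ENNReal.mul_inv_cancel hy'.1.ne' hy'.2.ne, mul_one]
        _ ≤ f y * (D * μ (Metric.ball x R) * (μ (Metric.ball y R))⁻¹) := by gcongr
        _ = _ := by ring
    · rw [hG, indicator_of_notMem (by exact hy)]
      exact zero_le
  refine (lintegral_mono h2).trans ?_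
  rw [lintegral_indicator Metric.isOpen_ball.measurableSet, setLIntegral_const, mul_assoc,
    ENNReal.inv_mul_cancel (hμ y R hR).1.ne' (hμ y R hR).2.ne, mul_one]

open scoped Classical in
-- Cover `X` by balls of radius `r` centred at a dense sequence, let `w` take on each point the
-- almost minimizing constant of the first ball containing it, and smooth `w`. The error function
-- `O` depends on `H` through an average of `H ^ p` over one fixed radius, so no maximal function is
-- needed and every `p > 0` is allowed.
theorem exists_local_approx (hμ : BallsPosFinite μ) (hdim : HasDoublingDimension μ Q)
    (hp : 0 < p) :
    ∃ C : ℝ≥0∞, C ≠ ∞ ∧ ∀ r : ℝ, 0 < r → ∀ (u : X → ℝ) (H : X → ℝ≥0∞) (E : Set X),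
      Measurable u → Measurable H → ∫⁻ x, H x ^ p ∂μ ≠ ∞ → μ E = 0 →
      (∀ x ∉ E, ∀ y ∉ E, dist x y < 8 * r → ‖u x - u y‖ₑ ≤ H x + H y) →
      ∃ (v : X → ℝ) (O : X → ℝ≥0∞) (E' : Set X), Continuous v ∧ Measurable O ∧
        lpQuasiNorm μ p O ≤ C * lpQuasiNorm μ p H ∧ μ E' = 0 ∧ E ⊆ E' ∧
        ∀ x ∉ E', ‖u x - v x‖ₑ ≤ O x ∧ ∀ y, dist x y < r →
          ‖v x - v y‖ₑ ≤ C * ENNReal.ofReal (dist x y / r) * O x := by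
  have := hμ.sigmaFinite
  have := hμ.secondCountable
  obtain ⟨C₁, hC₁, HC₁⟩ := exists_smoothing hμ hdim
  obtain ⟨D, hD, HD⟩ := hdim.exists_doubling hμ (M := 8) (by norm_num)
  set κ : ℝ≥0∞ := 2 ^ p with hκ
  have hκt : κ ≠ ∞ := ENNReal.rpow_ne_top_of_nonneg hp.le (by norm_num)
  set Λ : ℝ≥0∞ := D * (κ * (2 * κ + 1) * κ) with hΛ
  have hΛt : Λ ≠ ∞ := by finiteness
  set C₂ : ℝ≥0∞ := (Λ * (1 + D)) ^ (1 / p) with hC₂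
  have hC₂t : C₂ ≠ ∞ := ENNReal.rpow_ne_top_of_nonneg (by positivity) (by finiteness)
  refine ⟨ENNReal.ofReal C₁ + C₂, by finiteness, fun r hr u H E hu hH hfin hE hgrad => ?_⟩
  rcases isEmpty_or_nonempty X with hX | hX
  · exact ⟨fun _ => 0, fun _ => 0, E, continuous_const, measurable_const,
      (lpQuasiNorm_mono hp fun x => hX.elim x).trans (by
        rw [lpQuasiNorm, lintegral_of_isEmpty, ENNReal.zero_rpow_of_pos (by positivity)]
        exact zero_le), hE, subset_rfl, fun x => hX.elim x⟩
  -- piecewise constant approximation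
  have hex : ∀ z : X, ∃ i : ℕ, dist z (TopologicalSpace.denseSeq X i) < r := by
    intro z
    obtain ⟨i, hi⟩ := (TopologicalSpace.denseRange_denseSeq X).exists_dist_lt z hr
    exact ⟨i, hi⟩
  choose c hc using fun i => exists_almost_minimizer (μ := μ) hp hu
    (hμ (TopologicalSpace.denseSeq X i) r hr).1.ne' (hμ (TopologicalSpace.denseSeq X i) r hr).2.ne
  have hwm : Measurable fun z => c (Nat.find (hex z)) :=
    (measurable_from_top (f := c)).comp (measurable_find hex fun i =>
      measurableSet_lt (measurable_id.dist measurable_const) measurable_const)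
  set w : X → ℝ := fun z => c (Nat.find (hex z)) with hw
  set O : X → ℝ≥0∞ := fun x => (Λ * (H x ^ p + (∫⁻ y in Metric.ball x (8 * r), H y ^ p ∂μ) /
    μ (Metric.ball x (8 * r)))) ^ (1 / p) with hO
  have hOm : Measurable O := (((hH.pow_const p).add ((measurable_lintegral_ball (hH.pow_const p)
    _).div (measurable_measure_ball _))).const_mul Λ).pow_const _
  have hOp : ∀ x, O x ^ p = Λ * (H x ^ p + (∫⁻ y in Metric.ball x (8 * r), H y ^ p ∂μ) /
      μ (Metric.ball x (8 * r))) := by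
    intro x
    rw [hO]
    dsimp only
    rw [← ENNReal.rpow_mul, one_div_mul_cancel hp.ne', ENNReal.rpow_one]
  have hOlp : lpQuasiNorm μ p O ≤ C₂ * lpQuasiNorm μ p H := by
    rw [lpQuasiNorm_le_iff hp, ENNReal.mul_rpow_of_nonneg _ _ hp.le, lpQuasiNorm_rpow hp, hC₂,
      ← ENNReal.rpow_mul, one_div_mul_cancel hp.ne', ENNReal.rpow_one]
    simp_rw [hOp]
    rw [lintegral_const_mul' _ _ hΛt, lintegral_add_left (hH.pow_const p), mul_assoc Λ (1 + D),
      add_mul, one_mul]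
    gcongr
    refine lintegral_average_ball_le hμ (hH.pow_const p) (by positivity) fun x y hxy => ?_
    refine (measure_mono (Metric.ball_subset_ball ?_)).trans (HD x y (8 * r) (by positivity) ?_)
    · linarith
    · rw [dist_comm]; linarith
  have hOfin : ∫⁻ x, O x ^ p ∂μ ≠ ∞ := by
    rw [← lpQuasiNorm_rpow hp]
    refine ENNReal.rpow_ne_top_of_nonneg hp.le (ne_top_of_le_ne_top ?_ hOlp)
    refine ENNReal.mul_ne_top hC₂t ?_
    exact ENNReal.rpow_ne_top_of_nonneg (by positivity) hfin
  -- Compare both `w z` and `u x` with `u` on the ball of radius `r` that defines `w z`. It lies in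
  -- `B(x, 8r)`, where the gradient inequality holds, and has comparable measure.
  have hkey : ∀ x ∉ E, ∀ z ∈ Metric.ball x (3 * r), ‖w z - u x‖ₑ ≤ O x := by
    intro x hx z hz
    rw [← ENNReal.rpow_le_rpow_iff hp, hOp]
    have hi := Nat.find_spec (hex z)
    set i := Nat.find (hex z) with hidef
    set b := TopologicalSpace.denseSeq X i with hb
    set J : ℝ → ℝ≥0∞ := fun c' => ∫⁻ y in Metric.ball b r, ‖u y - c'‖ₑ ^ p ∂μ with hJ
    have hsub : Metric.ball b r ⊆ Metric.ball x (8 * r) := by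
      intro y hy
      rw [Metric.mem_ball] at hy hz ⊢
      linarith [dist_triangle y b x, dist_triangle_left b x z]
    have hm : ∀ c : ℝ, Measurable fun z => ‖u z - c‖ₑ ^ p := fun c =>
      (hu.sub_const c).enorm.pow_const p
    have h1 : μ (Metric.ball b r) * ‖w z - u x‖ₑ ^ p ≤ κ * (J (c i) + J (u x)) := by
      calc μ (Metric.ball b r) * ‖w z - u x‖ₑ ^ p
          = ∫⁻ y in Metric.ball b r, ‖w z - u x‖ₑ ^ p ∂μ := by
            rw [setLIntegral_const, mul_comm]
        _ ≤ ∫⁻ y in Metric.ball b r, κ * (‖u y - c i‖ₑ ^ p + ‖u y - u x‖ₑ ^ p) ∂μ := by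
            refine lintegral_mono fun y => ?_
            refine le_trans (ENNReal.rpow_le_rpow ?_ hp.le)
              (add_rpow_le_two_rpow_mul hp _ _)
            rw [show w z - u x = (u y - u x) - (u y - c i) by rw [hw]; ring, add_comm]
            exact enorm_sub_le
        _ = _ := by
            rw [lintegral_const_mul' _ _ hκt, lintegral_add_left (hm _)]
    have h2 : J (u x) ≤ κ * ((∫⁻ y in Metric.ball x (8 * r), H y ^ p ∂μ) +
        μ (Metric.ball x (8 * r)) * H x ^ p) := by
      calc J (u x) ≤ ∫⁻ y in Metric.ball x (8 * r), ‖u y - u x‖ₑ ^ p ∂μ :=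
            lintegral_mono_set hsub
        _ ≤ ∫⁻ y in Metric.ball x (8 * r), κ * (H y ^ p + H x ^ p) ∂μ := by
            refine setLIntegral_mono_ae' Metric.isOpen_ball.measurableSet ?_
            filter_upwards [measure_eq_zero_iff_ae_notMem.1 hE] with y hy hyB
            exact (ENNReal.rpow_le_rpow (hgrad y hy x hx hyB) hp.le).trans
              (add_rpow_le_two_rpow_mul hp _ _)
        _ = _ := by
            rw [lintegral_const_mul _ ((hH.pow_const p).add_const _),
              lintegral_add_left (hH.pow_const p), setLIntegral_const, mul_comm (H x ^ p)]
    have h3 : μ (Metric.ball x (8 * r)) ≤ D * μ (Metric.ball b r) := by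
      refine HD x b r hr ?_
      rw [Metric.mem_ball] at hz
      linarith [dist_triangle_left b x z]
    have h0 := hμ x (8 * r) (by positivity)
    set m := μ (Metric.ball x (8 * r))
    set S := ∫⁻ y in Metric.ball x (8 * r), H y ^ p ∂μ
    have h4 : m * ‖w z - u x‖ₑ ^ p ≤ Λ * (S + m * H x ^ p) := by
      calc m * ‖w z - u x‖ₑ ^ p ≤ D * (μ (Metric.ball b r) * ‖w z - u x‖ₑ ^ p) := by
            rw [← mul_assoc]; gcongr
        _ ≤ D * (κ * (2 * κ * J (u x) + J (u x))) := by
            refine mul_le_mul_right (h1.trans (mul_le_mul_right (add_le_add_left ?_ _) _)) _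
            exact hc i (u x)
        _ = D * (κ * (2 * κ + 1) * J (u x)) := by ring
        _ ≤ D * (κ * (2 * κ + 1) * (κ * (S + m * H x ^ p))) := by gcongr
        _ = _ := by rw [hΛ]; ring
    calc ‖w z - u x‖ₑ ^ p = m * ‖w z - u x‖ₑ ^ p * m⁻¹ := by
          rw [mul_comm m, mul_assoc, ENNReal.mul_inv_cancel h0.1.ne' h0.2.ne, mul_one]
      _ ≤ Λ * (S + m * H x ^ p) * m⁻¹ := by gcongr
      _ = Λ * (m * m⁻¹ * H x ^ p + S * m⁻¹) := by ring
      _ = _ := by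
          rw [ENNReal.mul_inv_cancel h0.1.ne' h0.2.ne, one_mul, div_eq_mul_inv]
  obtain ⟨v, hv⟩ := HC₁ r hr w hwm
  set E' : Set X := E ∪ {x | O x = ∞} with hE'
  have hE'0 : μ E' = 0 := by
    refine measure_union_null hE ?_
    have h1 := ae_lt_top (hOm.pow_const p) hOfin
    refine measure_mono_null (fun x hx => ?_) (ae_iff.1 h1)
    have hx' : O x = ∞ := hx
    simp [hx', hp]
  have hreal : ∀ x ∉ E', ∀ z ∈ Metric.ball x (3 * r), |w z - u x| ≤ (O x).toReal := by
    intro x hx z hz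
    simp only [hE', mem_union, mem_ofPred_eq, not_or] at hx
    have h1 := hkey x hx.1 z hz
    rw [Real.enorm_eq_ofReal_abs] at h1
    exact (ENNReal.ofReal_le_iff_le_toReal hx.2).1 h1
  refine ⟨v, O, E', ?_, hOm, hOlp.trans (by gcongr; exact le_add_self), hE'0, subset_union_left,
    fun x hx => ?_⟩
  · refine continuous_iff_continuousAt.2 fun x => ?_
    -- Continuity is needed on the null set `E'` too. A nearby good point serves, since `B(x, 2r)`
    -- lies in `B(x', 3r)`; this is why the bound on `w` was proved at radius `3 * r`.
    obtain ⟨x', hx', hxE⟩ : ∃ x' ∈ Metric.ball x r, x' ∉ E' := by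
      by_contra! hcon
      exact (hμ x r hr).1.ne' (measure_mono_null hcon hE'0)
    have h1 := hv x (u x') (O x').toReal fun z hz => hreal x' hxE z (by
      rw [Metric.mem_ball] at hx' hz ⊢
      linarith [dist_triangle_right z x' x])
    rw [ContinuousAt, tendsto_iff_dist_tendsto_zero]
    have h2 : Tendsto (fun y => C₁ * (dist x y / r) * (O x').toReal) (𝓝 x)
        (𝓝 (C₁ * (dist x x / r) * (O x').toReal)) := by
      refine Continuous.tendsto ?_ x
      fun_prop
    rw [dist_self, zero_div, mul_zero, zero_mul] at h2
    refine squeeze_zero' (Eventually.of_forall fun _ => dist_nonneg) ?_ h2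
    filter_upwards [Metric.ball_mem_nhds x hr] with y hy
    rw [dist_comm, Real.dist_eq]
    exact h1.2 y (Metric.mem_ball'.1 hy)
  · have h1 := hv x (u x) (O x).toReal fun z hz => hreal x hx z
      (Metric.ball_subset_ball (by linarith) hz)
    have hOx : O x ≠ ∞ := fun h => hx (Or.inr h)
    refine ⟨?_, fun y hy => ?_⟩
    · rw [enorm_sub_rev, Real.enorm_eq_ofReal_abs]
      exact (ENNReal.ofReal_le_iff_le_toReal hOx).2 h1.1
    · rw [Real.enorm_eq_ofReal_abs]
      refine (ENNReal.ofReal_le_ofReal (h1.2 y hy)).trans ?_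
      rw [ENNReal.ofReal_mul (by positivity), ENNReal.ofReal_mul hC₁.le, ENNReal.ofReal_toReal hOx]
      gcongr
      exact le_self_add

end LocalApproximation

/-! ### Density of continuous functions -/

section Density

variable {X : Type*} [MetricSpace X] [MeasurableSpace X] {μ : Measure X} {F : Scale} {s p Q : ℝ}
  {q : ℝ≥0∞}

theorem tendsto_tsum_tail {b : ℤ → ℝ≥0∞} (hb : ∑' k, b k ≠ ∞) :
    Tendsto (fun n : ℕ => ∑' k : ℤ, if (n : ℤ) ≤ k then b k else 0) atTop (𝓝 0) := by
  have h : Tendsto (fun n : ℕ => ∫⁻ k : ℤ, (if (n : ℤ) ≤ k then b k else 0) ∂Measure.count) atTop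
      (𝓝 (∫⁻ _ : ℤ, 0 ∂Measure.count)) := by
    refine tendsto_lintegral_of_dominated_convergence b (fun n => measurable_from_top)
      (fun n => Eventually.of_forall fun k => ?_) (by rwa [lintegral_count])
      (Eventually.of_forall fun k => ?_)
    · dsimp only
      split_ifs
      exacts [le_rfl, zero_le]
    · refine tendsto_const_nhds.congr' ?_
      filter_upwards [eventually_gt_atTop k.toNat] with n hn
      rw [if_neg (by omega)]
  simpa only [lintegral_count, tsum_zero] using h

omit [MetricSpace X] [MeasurableSpace X] in
theorem tailSeq_of_le {m k : ℤ} (h : m ≤ k) (g : ℤ → X → ℝ≥0∞) : tailSeq m g k = g k :=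
  funext fun _ => if_pos h

omit [MetricSpace X] [MeasurableSpace X] in
theorem tailSeq_of_not_le {m k : ℤ} (h : ¬ m ≤ k) (g : ℤ → X → ℝ≥0∞) :
    tailSeq m g k = fun _ => 0 :=
  funext fun _ => if_neg h

omit [MetricSpace X] in
theorem aemeasurable_tailSeq {g : ℤ → X → ℝ≥0∞} (hg : ∀ k, AEMeasurable (g k) μ) (m k : ℤ) :
    AEMeasurable (tailSeq m g k) μ := by
  by_cases h : m ≤ k
  · rw [tailSeq_of_le h]; exact hg k
  · rw [tailSeq_of_not_le h]; exact aemeasurable_const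

omit [MetricSpace X] [MeasurableSpace X] in
theorem tailSeq_rpow_tsum {t : ℝ} (ht : 0 < t) (m : ℤ) (g : ℤ → X → ℝ≥0∞) (x : X) :
    ∑' k, tailSeq m g k x ^ t = ∑' k, if m ≤ k then g k x ^ t else 0 := by
  refine tsum_congr fun k => ?_
  unfold tailSeq
  split_ifs
  exacts [rfl, ENNReal.zero_rpow_of_pos ht]

omit [MetricSpace X] in
-- Tails of a convergent series vanish; for Triebel–Lizorkin this holds pointwise and passes to
-- `L^p` by dominated convergence. Tails in `l^∞` need not vanish, so `q = ∞` is treated separately.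
theorem tendsto_mixedNorm_tailSeq (hp : 0 < p) (hq : 0 < q) (hq' : q ≠ ∞) {g : ℤ → X → ℝ≥0∞}
    (hg : ∀ k, AEMeasurable (g k) μ) (hfin : mixedNorm μ p q g F ≠ ∞) :
    Tendsto (fun n : ℕ => mixedNorm μ p q (tailSeq n g) F) atTop (𝓝 0) := by
  have hqr := toReal_pos_of_lt_top hq hq'
  have root : ∀ {t : ℝ}, 0 < t → ∀ {a : ℕ → ℝ≥0∞}, Tendsto a atTop (𝓝 0) →
      Tendsto (fun n => a n ^ t) atTop (𝓝 0) := by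
    intro t ht a ha
    have h2 := (ENNReal.continuous_rpow_const (y := t)).tendsto 0 |>.comp ha
    rw [ENNReal.zero_rpow_of_pos ht] at h2
    exact h2
  have unroot : ∀ {t : ℝ}, 0 < t → ∀ {a : ℝ≥0∞}, a ^ (1 / t) ≠ ∞ → a ≠ ∞ := by
    intro t ht a ha htop
    rw [htop, ENNReal.top_rpow_of_pos (by positivity)] at ha
    exact ha rfl
  cases F
  · simp only [mixedNorm, lqQuasiNorm, if_neg hq'] at hfin ⊢
    refine root (by positivity) ((tendsto_tsum_tail (unroot hqr hfin)).congr fun n => ?_)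
    refine tsum_congr fun k => ?_
    by_cases h : (n : ℤ) ≤ k
    · rw [if_pos h, tailSeq_of_le h]
    · rw [if_neg h, tailSeq_of_not_le h]
      simp only [lpQuasiNorm, ENNReal.zero_rpow_of_pos hp, lintegral_zero]
      rw [ENNReal.zero_rpow_of_pos (by positivity), ENNReal.zero_rpow_of_pos hqr]
  · simp only [mixedNorm, lqQuasiNorm, if_neg hq', lpQuasiNorm] at hfin ⊢
    refine root (by positivity) ?_
    have hfin' := unroot hp hfin
    have hm : ∀ n : ℕ, AEMeasurable
        (fun x => ((∑' k, tailSeq n g k x ^ q.toReal) ^ (1 / q.toReal)) ^ p) μ := by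
      intro n
      exact ((AEMeasurable.tsum fun k =>
        (aemeasurable_tailSeq hg n k).pow_const _).pow_const _).pow_const _
    have hlim := tendsto_lintegral_of_dominated_convergence' (μ := μ)
      (F := fun (n : ℕ) x => ((∑' k, tailSeq n g k x ^ q.toReal) ^ (1 / q.toReal)) ^ p)
      (f := fun _ => 0) (fun x => ((∑' k, g k x ^ q.toReal) ^ (1 / q.toReal)) ^ p) hm
      (fun n => Eventually.of_forall fun x => ?_) hfin' ?_
    · simpa using hlim
    · refine ENNReal.rpow_le_rpow (ENNReal.rpow_le_rpow (ENNReal.tsum_le_tsum fun k =>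
        ENNReal.rpow_le_rpow ?_ hqr.le) (by positivity)) hp.le
      unfold tailSeq
      split_ifs
      exacts [le_rfl, zero_le]
    · have hm0 : AEMeasurable (fun x => ((∑' k, g k x ^ q.toReal) ^ (1 / q.toReal)) ^ p) μ :=
        ((AEMeasurable.tsum fun k => (hg k).pow_const _).pow_const _).pow_const _
      filter_upwards [ae_lt_top' hm0 hfin'] with x hx
      refine root hp (root (by positivity) ?_)
      simp_rw [tailSeq_rpow_tsum hqr]
      refine tendsto_tsum_tail fun htop => ?_
      rw [htop, ENNReal.top_rpow_of_pos (by positivity), ENNReal.top_rpow_of_pos hp] at hx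
      exact lt_irrefl _ hx

theorem lqQuasiNorm_shift (a : ℤ → ℝ≥0∞) (k : ℤ) :
    lqQuasiNorm q (fun j => a (j - k)) = lqQuasiNorm q a := by
  unfold lqQuasiNorm
  split_ifs
  · exact (Equiv.subRight k).iSup_comp (g := a)
  · congr 1
    exact (Equiv.subRight k).tsum_eq fun j => a j ^ q.toReal

/-- The sequence `2 ^ (-δ |l|)`. -/
noncomputable def geomSeq (δ : ℝ) (l : ℤ) : ℝ≥0∞ := ENNReal.ofReal (2 ^ (-(δ * |(l : ℝ)|)))

theorem lqQuasiNorm_geomSeq_ne_top {δ : ℝ} (hδ : 0 < δ) (hq : 0 < q) (hq' : q ≠ ∞) :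
    lqQuasiNorm q (geomSeq δ) ≠ ∞ := by
  have hqr := toReal_pos_of_lt_top hq hq'
  rw [lqQuasiNorm, if_neg hq']
  refine ENNReal.rpow_ne_top_of_nonneg (by positivity) ?_
  set t : ℝ := 2 ^ (-(δ * q.toReal)) with ht
  have ht1 : t < 1 := Real.rpow_lt_one_of_one_lt_of_neg (by norm_num) (by
    have : 0 < δ * q.toReal := by positivity
    linarith)
  have h1 : ∀ l : ℤ, geomSeq δ l ^ q.toReal = ENNReal.ofReal (t ^ l.natAbs) := by
    intro l
    rw [geomSeq, ENNReal.ofReal_rpow_of_nonneg (by positivity) hqr.le,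
      ← Real.rpow_mul (by norm_num), ht, ← Real.rpow_natCast, ← Real.rpow_mul (by norm_num)]
    congr 2
    rw [Nat.cast_natAbs]
    push_cast
    ring
  simp_rw [h1]
  refine Summable.tsum_ofReal_ne_top (Summable.of_nat_of_neg ?_ ?_)
  · simpa using summable_geometric_of_lt_one (by positivity) ht1
  · simpa using summable_geometric_of_lt_one (by positivity) ht1

/-- Here `t` is distance over smoothing radius. Below that radius the Lipschitz bound `t` beats `t ^
s` by `t ^ (1 - s)`. -/
theorem le_rpow_mul_geom {s δ t : ℝ} {l : ℤ} (ht : 0 < t) (hδ : δ ≤ 1 - s) (hs1 : s ≤ 1)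
    (hl : 0 ≤ l) (h : t ≤ 2 ^ (-l)) : t ≤ t ^ s * 2 ^ (-(δ * |(l : ℝ)|)) := by
  have hl' : (0 : ℝ) ≤ l := by exact_mod_cast hl
  calc t = t ^ s * t ^ (1 - s) := by
        rw [← Real.rpow_add ht]; simp
    _ ≤ t ^ s * ((2 : ℝ) ^ (-l)) ^ (1 - s) := by
        gcongr
    _ = t ^ s * 2 ^ (-((1 - s) * l)) := by
        rw [← Real.rpow_intCast, ← Real.rpow_mul (by norm_num)]
        congr 2
        push_cast
        ring
    _ ≤ _ := by
        rw [abs_of_nonneg hl']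
        gcongr
        norm_num

/-- Above the smoothing radius a bound without any power of the distance suffices, because `t ^ s`
is itself large. -/
theorem one_le_rpow_mul_geom {s δ t : ℝ} {l : ℤ} (hδ : δ ≤ s) (hs0 : 0 ≤ s)
    (hs1 : s ≤ 1) (hl : l < 0) (h : 2 ^ (-l - 1) ≤ t) :
    1 ≤ 2 * (t ^ s * 2 ^ (-(δ * |(l : ℝ)|))) := by
  have hl' : (l : ℝ) < 0 := by exact_mod_cast hl
  rw [abs_of_neg hl']
  calc (1 : ℝ) ≤ 2 ^ (1 - s + (s - δ) * -l) := by
        refine Real.one_le_rpow (by norm_num) ?_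
        have := mul_nonneg (sub_nonneg.2 hδ) (neg_pos.2 hl').le
        linarith
    _ = 2 * (((2 : ℝ) ^ (-l - 1)) ^ s * 2 ^ (-(δ * -l))) := by
        rw [← Real.rpow_intCast, ← Real.rpow_mul (by norm_num), ← Real.rpow_add (by norm_num)]
        nth_rewrite 2 [← Real.rpow_one 2]
        rw [← Real.rpow_add (by norm_num)]
        congr 1
        push_cast
        ring
    _ ≤ _ := by gcongr

theorem exists_measurable_gradient {u : X → ℝ} {g : ℤ → X → ℝ≥0∞} (hp : 0 < p)
    (hg : IsFractionalGradient μ s (fun x => (u x : EReal)) g) :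
    ∃ g', (∀ k, Measurable (g' k)) ∧ mixedNorm μ p q g' F ≤ mixedNorm μ p q g F ∧
      ∃ E : Set X, μ E = 0 ∧ ∀ k : ℤ, ∀ x ∉ E, ∀ y ∉ E,
        (2 : ℝ) ^ (-k - 1) ≤ dist x y → dist x y < (2 : ℝ) ^ (-k) →
          ‖u x - u y‖ₑ ≤ ENNReal.ofReal (dist x y ^ s) * (g' k x + g' k y) := by
  obtain ⟨hm, E, hE, H⟩ := hg
  simp only [abs_coe_sub_coe] at H
  refine ⟨fun k => (hm k).mk, fun k => (hm k).measurable_mk,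
    mixedNorm_mono_ae hp fun k => (hm k).ae_eq_mk.symm.le,
    E ∪ ⋃ k, {x | g k x ≠ (hm k).mk (g k) x},
    measure_union_null hE (measure_iUnion_null fun k => (hm k).ae_eq_mk), ?_⟩
  intro k x hx y hy h1 h2
  simp only [mem_union, mem_iUnion, mem_ofPred_eq, not_or, not_exists, not_not] at hx hy
  dsimp only
  rw [← hx.2 k, ← hy.2 k]
  exact H k x hx.1 y hy.1 h1 h2

/-- The difference `u - v` has a gradient made of the tail of `g` and of `O`, spread over the scales
with weights decaying geometrically away from the smoothing scale. Both parts have norm at most a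
constant times the norm of the tail. -/
theorem exists_continuous_approx_of_lt_top [BorelSpace X] (hμ : BallsPosFinite μ)
    (hdim : HasDoublingDimension μ Q) (hs : 0 < s) (hs1 : s < 1) (hp : 0 < p) (hq : 0 < q)
    (hq' : q ≠ ∞) {u : X → ℝ} (hu : Measurable u) {a : ℝ≥0∞} (ha : a ≠ ∞)
    (h : NormLE μ F s p q u a) {ε : ℝ≥0∞} (hε : 0 < ε) :
    ∃ v : X → ℝ, Continuous v ∧ NormLE μ F s p q (fun x => u x - v x) ε := by
  obtain ⟨g₀, hg₀, hg₀a⟩ := h.grad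
  obtain ⟨g, hgm, hg, E, hE, H⟩ := exists_measurable_gradient (F := F) (q := q) hp hg₀
  have hgam : ∀ k, AEMeasurable (g k) μ := fun k => (hgm k).aemeasurable
  have hgfin : mixedNorm μ p q g F ≠ ∞ := ne_top_of_le_ne_top ha (hg.trans hg₀a)
  have hτ := tendsto_mixedNorm_tailSeq hp hq hq' hgam hgfin
  set τ : ℕ → ℝ≥0∞ := fun n => mixedNorm μ p q (tailSeq n g) F with hτdef
  obtain ⟨C, hC, HC⟩ := exists_local_approx hμ hdim hp
  obtain ⟨C₁, hC₁, HC₁⟩ := exists_lpQuasiNorm_weightedSup_le μ F hp hq hs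
  -- `1 - s` is the decay available at scales finer than the smoothing radius and `s` at coarser
  -- ones; positivity requires `s < 1`.
  set δ : ℝ := min s (1 - s) with hδ
  have hδ0 : 0 < δ := lt_min hs (by linarith)
  have hΓ := lqQuasiNorm_geomSeq_ne_top hδ0 hq hq'
  set Γ := lqQuasiNorm q (geomSeq δ)
  set K := supConst p q
  have hK : K ≠ ∞ := supConst_ne_top hp
  set M : ℝ≥0∞ := 1 + Γ * ((C + 2) * (C * C₁ * ENNReal.ofReal (8 ^ s))) with hM
  have hMt : 2 * K ^ 2 * M + C * C₁ ≠ ∞ := by finiteness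
  obtain ⟨n, hn⟩ : ∃ n, (2 * K ^ 2 * M + C * C₁) * τ n < ε := by
    have h1 := ENNReal.Tendsto.const_mul hτ (Or.inr hMt)
    rw [mul_zero] at h1
    exact (h1.eventually_lt_const hε).exists
  -- The shift by 3 gives `8 * r = 2 ^ (-n)`, so the approximation sees only the gradients with
  -- index at least `n`.
  set k : ℤ := n + 3 with hk
  set r : ℝ := 2 ^ (-k) with hr
  have hr0 : 0 < r := by positivity
  have h8r : 8 * r = 2 ^ (-(n : ℤ)) := by
    rw [hr, hk, neg_add, zpow_add₀ (by norm_num)]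
    norm_num
    ring
  set L : X → ℝ≥0∞ := fun x => ENNReal.ofReal ((8 * r) ^ s) * weightedSup s n g x with hL
  have hLm : Measurable L :=
    (Measurable.iSup fun j : ℕ => (hgm (n + j)).const_mul _).const_mul _
  have hLlp : lpQuasiNorm μ p L ≤ ENNReal.ofReal ((8 * r) ^ s) * (C₁ * τ n) := by
    rw [hL, lpQuasiNorm_const_mul hp ENNReal.ofReal_ne_top]
    exact mul_le_mul_right (HC₁ n g hgam) _
  have hτt : τ n ≠ ∞ := ne_top_of_le_ne_top hgfin (mixedNorm_mono hp fun k x => by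
    unfold tailSeq
    split_ifs
    exacts [le_rfl, zero_le])
  have hLfin : ∫⁻ x, L x ^ p ∂μ ≠ ∞ := by
    rw [← lpQuasiNorm_rpow hp]
    exact ENNReal.rpow_ne_top_of_nonneg hp.le (ne_top_of_le_ne_top (by finiteness) hLlp)
  have hLgrad : ∀ x ∉ E, ∀ y ∉ E, dist x y < 8 * r → ‖u x - u y‖ₑ ≤ L x + L y := by
    intro x hx y hy hxy
    rw [h8r] at hxy
    have := enorm_sub_le_weightedSup H (σ := 0) hs.le n hx hy hxy
    rw [Real.rpow_zero, ENNReal.ofReal_one, one_mul, sub_zero, ← h8r] at this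
    exact this
  obtain ⟨v, O, E', hv, hOm, hO, hE', hEE', hvE⟩ := HC r hr0 u L E hu hLm hLfin hE hLgrad
  have hOlp : lpQuasiNorm μ p O ≤ C * C₁ * ENNReal.ofReal ((8 * r) ^ s) * τ n := by
    refine hO.trans ((mul_le_mul_right hLlp _).trans (le_of_eq ?_))
    ring
  -- The factor `r ^ (-s)` cancels the `(8 * r) ^ s` in the bound for `O`, so the resulting constant
  -- does not depend on `n`. `C` serves the fine scales and 2 the coarse ones.
  set B : ℝ≥0∞ := (C + 2) * ENNReal.ofReal (r ^ (-s)) with hB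
  have hBt : B ≠ ∞ := by finiteness
  have hBO : B * lpQuasiNorm μ p O ≤ (C + 2) * (C * C₁ * ENNReal.ofReal (8 ^ s)) * τ n := by
    refine (mul_le_mul_right hOlp _).trans (le_of_eq ?_)
    have h1 : ENNReal.ofReal (r ^ (-s)) * ENNReal.ofReal ((8 * r) ^ s) =
        ENNReal.ofReal (8 ^ s) := by
      rw [← ENNReal.ofReal_mul (by positivity), Real.mul_rpow (by norm_num) hr0.le, mul_left_comm,
        ← Real.rpow_add hr0, neg_add_cancel, Real.rpow_zero, mul_one]
    rw [hB, ← h1]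
    ring
  refine ⟨v, hv, NormLE.mono ⟨hu.aemeasurable.sub hv.measurable.aemeasurable, ?_,
    fun j x => tailSeq n g j x + geomSeq δ (j - k) * (B * O x),
    ⟨fun j => ?_, E', hE', fun j x hx y hy h1 h2 => ?_⟩, ?_⟩ hn.le⟩
  · refine (lpQuasiNorm_mono_ae hp (g := O) ?_).trans (hOlp.trans ?_)
    · filter_upwards [measure_eq_zero_iff_ae_notMem.1 hE'] with x hx using (hvE x hx).1
    · have h1 : ENNReal.ofReal ((8 * r) ^ s) ≤ 1 := by
        rw [← ENNReal.ofReal_one]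
        refine ENNReal.ofReal_le_ofReal (Real.rpow_le_one (by positivity) ?_ hs.le)
        rw [h8r, zpow_neg]
        exact inv_le_one_of_one_le₀ (one_le_zpow₀ (by norm_num) (by positivity))
      calc C * C₁ * ENNReal.ofReal ((8 * r) ^ s) * τ n ≤ C * C₁ * 1 * τ n := by gcongr
        _ ≤ _ := by rw [mul_one]; gcongr; exact le_add_self
  · exact (aemeasurable_tailSeq hgam n j).add ((hOm.aemeasurable.const_mul _).const_mul _)
  · rw [abs_coe_sub_coe]
    have hd : 0 < dist x y := lt_of_lt_of_le (by positivity) h1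
    set t := dist x y / r with ht
    have ht0 : 0 < t := by positivity
    have htd : ENNReal.ofReal (t ^ s) =
        ENNReal.ofReal (dist x y ^ s) * ENNReal.ofReal (r ^ (-s)) := by
      rw [← ENNReal.ofReal_mul (by positivity), ht, Real.div_rpow hd.le hr0.le,
        Real.rpow_neg hr0.le, div_eq_mul_inv]
    have ht1 : (2 : ℝ) ^ (-(j - k) - 1) ≤ t := by
      rw [ht, le_div_iff₀ hr0, hr, ← zpow_add₀ (by norm_num),
        show -(j - k) - 1 + -k = -j - 1 by ring]
      exact h1
    have ht2 : t < 2 ^ (-(j - k)) := by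
      rw [ht, div_lt_iff₀ hr0, hr, ← zpow_add₀ (by norm_num),
        show -(j - k) + -k = -j by ring]
      exact h2
    -- At fine scales use the gradient of `u` and the Lipschitz bound for `v`; at coarse scales
    -- bound `u - v` by `O` at both points.
    rcases le_or_gt k j with hkj | hkj
    · have hdr : dist x y < r := by
        refine h2.trans_le (zpow_le_zpow_right₀ (by norm_num) (by omega))
      have h3 := (hvE x hx).2 y hdr
      have h4 := H j x (fun hh => hx (hEE' hh)) y (fun hh => hy (hEE' hh)) h1 h2
      have htail : ∀ z, tailSeq n g j z = g j z := fun z => if_pos (by omega)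
      have h5 : ENNReal.ofReal t ≤ ENNReal.ofReal (t ^ s) * geomSeq δ (j - k) := by
        rw [geomSeq, ← ENNReal.ofReal_mul (by positivity)]
        exact ENNReal.ofReal_le_ofReal (le_rpow_mul_geom ht0 (min_le_right _ _) hs1.le (by omega)
          ht2.le)
      dsimp only
      rw [sub_sub_sub_comm, htail, htail]
      calc ‖u x - u y - (v x - v y)‖ₑ ≤ ‖u x - u y‖ₑ + ‖v x - v y‖ₑ := enorm_sub_le
        _ ≤ ENNReal.ofReal (dist x y ^ s) * (g j x + g j y) +
            C * (ENNReal.ofReal (dist x y ^ s) * ENNReal.ofReal (r ^ (-s)) *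
              geomSeq δ (j - k)) * O x := by
            refine add_le_add h4 (h3.trans ?_)
            rw [← htd]
            gcongr
        _ ≤ ENNReal.ofReal (dist x y ^ s) * (g j x + g j y) +
            (C + 2) * (ENNReal.ofReal (dist x y ^ s) * ENNReal.ofReal (r ^ (-s)) *
              geomSeq δ (j - k)) * (O x + O y) := by
            gcongr
            · exact le_self_add
            · exact le_self_add
        _ = _ := by rw [hB]; ring
    · have h5 : 1 ≤ 2 * (ENNReal.ofReal (t ^ s) * geomSeq δ (j - k)) := by
        rw [geomSeq, ← ENNReal.ofReal_mul (by positivity)]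
        have h6 := one_le_rpow_mul_geom (l := j - k) (min_le_left s (1 - s)) hs.le hs1.le
          (by omega) ht1
        have h7 := ENNReal.ofReal_le_ofReal h6
        rw [ENNReal.ofReal_one, ENNReal.ofReal_mul (by norm_num)] at h7
        simpa using h7
      calc ‖u x - v x - (u y - v y)‖ₑ ≤ ‖u x - v x‖ₑ + ‖u y - v y‖ₑ := enorm_sub_le
        _ ≤ 1 * (O x + O y) := by
            rw [one_mul]; exact add_le_add (hvE x hx).1 (hvE y hy).1
        _ ≤ 2 * (ENNReal.ofReal (dist x y ^ s) * ENNReal.ofReal (r ^ (-s)) *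
              geomSeq δ (j - k)) * (O x + O y) := by
            rw [← htd]
            gcongr
        _ ≤ (C + 2) * (ENNReal.ofReal (dist x y ^ s) * ENNReal.ofReal (r ^ (-s)) *
              geomSeq δ (j - k)) * (O x + O y) := by
            gcongr
            exact le_add_self
        _ = ENNReal.ofReal (dist x y ^ s) *
              (geomSeq δ (j - k) * (B * O x) + geomSeq δ (j - k) * (B * O y)) := by
            rw [hB]; ring
        _ ≤ _ := by
            gcongr
            · exact le_add_self
            · exact le_add_self
  · have hgeo : mixedNorm μ p q (fun j x => geomSeq δ (j - k) * (B * O x)) F =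
        Γ * (B * lpQuasiNorm μ p O) := by
      have hsh := lqQuasiNorm_shift (q := q) (geomSeq δ) k
      rw [mixedNorm_mul_of_seq hp hq (fun j => geomSeq δ (j - k)) (fun _ => ENNReal.ofReal_ne_top)
        (by rw [hsh]; exact hΓ) (fun x => B * O x), hsh, lpQuasiNorm_const_mul hp hBt]
    have hadd := mixedNorm_add_le (μ := μ) (F := F) (g := tailSeq n g)
      (h := fun j x => geomSeq δ (j - k) * (B * O x)) hp hq
      (aemeasurable_tailSeq hgam n) (fun j =>
        (hOm.aemeasurable.const_mul _).const_mul _) (a := M * τ n) ?_ ?_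
    · refine hadd.trans ?_
      rw [← mul_assoc]
      gcongr
      exact le_self_add
    · exact le_mul_of_one_le_left' le_self_add
    · rw [hgeo, hM, add_mul, mul_assoc Γ]
      exact (mul_le_mul_right hBO _).trans le_add_self

theorem exists_continuous_approx [BorelSpace X] (hμ : BallsPosFinite μ)
    (hdim : HasDoublingDimension μ Q) (hs : 0 < s) (hp : 0 < p) (hq : 0 < q)
    (hF : (s < 1 ∧ q < ∞) ∨ (F = Scale.triebelLizorkin ∧ s ≤ 1 ∧ q = ∞)) {u : X → ℝ}
    {a : ℝ≥0∞} (ha : a ≠ ∞) (h : NormLE μ F s p q u a) {ε : ℝ≥0∞} (hε : 0 < ε) :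
    ∃ v : X → ℝ, Continuous v ∧ NormLE μ F s p q (fun x => u x - v x) ε := by
  rcases hF with ⟨hs1, hq'⟩ | ⟨rfl, hs1, rfl⟩
  · have hmk := h.1.ae_eq_mk
    obtain ⟨v, hv, hvn⟩ := exists_continuous_approx_of_lt_top hμ hdim hs hs1 hp hq hq'.ne
      h.1.measurable_mk ha (h.congr_ae hp hmk) hε
    refine ⟨v, hv, hvn.congr_ae hp ?_⟩
    filter_upwards [hmk] with x hx using by rw [hx]
  · exact exists_continuous_approx_of_top hs hs1 hp ha h hε

end Density

/-! ### Quasicontinuous functions -/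

section Quasicontinuity

variable {X : Type*} [MetricSpace X] [MeasurableSpace X] {μ : Measure X} {F : Scale} {s p Q : ℝ}
  {q : ℝ≥0∞}

theorem eq_zero_of_forall_le_rpow (hp : 0 < p) {c : ℝ≥0∞} (hc : c ≠ ∞) {A : ℝ≥0∞}
    (h : ∀ b : ℝ≥0∞, b ≠ 0 → b ≠ ∞ → A ≤ (c * b) ^ p) : A = 0 := by
  have h1 : Tendsto (fun b : ℝ≥0∞ => (c * b) ^ p) (𝓝[>] 0) (𝓝 ((c * 0) ^ p)) := by
    refine Tendsto.mono_left ?_ nhdsWithin_le_nhds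
    exact ((ENNReal.continuous_rpow_const (y := p)).comp
      (ENNReal.continuous_const_mul hc)).tendsto 0
  rw [mul_zero, ENNReal.zero_rpow_of_pos hp] at h1
  refine le_antisymm (ge_of_tendsto h1 ?_) zero_le
  filter_upwards [Ioo_mem_nhdsGT (ENNReal.zero_lt_top)] with b hb using h b hb.1.ne' hb.2.ne

open scoped Classical in
-- The superlevel set is relatively open off an exceptional `E`, so adding an open `V ⊇ E` gives an
-- open set. There `max (|v| / λ) w`, with `w = 1` on `V`, is at least 1 almost everywhere. Choosing
-- the capacity of `E` below `(a / λ) ^ p` keeps both terms of the same size.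
theorem IsQuasicontinuous.capacity_gt_le (hp : 0 < p) (hq : 0 < q) {u : X → EReal}
    (hu : IsQuasicontinuous μ F s p q u) {v : X → ℝ} (huv : u =ᵐ[μ] fun x => (v x : EReal))
    {a : ℝ≥0∞} (ha : 0 < a) (ha' : a ≠ ∞) (hv : NormLE μ F s p q v a) {lam : ℝ} (hlam : 0 < lam) :
    capacity μ F s p q {x | (lam : EReal) < u x ∨ u x < ((-lam : ℝ) : EReal)} ≤
      (2 * (supConst p q ^ 2 * (ENNReal.ofReal lam⁻¹ * a))) ^ p := by
  have hl : ENNReal.ofReal lam⁻¹ ≠ 0 := (ENNReal.ofReal_pos.2 (inv_pos.2 hlam)).ne'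
  have hb0 : 0 < (ENNReal.ofReal lam⁻¹ * a) ^ p :=
    ENNReal.rpow_pos (pos_iff_ne_zero.2 (mul_ne_zero hl ha.ne'))
      (ENNReal.mul_ne_top ENNReal.ofReal_ne_top ha')
  obtain ⟨E, hE, hcont⟩ := hu _ hb0
  obtain ⟨w, V, hw, hV, hEV, hw1, -⟩ := exists_of_capacity_lt hp hE
  have hopen : IsOpen {y : EReal | (lam : EReal) < y ∨ y < ((-lam : ℝ) : EReal)} :=
    (isOpen_lt continuous_const continuous_id).union (isOpen_lt continuous_id continuous_const)
  obtain ⟨U, hU, hUeq⟩ := continuousOn_iff'.1 hcont _ hopen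
  have hvl : NormLE μ F s p q (fun x => |lam⁻¹ * v x|) (ENNReal.ofReal lam⁻¹ * a) := by
    have := (hv.const_mul hp hq lam⁻¹).abs hp
    rwa [Real.enorm_eq_ofReal_abs, abs_of_pos (inv_pos.2 hlam)] at this
  have hm : NormLE μ F s p q (fun x => max |lam⁻¹ * v x| (w x))
      (supConst p q ^ 2 * (ENNReal.ofReal lam⁻¹ * a)) := by
    refine NormLE.of_pair hp hq hvl hw (hvl.1.max hw.1) (fun x => ?_) fun x y => ?_
    · simp only [Real.enorm_eq_ofReal_abs, ← ENNReal.ofReal_max]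
      exact ENNReal.ofReal_le_ofReal abs_max_le_max_abs_abs
    · simp only [Real.enorm_eq_ofReal_abs, ← ENNReal.ofReal_max]
      exact ENNReal.ofReal_le_ofReal (abs_max_sub_max_le_max _ _ _ _)
  -- The capacity asks for the bound 1 at every point of the neighbourhood, so the test function is
  -- raised there on a null set.
  have hm' := hm.congr_ae (w := fun x => if x ∈ U ∪ V then max 1 (max |lam⁻¹ * v x| (w x)) else
    max |lam⁻¹ * v x| (w x)) hp (by
      filter_upwards [huv] with x hx
      split_ifs with hxUV
      · symm
        refine max_eq_right ?_
        by_cases hxV : x ∈ V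
        · exact le_max_of_le_right (hw1 x hxV).symm.le
        · have hxU : x ∈ U ∩ Eᶜ := ⟨hxUV.resolve_right hxV, fun h => hxV (hEV h)⟩
          rw [← hUeq] at hxU
          have h1 : (lam : EReal) < u x ∨ u x < ((-lam : ℝ) : EReal) := hxU.1
          rw [hx, EReal.coe_lt_coe_iff, EReal.coe_lt_coe_iff] at h1
          refine le_max_of_le_left ?_
          have h2 : lam ≤ |v x| := by
            rcases h1 with h1 | h1
            · exact h1.le.trans (le_abs_self _)
            · exact (by linarith : lam ≤ -v x).trans (neg_le_abs _)
          rw [abs_mul, abs_of_pos (inv_pos.2 hlam)]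
          calc (1 : ℝ) = lam⁻¹ * lam := (inv_mul_cancel₀ hlam.ne').symm
            _ ≤ _ := by gcongr
      · rfl)
  refine capacity_le_of_normLE hp hm' (hU.union hV) (fun x hx => ?_) fun x hx => ?_
  · by_cases hxE : x ∈ E
    · exact Or.inr (hEV hxE)
    · have h1 : x ∈ U ∩ Eᶜ := by
        rw [← hUeq]
        exact ⟨hx, hxE⟩
      exact Or.inl h1.1
  · rw [if_pos hx]
    exact le_max_left _ _

/-- A fast approximating sequence of continuous functions converges uniformly off open sets of small
capacity, namely where some later increment exceeds `2 ^ (-k)`. -/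
theorem exists_quasicontinuous_representative [BorelSpace X] (hp : 0 < p) (hq : 0 < q) {u : X → ℝ}
    (hu : ∀ ε : ℝ≥0∞, 0 < ε → ∃ v : X → ℝ, Continuous v ∧
      NormLE μ F s p q (fun x => u x - v x) ε) :
    ∃ v : X → ℝ, u =ᵐ[μ] v ∧
      ∀ ε : ℝ≥0∞, 0 < ε → ∃ E, capacity μ F s p q E < ε ∧ ContinuousOn v Eᶜ := by
  set K := supConst p q with hKdef
  have hK1 : 1 ≤ K := one_le_supConst hp
  have hK0 : K ≠ 0 := (zero_lt_one.trans_le hK1).ne'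
  have hKt : K ≠ ∞ := supConst_ne_top hp
  -- `K⁻¹ ^ k` absorbs the weights of the countable supremum; `4⁻¹ ^ k` absorbs the factor `2 ^ k`
  -- in `d` and leaves `2⁻¹ ^ k`.
  set e : ℕ → ℝ≥0∞ := fun k => (K⁻¹ * 4⁻¹) ^ k with he
  have he0 : ∀ k, 0 < e k := fun k => pos_iff_ne_zero.2 (pow_ne_zero _
    (mul_ne_zero (ENNReal.inv_ne_zero.2 hKt) (ENNReal.inv_ne_zero.2 (by norm_num))))
  have he4 : ∀ k, e k ≤ 4⁻¹ ^ k := fun k => pow_le_pow_left₀ zero_le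
    (mul_le_of_le_one_left' (ENNReal.inv_le_one.2 hK1)) k
  have hesucc : ∀ k, e (k + 1) ≤ e k := fun k =>
    pow_le_pow_of_le_one zero_le (mul_le_one' (ENNReal.inv_le_one.2 hK1)
      (ENNReal.inv_le_one.2 (by norm_num))) (Nat.le_succ k)
  choose v hv hvn using fun k => hu (e k) (he0 k)
  -- almost everywhere convergence
  have hae : ∀ᵐ x ∂μ, Tendsto (fun k => v k x) atTop (𝓝 (u x)) := by
    have h1 : ∫⁻ x, ∑' k, ‖u x - v k x‖ₑ ^ p ∂μ ≠ ∞ := by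
      rw [lintegral_tsum fun k => ((hvn k).1.enorm).pow_const p]
      refine ne_top_of_le_ne_top (b := ∑' k : ℕ, ((4⁻¹ : ℝ≥0∞) ^ p) ^ k) ?_
        (ENNReal.tsum_le_tsum fun k => ?_)
      · rw [ENNReal.tsum_geometric]
        refine ENNReal.inv_ne_top.2 (tsub_pos_of_lt (ENNReal.rpow_lt_one ?_ hp)).ne'
        exact ENNReal.inv_lt_one.2 (by norm_num)
      · refine ((lpQuasiNorm_le_iff hp).1 (hvn k).2).trans ?_
        rw [← ENNReal.rpow_natCast, ← ENNReal.rpow_mul, mul_comm p, ENNReal.rpow_mul,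
          ENNReal.rpow_natCast]
        exact ENNReal.rpow_le_rpow (he4 k) hp.le
    filter_upwards [ae_lt_top' (AEMeasurable.tsum fun k => ((hvn k).1.enorm).pow_const p) h1]
      with x hx
    have h2 := ENNReal.tendsto_atTop_zero_of_tsum_ne_top hx.ne
    have h3 := (ENNReal.continuous_rpow_const (y := 1 / p)).tendsto 0 |>.comp h2
    rw [ENNReal.zero_rpow_of_pos (by positivity)] at h3
    rw [tendsto_iff_edist_tendsto_0]
    refine h3.congr fun k => ?_
    rw [Function.comp_apply, ← ENNReal.rpow_mul, mul_one_div_cancel hp.ne', ENNReal.rpow_one,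
      edist_comm, edist_eq_enorm_sub]
  -- exceptional sets
  set d : ℕ → X → ℝ := fun k x => 2 ^ k * (v (k + 1) x - v k x) with hd
  have hdc : ∀ k, Continuous (d k) := fun k => ((hv (k + 1)).sub (hv k)).const_mul _
  have hdn : ∀ k, NormLE μ F s p q (d k) (2 ^ k * (2 * K ^ 2 * e k)) := by
    intro k
    have h1 := NormLE.sub hp hq (hvn k) ((hvn (k + 1)).mono (hesucc k))
    have h2 := h1.const_mul hp hq (2 ^ k)
    have h3 : ‖(2 : ℝ) ^ k‖ₑ = 2 ^ k := by
      rw [Real.enorm_eq_ofReal_abs, abs_of_pos (by positivity), ENNReal.ofReal_pow (by norm_num)]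
      norm_num
    rw [h3] at h2
    refine h2.congr_ae hp (Eventually.of_forall fun x => ?_)
    simp only [hd]
    ring
  set G : ℕ → Set X := fun m => ⋃ i : ℕ, {x | 1 < |d (m + i) x|} with hG
  have hGopen : ∀ m, IsOpen (G m) := fun m => isOpen_iUnion fun i =>
    isOpen_lt continuous_const (hdc (m + i)).abs
  have hGcap : ∀ m, capacity μ F s p q (G m) ≤ (4 * K ^ 3 * 2⁻¹ ^ m) ^ p := by
    intro m
    have h1 := NormLE.ciSup hp hq (fun i => ((hdn (m + i)).abs hp).clamp hp)
      (fun i x => ⟨clamp_nonneg _, clamp_le_one _⟩)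
    have h2 : K * ⨆ i : ℕ, K ^ i * (2 ^ (m + i) * (2 * K ^ 2 * e (m + i))) ≤
        2 * K ^ 3 * 2⁻¹ ^ m := by
      rw [ENNReal.mul_iSup]
      refine iSup_le fun i => ?_
      have h3 : K ^ (m + i) * 2 ^ (m + i) * e (m + i) = 2⁻¹ ^ (m + i) := by
        rw [he]
        dsimp only
        rw [← mul_pow, ← mul_pow]
        congr 1
        have h4 : (4⁻¹ : ℝ≥0∞) = 2⁻¹ * 2⁻¹ := by
          rw [← ENNReal.mul_inv (by norm_num) (by norm_num)]; norm_num
        calc K * 2 * (K⁻¹ * 4⁻¹) = (K * K⁻¹) * (2 * 2⁻¹) * 2⁻¹ := by rw [h4]; ring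
          _ = 2⁻¹ := by
            rw [ENNReal.mul_inv_cancel hK0 hKt, ENNReal.mul_inv_cancel (by norm_num) (by norm_num)]
            simp
      calc K * (K ^ i * (2 ^ (m + i) * (2 * K ^ 2 * e (m + i))))
          = 2 * K ^ 3 * (K ^ i * 2 ^ (m + i) * e (m + i)) := by ring
        _ ≤ 2 * K ^ 3 * (K ^ (m + i) * 2 ^ (m + i) * e (m + i)) := by
            gcongr
            omega
        _ ≤ 2 * K ^ 3 * 2⁻¹ ^ m := by
            rw [h3]
            gcongr 2 * K ^ 3 * ?_
            exact pow_le_pow_of_le_one zero_le (ENNReal.inv_le_one.2 (by norm_num)) (by omega)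
    refine (capacity_le_of_normLE hp (h1.mono h2) (hGopen m) subset_rfl fun x hx => ?_).trans
      (le_of_eq ?_)
    · obtain ⟨i, hi⟩ := mem_iUnion.1 hx
      refine (clamp_eq_one (le_of_lt hi)).symm.le.trans
        (le_ciSup (f := fun i => clamp |d (m + i) x|) (bddAbove_range_of_le_one fun i =>
          ⟨clamp_nonneg _, clamp_le_one _⟩) i)
    · congr 1
      ring
  -- Where `v k x` diverges the value is arbitrary; such points lie in every `G m`.
  refine ⟨fun x => limUnder atTop fun k => v k x, ?_, fun ε hε => ?_⟩
  · filter_upwards [hae] with x hx using hx.limUnder_eq.symm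
  obtain ⟨m, hm⟩ : ∃ m : ℕ, (4 * K ^ 3 * 2⁻¹ ^ m) ^ p < ε := by
    have h1 : Tendsto (fun m : ℕ => 4 * K ^ 3 * (2⁻¹ : ℝ≥0∞) ^ m) atTop (𝓝 (4 * K ^ 3 * 0)) :=
      ENNReal.Tendsto.const_mul (ENNReal.tendsto_pow_atTop_nhds_zero_of_lt_one
        (ENNReal.inv_lt_one.2 (by norm_num))) (Or.inr (by finiteness))
    have h2 := (ENNReal.continuous_rpow_const (y := p)).tendsto (4 * K ^ 3 * 0) |>.comp h1
    rw [mul_zero, ENNReal.zero_rpow_of_pos hp] at h2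
    exact (h2.eventually_lt_const hε).exists
  refine ⟨G m, (hGcap m).trans_lt hm, ?_⟩
  have hbound : ∀ x ∈ (G m)ᶜ, ∀ i, dist (v (m + i) x) (v (m + (i + 1)) x) ≤
      2⁻¹ ^ m * (2⁻¹ : ℝ) ^ i := by
    intro x hx i
    simp only [hG, mem_compl_iff, mem_iUnion, not_exists, mem_ofPred_eq, not_lt] at hx
    have h1 := hx i
    simp only [hd] at h1
    rw [abs_mul, abs_of_pos (by positivity)] at h1
    rw [dist_comm, Real.dist_eq, ← pow_add, inv_pow, ← one_div, le_div_iff₀ (by positivity),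
      mul_comm]
    exact h1
  refine TendstoUniformlyOn.continuousOn (F := fun i => v (m + i)) (p := atTop) ?_
    (Frequently.of_forall fun i => (hv (m + i)).continuousOn)
  rw [Metric.tendstoUniformlyOn_iff]
  intro η hη
  have h2 : Tendsto (fun i : ℕ => 2⁻¹ ^ m * (2⁻¹ : ℝ) ^ i / (1 - 2⁻¹)) atTop
      (𝓝 (2⁻¹ ^ m * 0 / (1 - 2⁻¹))) :=
    ((tendsto_pow_atTop_nhds_zero_of_lt_one (by norm_num) (by norm_num)).const_mul _).div_const _
  rw [mul_zero, zero_div] at h2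
  filter_upwards [h2.eventually_lt_const hη] with i hi x hx
  have hcs := cauchySeq_of_le_geometric (2⁻¹ : ℝ) (2⁻¹ ^ m) (by norm_num) (hbound x hx)
  obtain ⟨t, ht⟩ := cauchySeq_tendsto_of_complete hcs
  have ht' : Tendsto (fun k => v k x) atTop (𝓝 t) :=
    (tendsto_add_atTop_iff_nat m).1 (ht.congr fun i => by rw [add_comm])
  rw [ht'.limUnder_eq, dist_comm]
  exact (dist_le_of_le_geometric_of_tendsto (2⁻¹ : ℝ) (2⁻¹ ^ m) (by norm_num) (hbound x hx) ht
    i).trans_lt hi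

end Quasicontinuity

/-! ### Averages along the basis and the two main implications -/

section Averages

variable {X : Type*} [MetricSpace X] [MeasurableSpace X] {μ : Measure X} {F : Scale} {s p Q : ℝ}
  {q : ℝ≥0∞} {𝓑 : X → Set (Set X)}

omit [MeasurableSpace X] in
theorem mem_basisFilter (x : X) {ε : ℝ} (hε : 0 < ε) :
    {B | B ∈ 𝓑 x ∧ Metric.diam B < ε} ∈ basisFilter 𝓑 x :=
  mem_iInf_of_mem (⟨ε, hε⟩ : {ε : ℝ // 0 < ε}) (mem_principal_self _)

theorem IsBusemannFellerBasis.neBot (h : IsBusemannFellerBasis μ 𝓑) (x : X) :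
    (basisFilter 𝓑 x).NeBot := by
  have : Nonempty {ε : ℝ // 0 < ε} := ⟨⟨1, one_pos⟩⟩
  refine iInf_neBot_of_directed' (fun a b => ?_) fun ε => principal_neBot_iff.2 ?_
  · refine ⟨⟨min a b, lt_min a.2 b.2⟩, ?_, ?_⟩
    · exact principal_mono.2 fun B hB => ⟨hB.1, hB.2.trans_le (min_le_left _ _)⟩
    · exact principal_mono.2 fun B hB => ⟨hB.1, hB.2.trans_le (min_le_right _ _)⟩
  · exact h.exists_small x ε ε.2

omit [MetricSpace X] in
theorem avg_congr_ae {u v : X → EReal} (h : u =ᵐ[μ] v) (B : Set X) : avg μ u B = avg μ v B := by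
  unfold avg
  congr 1
  refine average_congr (ae_restrict_of_ae ?_)
  filter_upwards [h] with x hx
  rw [hx]

omit [MetricSpace X] [MeasurableSpace X] in
theorem absFun_coe (v : X → ℝ) :
    absFun (fun x => (v x : EReal)) = fun x => ((|v x| : ℝ) : EReal) := by
  funext x
  rw [absFun, EReal.abs_def, EReal.coe_ennreal_ofReal, max_eq_left (abs_nonneg _)]

/-- The averages of a function are close to its value at `x` if the function is close in the mean
to a continuous function which is close to it at `x`. -/
theorem eventually_abs_average_sub_le [BorelSpace X] (hμ : BallsPosFinite μ)
    (h𝓑 : IsBusemannFellerBasis μ 𝓑) {u v : X → ℝ} (hv : Continuous v) {x : X}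
    (hint : ∀ r, IntegrableOn (fun y => u y - v y) (Metric.ball x r) μ) {t lam : ℝ}
    (hlam : 0 < lam) (ht : |t - v x| ≤ lam)
    (h : ∀ᶠ B in basisFilter 𝓑 x, ⨍ y in B, |u y - v y| ∂μ ≤ 2 * lam) :
    ∀ᶠ B in basisFilter 𝓑 x, |(⨍ y in B, u y ∂μ) - t| ≤ 4 * lam := by
  obtain ⟨ε, hε, hεv⟩ := Metric.continuousAt_iff.1 hv.continuousAt lam hlam
  filter_upwards [h, mem_basisFilter x hε] with B hB hBx
  have hopen := h𝓑.isOpen x B hBx.1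
  have hxB := h𝓑.mem x B hBx.1
  have hbdd := h𝓑.isBounded x B hBx.1
  obtain ⟨R, hR⟩ := hbdd.subset_ball x
  have hR0 : 0 < R := by simpa using hR hxB
  have hfin : μ B ≠ ∞ := ne_top_of_le_ne_top (hμ x R hR0).2.ne (measure_mono hR)
  have hpos : μ B ≠ 0 := by
    obtain ⟨δ, hδ, hδB⟩ := Metric.isOpen_iff.1 hopen x hxB
    exact ((hμ x δ hδ).1.trans_le (measure_mono hδB)).ne'
  have hw : IntegrableOn (fun y => u y - v y) B μ := (hint R).mono_set hR
  have hnear : ∀ y ∈ B, |v y - v x| ≤ lam := by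
    intro y hy
    have h1 : dist y x < ε := (Metric.dist_le_diam_of_mem hbdd hy hxB).trans_lt hBx.2
    have h2 := hεv h1
    rw [Real.dist_eq] at h2
    exact h2.le
  have hvint : IntegrableOn (fun y => v y - t) B μ := by
    refine Measure.integrableOn_of_bounded (M := 2 * lam) hfin
      (hv.sub continuous_const).measurable.aestronglyMeasurable ?_
    filter_upwards [ae_restrict_mem hopen.measurableSet] with y hy
    have h1 := hnear y hy
    rw [Real.norm_eq_abs]
    rw [abs_le] at h1 ht ⊢
    constructor <;> linarith
  have huint : IntegrableOn (fun y => u y - t) B μ := by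
    refine (hw.add hvint).congr (Eventually.of_forall fun y => ?_)
    simp
  have hm : 0 < μ.real B := ENNReal.toReal_pos hpos hfin
  have hconst : IntegrableOn (fun _ : X => t) B μ := integrableOn_const hfin
  have hu : ∫ y in B, u y ∂μ = (∫ y in B, (u y - t) ∂μ) + t * μ.real B := by
    rw [mul_comm, ← smul_eq_mul, ← setIntegral_const, ← integral_add huint hconst]
    simp
  rw [setAverage_eq, smul_eq_mul, ← div_eq_inv_mul, div_le_iff₀ hm] at hB
  rw [setAverage_eq, smul_eq_mul, hu, mul_add, mul_comm t, inv_mul_cancel_left₀ hm.ne',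
    add_sub_cancel_right, abs_mul, abs_of_pos (inv_pos.2 hm), ← div_eq_inv_mul, div_le_iff₀ hm]
  calc |∫ y in B, (u y - t) ∂μ| ≤ ∫ y in B, (|u y - v y| + 2 * lam) ∂μ := by
        refine norm_integral_le_of_norm_le (f := fun y => u y - t)
          (hw.abs.add (integrableOn_const hfin)) ?_
        filter_upwards [ae_restrict_mem hopen.measurableSet] with y hy
        have h1 := hnear y hy
        rw [Real.norm_eq_abs]
        have h2 : u y - t = (u y - v y) + (v y - t) := by ring
        have h3 : |v y - t| ≤ 2 * lam := by
          rw [abs_le] at h1 ht ⊢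
          constructor <;> linarith
        rw [h2]
        exact (abs_add_le _ _).trans (by linarith)
    _ = (∫ y in B, |u y - v y| ∂μ) + 2 * lam * μ.real B := by
        rw [integral_add hw.abs (integrableOn_const hfin), setIntegral_const, smul_eq_mul,
          mul_comm (2 * lam)]
    _ ≤ _ := by linarith

theorem isQuasicontinuous_coe {v : X → ℝ}
    (hv : ∀ ε : ℝ≥0∞, 0 < ε → ∃ E, capacity μ F s p q E < ε ∧ ContinuousOn v Eᶜ) :
    IsQuasicontinuous μ F s p q fun x => (v x : EReal) := fun ε hε => by
  obtain ⟨E, hE, hc⟩ := hv ε hε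
  exact ⟨E, hE, continuous_coe_real_ereal.comp_continuousOn hc⟩

/-- Addition of extended reals is continuous wherever one summand is finite, and here `v` is
real-valued. -/
theorem IsQuasicontinuous.sub_coe {u : X → EReal} (hu : IsQuasicontinuous μ F s p q u) {v : X → ℝ}
    (hv : Continuous v) : IsQuasicontinuous μ F s p q fun x => u x - (v x : EReal) := by
  intro ε hε
  obtain ⟨E, hE, hc⟩ := hu ε hε
  refine ⟨E, hE, fun x hx => ?_⟩
  have h1 : ContinuousAt (fun z : EReal × EReal => z.1 + z.2) (u x, ((-v x : ℝ) : EReal)) :=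
    EReal.continuousAt_add (Or.inr (EReal.coe_ne_bot _)) (Or.inr (EReal.coe_ne_top _))
  have h2 : ContinuousWithinAt (fun y => (u y, ((-v y : ℝ) : EReal))) Eᶜ x :=
    (hc x hx).prodMk (continuous_coe_real_ereal.comp hv.neg).continuousWithinAt
  exact h1.comp_continuousWithinAt (f := fun y => (u y, ((-v y : ℝ) : EReal))) h2

/-- Convergence of averages quasieverywhere implies the capacitary weak type estimate. -/
theorem capacity_limsup_le_of_tendsto [BorelSpace X] (hp : 0 < p) (hq : 0 < q)
    (h𝓑 : IsBusemannFellerBasis μ 𝓑)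
    (happrox : ∀ (u : X → ℝ) (a : ℝ≥0∞), a ≠ ∞ → NormLE μ F s p q u a → ∀ ε : ℝ≥0∞, 0 < ε →
      ∃ v : X → ℝ, Continuous v ∧ NormLE μ F s p q (fun x => u x - v x) ε)
    (h : ∀ u : X → EReal, MemF μ F s p q u → IsQuasicontinuous μ F s p q u →
      ∃ E : Set X, capacity μ F s p q E = 0 ∧
        ∀ x ∉ E, Tendsto (avg μ u) (basisFilter 𝓑 x) (𝓝 (u x))) :
    ∃ C : ℝ≥0, ∀ u : X → EReal, MemF μ F s p q u → ∀ lam : ℝ, 0 < lam →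
      capacity μ F s p q {x | (lam : EReal) < limsup (avg μ (absFun u)) (basisFilter 𝓑 x)} ≤
        C * ENNReal.ofReal (lam ^ (-p)) * fNorm μ F s p q u ^ p := by
  set K := supConst p q with hK
  have hKt : K ≠ ∞ := supConst_ne_top hp
  have hK1 : 1 ≤ K := one_le_supConst hp
  have hC : (6 * K ^ 4) ^ p ≠ ∞ := ENNReal.rpow_ne_top_of_nonneg hp.le (by finiteness)
  refine ⟨((6 * K ^ 4) ^ p).toNNReal, fun u hu lam hlam => ?_⟩
  rw [ENNReal.coe_toNNReal hC]
  set c := (6 * K ^ 4) ^ p * ENNReal.ofReal (lam ^ (-p)) with hc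
  have hct : c ≠ ∞ := by finiteness
  have key : ∀ a, fNorm μ F s p q u < a → a ≠ ∞ →
      capacity μ F s p q {x | (lam : EReal) < limsup (avg μ (absFun u)) (basisFilter 𝓑 x)} ≤
        c * a ^ p := by
    intro a hua ha
    have ha0 : 0 < a := zero_le.trans_lt hua
    have hn := normLE_of_fNorm_lt hu.1 hp hua
    obtain ⟨v, huv, hv⟩ := exists_quasicontinuous_representative hp hq (happrox _ a ha hn)
    have hva : NormLE μ F s p q (fun x => |v x|) a := (hn.congr_ae hp huv).abs hp
    have hvq : IsQuasicontinuous μ F s p q fun x => ((|v x| : ℝ) : EReal) :=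
      isQuasicontinuous_coe fun ε hε => by
        obtain ⟨E, hE, hcont⟩ := hv ε hε
        exact ⟨E, hE, hcont.abs⟩
    -- The hypothesis is applied to `|v|`, whose averages coincide with those of `|u|`.
    obtain ⟨E, hE, hlim⟩ := h _ (hva.memF hp ha (ae_eq_refl _)) hvq
    have hl : ENNReal.ofReal lam⁻¹ ≠ 0 := (ENNReal.ofReal_pos.2 (inv_pos.2 hlam)).ne'
    set b := K ^ 2 * (ENNReal.ofReal lam⁻¹ * a) with hb
    have hb0 : b ≠ 0 := mul_ne_zero (pow_ne_zero _ (zero_lt_one.trans_le hK1).ne')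
      (mul_ne_zero hl ha0.ne')
    have hbt : b ≠ ∞ := by finiteness
    have hweak := hvq.capacity_gt_le hp hq (ae_eq_refl _) ha0 ha hva hlam
    -- Enlarging 2 to 3 supplies the strict inequality that `capacity_union_le` requires.
    have h2b : 2 * b < 3 * b := ENNReal.mul_lt_mul_left hb0 hbt (by norm_num)
    have hunion := capacity_union_le hp hq (b := 3 * b)
      (by rw [hE]; exact ENNReal.rpow_pos (pos_iff_ne_zero.2 (mul_ne_zero (by norm_num) hb0))
            (by finiteness))
      (hweak.trans_lt (ENNReal.rpow_lt_rpow h2b hp))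
    have hsub : {x | (lam : EReal) < limsup (avg μ (absFun u)) (basisFilter 𝓑 x)} ⊆
        E ∪ {x | (lam : EReal) < ((|v x| : ℝ) : EReal) ∨
          ((|v x| : ℝ) : EReal) < ((-lam : ℝ) : EReal)} := by
      intro x hx
      by_cases hxE : x ∈ E
      · exact Or.inl hxE
      · refine Or.inr (Or.inl ?_)
        have := h𝓑.neBot x
        have havg : avg μ (absFun u) = avg μ fun x => ((|v x| : ℝ) : EReal) := by
          funext B
          refine avg_congr_ae ?_ B
          filter_upwards [hu.1.coe_toReal_ae, huv] with y hy1 hy2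
          rw [← congrFun (absFun_coe v) y, absFun, absFun, ← hy2, hy1]
        rw [mem_ofPred_eq, havg, (hlim x hxE).limsup_eq] at hx
        exact hx
    refine (capacity_mono hsub).trans (hunion.trans (le_of_eq ?_))
    have h1 : 2 * (K ^ 2 * (3 * b)) = 6 * K ^ 4 * ENNReal.ofReal lam⁻¹ * a := by
      rw [hb]; ring
    rw [← hK, h1, ENNReal.mul_rpow_of_nonneg _ _ hp.le, ENNReal.mul_rpow_of_nonneg _ _ hp.le,
      ENNReal.ofReal_rpow_of_nonneg (by positivity) hp.le, Real.inv_rpow hlam.le,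
      ← Real.rpow_neg hlam.le]
  -- The estimate holds for every `a` above the norm, possibly zero, so let `a` decrease to it.
  have hlim : Tendsto (fun a : ℝ≥0∞ => c * a ^ p) (𝓝[>] fNorm μ F s p q u)
      (𝓝 (c * fNorm μ F s p q u ^ p)) := by
    refine Tendsto.mono_left ?_ nhdsWithin_le_nhds
    exact ((ENNReal.continuous_const_mul hct).comp
      (ENNReal.continuous_rpow_const (y := p))).tendsto _
  have : (𝓝[>] fNorm μ F s p q u).NeBot := nhdsGT_neBot_of_exists_gt ⟨∞, hu.2⟩
  refine ge_of_tendsto hlim ?_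
  filter_upwards [Ioo_mem_nhdsGT hu.2] with a ha using key a ha.1 ha.2.ne

/-- If the capacities of the superlevel sets of the upper averages tend to zero along null
sequences, then the averages of quasicontinuous functions converge quasieverywhere. -/
theorem tendsto_avg_of_tendsto_capacity [BorelSpace X] (hμ : BallsPosFinite μ) (hp : 0 < p)
    (hq : 0 < q) (h𝓑 : IsBusemannFellerBasis μ 𝓑)
    (hint : ∀ (u : X → ℝ) (a : ℝ≥0∞), a ≠ ∞ → NormLE μ F s p q u a → ∀ (x : X) (r : ℝ),
      IntegrableOn u (Metric.ball x r) μ)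
    (happrox : ∀ (u : X → ℝ) (a : ℝ≥0∞), a ≠ ∞ → NormLE μ F s p q u a → ∀ ε : ℝ≥0∞, 0 < ε →
      ∃ v : X → ℝ, Continuous v ∧ NormLE μ F s p q (fun x => u x - v x) ε)
    (h : ∀ lam : ℝ, 0 < lam → ∀ u : ℕ → X → EReal, (∀ k, MemF μ F s p q (u k)) →
      Tendsto (fun k => fNorm μ F s p q (u k)) atTop (𝓝 0) →
      Tendsto (fun k => capacity μ F s p q
        {x | (lam : EReal) < limsup (avg μ (absFun (u k))) (basisFilter 𝓑 x)}) atTop (𝓝 0))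
    {u : X → EReal} (hu : MemF μ F s p q u) (huq : IsQuasicontinuous μ F s p q u) :
    ∃ E : Set X, capacity μ F s p q E = 0 ∧
      ∀ x ∉ E, Tendsto (avg μ u) (basisFilter 𝓑 x) (𝓝 (u x)) := by
  set K := supConst p q with hK
  have hKt : K ≠ ∞ := supConst_ne_top hp
  obtain ⟨a, ha, hn⟩ := hu.exists_normLE hp
  set e : ℕ → ℝ≥0∞ := fun k => 2⁻¹ ^ k with he
  have he0 : ∀ k, 0 < e k := fun k => pos_iff_ne_zero.2 (pow_ne_zero _
    (ENNReal.inv_ne_zero.2 (by norm_num)))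
  have het : ∀ k, e k ≠ ∞ := fun k => ENNReal.pow_ne_top (ENNReal.inv_ne_top.2 (by norm_num))
  have hetend : Tendsto e atTop (𝓝 0) :=
    ENNReal.tendsto_pow_atTop_nhds_zero_of_lt_one (ENNReal.inv_lt_one.2 (by norm_num))
  have mul_tend : ∀ c : ℝ≥0∞, c ≠ ∞ → Tendsto (fun k => c * e k) atTop (𝓝 0) := by
    intro c hc
    have := ENNReal.Tendsto.const_mul hetend (Or.inr hc)
    rwa [mul_zero] at this
  choose v hv hvn using fun k => happrox _ a ha hn (e k) (he0 k)
  set f : ℕ → X → ℝ := fun k x => (u x).toReal - v k x with hf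
  have hfF : ∀ k, MemF μ F s p q fun x => (f k x : EReal) := fun k =>
    (hvn k).memF hp (het k) (ae_eq_refl _)
  have hfn : Tendsto (fun k => fNorm μ F s p q fun x => (f k x : EReal)) atTop (𝓝 0) :=
    tendsto_of_tendsto_of_tendsto_of_le_of_le tendsto_const_nhds (mul_tend 2 (by norm_num))
      (fun _ => zero_le) fun k => (hvn k).fNorm_le hp (ae_eq_refl _)
  -- A point is also bad when `u` is infinite there, so that off the bad sets the limit is real.
  set Bad : ℝ → Set X := fun lam => {x | ¬ ∃ t : ℝ, u x = t ∧
    ∀ᶠ B in basisFilter 𝓑 x, |(⨍ y in B, (u y).toReal ∂μ) - t| ≤ 4 * lam} with hBad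
  have hnull : ∀ lam : ℝ, 0 < lam → capacity μ F s p q (Bad lam) = 0 := by
    intro lam hlam
    refine eq_zero_of_forall_le_rpow (c := 2 * K ^ 2) hp (by finiteness) fun b hb0 hbt => ?_
    have hbp : 0 < b ^ p := ENNReal.rpow_pos (pos_iff_ne_zero.2 hb0) hbt
    have h1 := (h lam hlam _ hfF hfn).eventually_lt_const hbp
    have h2 := (mul_tend (2 * (K ^ 2 * ENNReal.ofReal lam⁻¹)) (by finiteness)).eventually_lt_const
      (pos_iff_ne_zero.2 hb0)
    obtain ⟨k, hk1, hk2⟩ := (h1.and h2).exists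
    have hae : (fun x => u x - (v k x : EReal)) =ᵐ[μ] fun x => (f k x : EReal) := by
      filter_upwards [hu.1.coe_toReal_ae] with x hx
      rw [hf]
      dsimp only
      rw [EReal.coe_sub, hx]
    have hweak := (huq.sub_coe (hv k)).capacity_gt_le hp hq hae (he0 k) (het k) (hvn k) hlam
    have hk3 : 2 * (supConst p q ^ 2 * (ENNReal.ofReal lam⁻¹ * e k)) < b := by
      refine lt_of_eq_of_lt ?_ hk2
      rw [hK]
      ring
    have hunion := capacity_union_le hp hq hk1 (hweak.trans_lt (ENNReal.rpow_lt_rpow hk3 hp))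
    rw [mul_assoc]
    -- For every `k` a bad point has upper averages of `|u - v k|` above `lam` or lies where `|u - v
    -- k| > lam`; this `k` makes both capacities less than `b ^ p`.
    refine (capacity_mono fun x hx => ?_).trans hunion
    by_contra hcon
    simp only [mem_union, mem_ofPred_eq, not_or, not_lt] at hcon
    obtain ⟨hc1, hc2, hc3⟩ := hcon
    refine hx ?_
    -- Infinite values are excluded, since subtracting the real `v k x` leaves them outside `[-lam,
    -- lam]`.
    induction hux : u x with
    | bot =>
      rw [hux, sub_eq_add_neg, EReal.bot_add] at hc3
      exact absurd hc3 (not_le.2 (EReal.bot_lt_coe _))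
    | top =>
      rw [hux, EReal.top_sub_coe] at hc2
      exact absurd hc2 (not_le.2 (EReal.coe_lt_top _))
    | coe t =>
      refine ⟨t, rfl, ?_⟩
      rw [hux, ← EReal.coe_sub, EReal.coe_le_coe_iff] at hc2 hc3
      refine eventually_abs_average_sub_le hμ h𝓑 (hv k)
        (fun r => hint _ (e k) (het k) (hvn k) x r) hlam (abs_le.2 ⟨hc3, hc2⟩) ?_
      have hlt : limsup (avg μ (absFun fun x => (f k x : EReal))) (basisFilter 𝓑 x) <
          ((2 * lam : ℝ) : EReal) := hc1.trans_lt (EReal.coe_lt_coe_iff.2 (by linarith))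
      filter_upwards [eventually_lt_of_limsup_lt hlt] with B hB
      rw [absFun_coe, avg, EReal.coe_lt_coe_iff] at hB
      exact hB.le
  refine ⟨⋃ n : ℕ, Bad (1 / ((n : ℝ) + 1)), capacity_iUnion_null hp hq fun n =>
    hnull _ (by positivity), fun x hx => ?_⟩
  have hx : ∀ n : ℕ, x ∉ Bad (1 / ((n : ℝ) + 1)) := fun n hn => hx (mem_iUnion.2 ⟨n, hn⟩)
  replace hx := fun n => not_not.1 (hx n)
  obtain ⟨t, ht, -⟩ := hx 0
  rw [ht]
  unfold avg
  refine (continuous_coe_real_ereal.tendsto t).comp ?_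
  rw [Metric.tendsto_nhds]
  intro ε hε
  obtain ⟨n, hn⟩ := exists_nat_one_div_lt (show 0 < ε / 4 by positivity)
  obtain ⟨t', ht', hB⟩ := hx n
  have htt : t = t' := by
    rw [ht] at ht'
    exact_mod_cast ht'
  filter_upwards [hB] with B hB
  rw [Real.dist_eq, htt]
  linarith

end Averages

end HajlaszAverages

/-! ### The cycle of implications -/

open HajlaszAverages
theorem mainTheorem6 {X : Type*} [MetricSpace X] [MeasurableSpace X] [BorelSpace X]
    (μ : Measure X) (hμ : BallsPosFinite μ)
    (Q : ℝ) (hQ : 0 < Q) (hdim : HasDoublingDimension μ Q)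
    (𝓑 : X → Set (Set X)) (h𝓑 : IsBusemannFellerBasis μ 𝓑)
    (F : Scale) (s p : ℝ) (q : ℝ≥0∞) (hs : 0 < s) (hp : Q / (Q + s) < p) (hq : 0 < q)
    (hF : (s < 1 ∧ q < ∞) ∨ (F = Scale.triebelLizorkin ∧ s ≤ 1 ∧ q = ∞)) :
    (∀ u : X → EReal, MemF μ F s p q u → ∀ (x : X) (r : ℝ),
      IntegrableOn (fun y => (u y).toReal) (Metric.ball x r) μ) ∧
    List.TFAE [
      ∀ u : X → EReal, MemF μ F s p q u → IsQuasicontinuous μ F s p q u →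
        ∃ E : Set X, capacity μ F s p q E = 0 ∧
          ∀ x ∉ E, Tendsto (avg μ u) (basisFilter 𝓑 x) (𝓝 (u x)),
      ∃ C : ℝ≥0, ∀ u : X → EReal, MemF μ F s p q u → ∀ lam : ℝ, 0 < lam →
        capacity μ F s p q {x | (lam : EReal) < limsup (avg μ (absFun u)) (basisFilter 𝓑 x)} ≤
          C * ENNReal.ofReal (lam ^ (-p)) * fNorm μ F s p q u ^ p,
      ∀ lam : ℝ, 0 < lam → ∀ u : ℕ → X → EReal, (∀ k, MemF μ F s p q (u k)) →
        Tendsto (fun k => fNorm μ F s p q (u k)) atTop (𝓝 0) →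
        Tendsto (fun k => capacity μ F s p q
          {x | (lam : EReal) < limsup (avg μ (absFun (u k))) (basisFilter 𝓑 x)}) atTop (𝓝 0)] := by
  have hp0 : 0 < p := lt_trans (by positivity) hp
  have hint : ∀ (u : X → ℝ) (a : ℝ≥0∞), a ≠ ∞ → NormLE μ F s p q u a → ∀ (x : X) (r : ℝ),
      IntegrableOn u (Metric.ball x r) μ := fun u a ha h x r =>
    h.integrableOn_ball hμ hQ hdim hs hp hq ha x r
  have happrox : ∀ (u : X → ℝ) (a : ℝ≥0∞), a ≠ ∞ → NormLE μ F s p q u a → ∀ ε : ℝ≥0∞, 0 < ε →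
      ∃ v : X → ℝ, Continuous v ∧ NormLE μ F s p q (fun x => u x - v x) ε :=
    fun u a ha h ε hε => exists_continuous_approx hμ hdim hs hp0 hq hF ha h hε
  refine ⟨fun u hu x r => ?_, ?_⟩
  · obtain ⟨a, ha, hn⟩ := hu.exists_normLE hp0
    exact hint _ a ha hn x r
  tfae_have 1 → 2 := capacity_limsup_le_of_tendsto hp0 hq h𝓑 happrox
  tfae_have 2 → 3 := by
    rintro ⟨C, hC⟩ lam hlam u hu hlim
    have h1 : Tendsto (fun k => C * ENNReal.ofReal (lam ^ (-p)) * fNorm μ F s p q (u k) ^ p) atTop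
        (𝓝 0) := by
      have h2 := (ENNReal.continuous_rpow_const (y := p)).tendsto 0 |>.comp hlim
      rw [ENNReal.zero_rpow_of_pos hp0] at h2
      have h3 := ENNReal.Tendsto.const_mul (a := C * ENNReal.ofReal (lam ^ (-p))) h2
        (Or.inr (by finiteness))
      rwa [mul_zero] at h3
    exact tendsto_of_tendsto_of_tendsto_of_le_of_le tendsto_const_nhds h1 (fun _ => zero_le)
      fun k => hC (u k) (hu k) lam hlam
  tfae_have 3 → 1 := fun h u hu huq =>
    tendsto_avg_of_tendsto_capacity hμ hp0 hq h𝓑 hint happrox h hu huq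
  tfae_finish
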